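/- Let $M$ be a smooth finite-dimensional manifold (Hausdorff, second countable) with a Poisson structure $\pi$, $\{f,g\}_\pi=\sum_{i,j}\pi_{ij}\,\partial_{x_i}f\,\partial_{x_j}g$, and let $\pi^\#:T^*M\to TM$ be given by $(\pi^\#\xi)_i=\sum_j\pi_{ij}\xi_j$, so that $\{f,g\}_\pi=df(\pi^\# dg)$. Let $\tau:T^*M\to M$ be the cotangent projection, let $\omega=\sum_i dp_i\wedge dx_i$ be the canonical symplectic form of $T^*M$, and let $\{\cdot,\cdot\}_\omega$ be its Poisson bracket, normalised by $\{x_i,x_j\}_\omega=\{p_i,p_j\}_\omega=0$ and $\{x_i,p_j\}_\omega=\delta_{ij}$. A *Poisson spray* is a smooth vector field $X$ on $T^*M$ with $d_\xi\tau\,(X(\xi))=\pi^\#(\xi)$ for all $\xi\in T^*M$ and $m_\lambda^*X=\lambda X$ for all real $\lambda\neq 0$, where $m_\lambda:T^*M\to T^*M$ is the fibrewise multiplication by $\lambda$. Let $\Phi^s_X$ be its flow, and, wherever the flow exists up to time $1$, let $\Omega=\int_0^1(\Phi^s_X)^*\omega\,ds$. A *bi-realisation* of $(M,\pi)$ consists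 of an open neighbourhood $W\subset T^*M$ of the zero section and two smooth surjective submersions $\alpha,\beta:W\to M$ such that $\alpha(0_x)=\beta(0_x)=x$ for all $x\in M$; $\alpha$ is a Poisson map and $\beta$ is an anti-Poisson map from $(W,\{\cdot,\cdot\}_\omega)$ to $(M,\pi)$, i.e. $\{f\circ\alpha,g\circ\alpha\}_\omega=\{f,g\}_\pi\circ\alpha$ and $\{f\circ\beta,g\circ\beta\}_\omega=-\{f,g\}_\pi\circ\beta$ for all $f,g\in C^\infty(M)$; and the fibres of $\alpha$ and $\beta$ are symplectically orthogonal: $\omega(u,v)=0$ whenever $u\in\ker d_p\alpha$, $v\in\ker d_p\beta$, $p\in W$. **Theorem.** Any Poisson spray $X$ for $(M,\pi)$ induces a bi-realisation of $(M,\pi)$. Precisely, there are open neighbourhoods $W$ and $V$ of the zero section in $T^*M$ and a diffeomorphism $\psi:W\to V$ such that 1. $\psi(0_x)=0_x$ for all $x\in M$; 2. for every $p\in V$ and $s\in[0,1]$ the flow $\Phi^s_X(p)$ is defined, and $(s,p)\mapsto\Phi^s_X(p)$ is smooth on $[0,1]\times V$; 3. $\psi^*\Omega=\omega$ on $W$;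 4. $W$ with $\alpha=\tau\circ\psi$ and $\beta=\tau\circ\Phi^1_X\circ\psi$ is a bi-realisation of $(M,\pi)$. -/

import Mathlib

open scoped Manifold ContDiff Topology
open Set

noncomputable section

section Cotangent

variable (E : Type*) [NormedAddCommGroup E] [NormedSpace ℝ E]
  (M : Type*) [TopologicalSpace M] [ChartedSpace E M]

/-- The fibre `T*_x M` of the cotangent bundle of a manifold `M` modelled on `E`. -/
abbrev CotangentSpace (x : M) : Type _ :=
  TangentSpace 𝓘(ℝ, E) x →L[ℝ] Bundle.Trivial M ℝ x

/-- The total space `T*M` of the cotangent bundle: pairs `⟨x, ξ⟩` with `ξ ∈ T*_x M`. Topology, charts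
and smooth structure are those of Mathlib's bundle of continuous linear maps from the tangent
bundle to the trivial line bundle. -/
abbrev CotangentBundle : Type _ := Bundle.TotalSpace (E →L[ℝ] ℝ) (CotangentSpace E M)

/-- The model with corners of `T*M`; its model vector space is `E × E*`. -/
abbrev cotangentModel : ModelWithCorners ℝ (E × (E →L[ℝ] ℝ)) (ModelProd E (E →L[ℝ] ℝ)) :=
  𝓘(ℝ, E).prod 𝓘(ℝ, E →L[ℝ] ℝ)

end Cotangent

section Definitions

variable {E : Type*} [NormedAddCommGroup E] [NormedSpace ℝ E]
  {M : Type*} [TopologicalSpace M] [ChartedSpace E M]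

/-- The cotangent projection `τ : T*M → M`. -/
def cotangentProj (p : CotangentBundle E M) : M := p.1

/-- The point `0_x` of the zero section of `T*M`. -/
def zeroCovector (x : M) : CotangentBundle E M := ⟨x, 0⟩

/-- The fibrewise multiplication `m_c : T*M → T*M`, `ξ ↦ c ξ`. -/
def fibreMul (c : ℝ) (p : CotangentBundle E M) : CotangentBundle E M := ⟨p.1, c • p.2⟩

/-! ### Poisson structures -/

/-- For a field `x ↦ P x` of linear maps `T*_x M → T_x M`, the bracket
`{f, g}(x) = d_x f (P x (d_x g))`. In coordinates it is
`∑ i j, π_{ij} (∂f / ∂x_i) (∂g / ∂x_j)`, where `(P x ξ)_i = ∑ j, π_{ij} ξ_j`. -/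
def tensorBracket (P : ∀ x : M, CotangentSpace E M x →L[ℝ] TangentSpace 𝓘(ℝ, E) x)
    (f g : M → ℝ) (x : M) : ℝ :=
  mvfderiv 𝓘(ℝ, E) f x (P x (mvfderiv 𝓘(ℝ, E) g x))

variable [IsManifold 𝓘(ℝ, E) ∞ M]

variable (E M) in
/-- A Poisson structure on `M`: a smooth tensor field `π`, viewed through
`π^# : T*M → TM`, `(π^# ξ)_i = ∑ j, π_{ij} ξ_j`, whose bracket on smooth functions is skew-symmetric
and satisfies the Jacobi identity. -/
structure PoissonStructure where
  /-- The bundle map `π^#`. -/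
  sharp : ∀ x : M, CotangentSpace E M x →L[ℝ] TangentSpace 𝓘(ℝ, E) x
  contMDiff_sharp : ContMDiff 𝓘(ℝ, E) (𝓘(ℝ, E).prod 𝓘(ℝ, (E →L[ℝ] ℝ) →L[ℝ] E)) ∞
    (fun x ↦ Bundle.TotalSpace.mk' ((E →L[ℝ] ℝ) →L[ℝ] E)
      (E := fun x : M ↦ CotangentSpace E M x →L[ℝ] TangentSpace 𝓘(ℝ, E) x) x (sharp x))
  skew : ∀ f g : M → ℝ, ContMDiff 𝓘(ℝ, E) 𝓘(ℝ, ℝ) ∞ f → ContMDiff 𝓘(ℝ, E) 𝓘(ℝ, ℝ) ∞ g →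
    ∀ x, tensorBracket sharp f g x = -tensorBracket sharp g f x
  jacobi : ∀ f g h : M → ℝ, ContMDiff 𝓘(ℝ, E) 𝓘(ℝ, ℝ) ∞ f →
    ContMDiff 𝓘(ℝ, E) 𝓘(ℝ, ℝ) ∞ g → ContMDiff 𝓘(ℝ, E) 𝓘(ℝ, ℝ) ∞ h →
    ∀ x, tensorBracket sharp (tensorBracket sharp f g) h x
      + tensorBracket sharp (tensorBracket sharp g h) f x
      + tensorBracket sharp (tensorBracket sharp h f) g x = 0

/-- The Poisson bracket `{f, g}_π`. -/
def PoissonStructure.bracket (π : PoissonStructure E M) (f g : M → ℝ) : M → ℝ :=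
  tensorBracket π.sharp f g

/-! ### The canonical symplectic form of the cotangent bundle -/

variable (E) in
/-- The bilinear form `((a, α), (b, β)) ↦ α b - β a` on `E × E*`, i.e. `∑ i, dp_i ∧ dx_i`. -/
def canonicalFormModel : (E × (E →L[ℝ] ℝ)) →L[ℝ] (E × (E →L[ℝ] ℝ)) →L[ℝ] ℝ :=
  LinearMap.mkContinuous₂
    (LinearMap.mk₂ ℝ (fun u v : E × (E →L[ℝ] ℝ) ↦ u.2 v.1 - v.2 u.1)
      (fun u u' v ↦ by simp; ring) (fun c u v ↦ by simp; ring)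
      (fun u v v' ↦ by simp; ring) (fun c u v ↦ by simp; ring)) 2
    (fun u v ↦ by
      have h1 : ‖u.2 v.1‖ ≤ ‖u‖ * ‖v‖ := (u.2.le_opNorm v.1).trans (by
        gcongr
        · exact norm_snd_le u
        · exact norm_fst_le v)
      have h2 : ‖v.2 u.1‖ ≤ ‖u‖ * ‖v‖ := (v.2.le_opNorm u.1).trans (by
        rw [mul_comm]
        gcongr
        · exact norm_fst_le u
        · exact norm_snd_le v)
      have h3 := norm_sub_le (u.2 v.1) (v.2 u.1)
      simp only [LinearMap.mk₂_apply]
      linarith)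

theorem canonicalFormModel_apply (u v : E × (E →L[ℝ] ℝ)) :
    canonicalFormModel E u v = u.2 v.1 - v.2 u.1 := rfl

/-- The canonical symplectic form `ω = ∑ i, dp_i ∧ dx_i` of `T*M`. Mathlib identifies
`T_p (T*M)` with `E × E*` through the chart of `T*M` at `p`, and that chart is the cotangent chart
`(x, p)` induced by the chart of `M` at the base point. Hence the coordinate expression of `ω` at
`p` is the model form. -/
def canonicalForm (p : CotangentBundle E M) (u v : TangentSpace (cotangentModel E) p) : ℝ :=
  canonicalFormModel E u v

/-- The Hamiltonian vector `H_G(p)` of a function `G`, defined by `ω(u, H_G(p)) = d_p G(u)`. -/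
def hamiltonianVector (G : CotangentBundle E M → ℝ) (p : CotangentBundle E M) :
    TangentSpace (cotangentModel E) p :=
  (canonicalFormModel E).flip.inverse (mvfderiv (cotangentModel E) G p)

/-- `ω` is nondegenerate. -/
theorem canonicalFormModel_flip_isInvertible [FiniteDimensional ℝ E] :
    (canonicalFormModel E).flip.IsInvertible := by
  have hinj : Function.Injective (canonicalFormModel E).flip := by
    rw [injective_iff_map_eq_zero]
    intro u hu
    have h (v : E × (E →L[ℝ] ℝ)) : v.2 u.1 - u.2 v.1 = 0 := by
      have := DFunLike.congr_fun hu v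
      simpa [canonicalFormModel_apply] using this
    refine Prod.ext ?_ ?_
    · exact SeparatingDual.eq_zero_of_forall_dual_eq_zero (R := ℝ) (fun β ↦ by simpa using h (0, β))
    · ext b
      simpa using h (b, 0)
  have hfr : Module.finrank ℝ (E × (E →L[ℝ] ℝ)) =
      Module.finrank ℝ ((E × (E →L[ℝ] ℝ)) →L[ℝ] ℝ) := by
    rw [(LinearMap.toContinuousLinearMap (𝕜 := ℝ) (E := E × (E →L[ℝ] ℝ)) (F' := ℝ)).symm.finrank_eq]
    exact (Subspace.dual_finrank_eq).symm
  exact ⟨(LinearEquiv.ofInjectiveOfFinrankEq (canonicalFormModel E).flip.toLinearMap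
    hinj hfr).toContinuousLinearEquiv, by ext <;> rfl⟩

theorem canonicalForm_hamiltonianVector [FiniteDimensional ℝ E] (G : CotangentBundle E M → ℝ)
    (p : CotangentBundle E M) (u : TangentSpace (cotangentModel E) p) :
    canonicalForm p u (hamiltonianVector G p) = mvfderiv (cotangentModel E) G p u := by
  obtain ⟨e, he⟩ := canonicalFormModel_flip_isInvertible (E := E)
  have : (canonicalFormModel E).flip
      ((canonicalFormModel E).flip.inverse (mvfderiv (cotangentModel E) G p)) =
      (mvfderiv (cotangentModel E) G p) := by
    rw [← he, ContinuousLinearMap.inverse_equiv]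
    exact e.apply_symm_apply _
  exact DFunLike.congr_fun this u

/-- The Poisson bracket `{F, G}_ω = dF(H_G)` of `ω`, so that `{x_i, p_j}_ω = δ_{ij}`. -/
def canonicalBracket (F G : CotangentBundle E M → ℝ) (p : CotangentBundle E M) : ℝ :=
  mvfderiv (cotangentModel E) F p (hamiltonianVector G p)

/-! ### Bi-realisations -/

/-- `IsBirealisation π W α β`: the maps `α, β : W → M` on the neighbourhood `W` of the zero section
in `T*M` (equipped with `ω`) form a bi-realisation of `(M, π)`. Values of `α` and `β` outside `W`
play no role. -/
structure IsBirealisation (π : PoissonStructure E M) (W : Set (CotangentBundle E M))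
    (α β : CotangentBundle E M → M) : Prop where
  isOpen : IsOpen W
  zero_mem : ∀ x, zeroCovector x ∈ W
  contMDiffOn_source : ContMDiffOn (cotangentModel E) 𝓘(ℝ, E) ∞ α W
  contMDiffOn_target : ContMDiffOn (cotangentModel E) 𝓘(ℝ, E) ∞ β W
  surjOn_source : SurjOn α W univ
  surjOn_target : SurjOn β W univ
  submersion_source : ∀ p ∈ W,
    Function.Surjective (mfderiv (cotangentModel E) 𝓘(ℝ, E) α p)
  submersion_target : ∀ p ∈ W,
    Function.Surjective (mfderiv (cotangentModel E) 𝓘(ℝ, E) β p)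
  source_zero : ∀ x, α (zeroCovector x) = x
  target_zero : ∀ x, β (zeroCovector x) = x
  /-- `α` is a Poisson map. -/
  poisson : ∀ f g : M → ℝ, ContMDiff 𝓘(ℝ, E) 𝓘(ℝ, ℝ) ∞ f → ContMDiff 𝓘(ℝ, E) 𝓘(ℝ, ℝ) ∞ g →
    ∀ p ∈ W, canonicalBracket (f ∘ α) (g ∘ α) p = π.bracket f g (α p)
  /-- `β` is an anti-Poisson map. -/
  antiPoisson : ∀ f g : M → ℝ, ContMDiff 𝓘(ℝ, E) 𝓘(ℝ, ℝ) ∞ f →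
    ContMDiff 𝓘(ℝ, E) 𝓘(ℝ, ℝ) ∞ g →
    ∀ p ∈ W, canonicalBracket (f ∘ β) (g ∘ β) p = -π.bracket f g (β p)
  /-- The fibres of `α` and `β` are symplectically orthogonal to each other. -/
  orthogonal : ∀ p ∈ W, ∀ u v : TangentSpace (cotangentModel E) p,
    mfderiv (cotangentModel E) 𝓘(ℝ, E) α p u = 0 →
    mfderiv (cotangentModel E) 𝓘(ℝ, E) β p v = 0 → canonicalForm p u v = 0

/-! ### Poisson sprays, their flows and the averaged form -/

/-- `X` is a Poisson spray for `π`: a smooth vector field on `T*M` with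
`d_ξ τ (X(ξ)) = π^#(ξ)` for all `ξ ∈ T*M`, and `m_c^* X = c X` for all `c ≠ 0`. -/
structure IsPoissonSpray (π : PoissonStructure E M)
    (X : ∀ p : CotangentBundle E M, TangentSpace (cotangentModel E) p) : Prop where
  contMDiff : ContMDiff (cotangentModel E) (cotangentModel E).tangent ∞
    (fun p ↦ (⟨p, X p⟩ : TangentBundle (cotangentModel E) (CotangentBundle E M)))
  proj_eq : ∀ p : CotangentBundle E M,
    mfderiv (cotangentModel E) 𝓘(ℝ, E) cotangentProj p (X p) = π.sharp p.1 p.2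
  homogeneous : ∀ c : ℝ, c ≠ 0 →
    VectorField.mpullback (cotangentModel E) (cotangentModel E) (fibreMul c) X = c • X

/-- `FlowsTo X s p q`: the integral curve of `X` starting at `p` exists between time `0` and time `s`
and reaches `q` at time `s`. -/
def FlowsTo (X : ∀ p : CotangentBundle E M, TangentSpace (cotangentModel E) p) (s : ℝ)
    (p q : CotangentBundle E M) : Prop :=
  ∃ γ : ℝ → CotangentBundle E M, IsMIntegralCurveOn γ X (uIcc 0 s) ∧ γ 0 = p ∧ γ s = q

/-- The domain of the time-`s` flow of `X`. -/
def flowDomain (X : ∀ p : CotangentBundle E M, TangentSpace (cotangentModel E) p) (s : ℝ) :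
    Set (CotangentBundle E M) :=
  {p | ∃ q, FlowsTo X s p q}

open Classical in
/-- The time-`s` flow `Φ^s_X` of `X` (with the irrelevant value `p` at points `p` outside its
domain). -/
def flow (X : ∀ p : CotangentBundle E M, TangentSpace (cotangentModel E) p) (s : ℝ)
    (p : CotangentBundle E M) : CotangentBundle E M :=
  if h : ∃ q, FlowsTo X s p q then h.choose else p

/-- The form `Ω = ∫₀¹ (Φ^s_X)^* ω ds` at the point `p`. -/
def averagedForm (X : ∀ p : CotangentBundle E M, TangentSpace (cotangentModel E) p)
    (p : CotangentBundle E M) (u v : TangentSpace (cotangentModel E) p) : ℝ :=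
  ∫ s in (0 : ℝ)..1, canonicalForm (flow X s p)
    (mfderiv (cotangentModel E) (cotangentModel E) (flow X s) p u)
    (mfderiv (cotangentModel E) (cotangentModel E) (flow X s) p v)

end Definitions

end

/-!
The proof works in cotangent charts and glues the results. All constructions take place near the
zero section, where the spray vanishes and the flow is therefore defined up to time `1`.

*Averaged form.* Let `λ` be the canonical one-form of `T*M`, so that `dλ = ω`, and let
`Λ = ∫₀¹ (Φ^s)^* λ ds`. Then `dΛ = Ω` (`IsSmoothFlow.oneFormDeriv_averagedLiouville`). Along the
zero section the linearised flow is `(v, ξ) ↦ (v + s π^# ξ, ξ)` in coordinates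
(`SprayModel.fderiv_zero_section`), and an explicit computation shows that all the forms
`Ω_t = (1 - t) ω + t Ω` are nondegenerate there (`SprayModel.injective_moserForm`).

*Moser's argument.* The vector field `Y_t` with `Ω_t(Y_t, ·) = λ - Λ` is defined near the zero
section and vanishes on it. The forms `Ω_t` are constant along its flow (`moserForm_const_along`),
so its time-one map `ψ` satisfies `ψ^* Ω = ω` and fixes the zero section (`nonempty_moserData`).
The smoothness of the flows involved is obtained from the implicit function theorem on a space of
continuous curves (`exists_local_smooth_flow`, `exists_isSmoothFlow`).

*Gluing.* The trajectories of `Y_t` are characterised without reference to a chart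
(`IsMoserCurve`). After the chart domains have been shrunk so that any two of them that meet lie in
a common one (`exists_mem_nhds_forall_inter_nonempty`), uniqueness of these curves shows that the
local maps `ψ` agree on overlaps and that the glued map is injective
(`IsPoissonSpray.exists_partialDiffeomorph_endpoint`).

*Orthogonality and Poisson property.* Let `v_s` be the image of a tangent vector `v` under the
derivative of `Φ^s`. If `τ_* v_s = π^# η` holds at `s = 0` or at `s = 1`, then `η` extends to a
solution `η_s` of a linear differential equation such that `τ_* v_s = π^# η_s` for all `s`, by the
Jacobi identity. Moreover `η_s(τ_* w_s)` has the derivative `ω(v_s, w_s)`, whence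
`Ω(v, w) = η_1(τ_* w_1) - η_0(τ_* w_0)` (`SprayModel.exists_covector_along`). If `τ_* v_0 = 0`, the
choice `η_0 = 0` gives `Ω(v, w) = η_1(τ_* w_1)`. This vanishes whenever `τ_* w_1 = 0`, which is the
orthogonality of the fibres of `τ` and of `τ ∘ Φ^1`. A comparison of dimensions
(`exists_mem_ker_of_finrank_eq`) shows that every covector arises as `η_1`, so that the Hamiltonian
vectors of functions of `τ ∘ Φ^1` with respect to `Ω` are the negatives of such `v`, and
`τ_* v_1 = π^# η_1` says that `τ ∘ Φ^1` is anti-Poisson. The choice `η_1 = 0` gives in the same way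
that `τ` is Poisson. As `ψ^* Ω = ω`, these properties carry over to `τ ∘ ψ` and `τ ∘ Φ^1 ∘ ψ`.
-/

/-! ### Composition operators on spaces of continuous maps -/

section Postcomp

universe u

/-- The superposition operator `γ ↦ f ∘ γ` on spaces of continuous maps. -/
noncomputable def postcomp {K F G : Type*} [TopologicalSpace K] [TopologicalSpace F]
    [TopologicalSpace G] (f : F → G) (hf : Continuous f) (γ : C(K, F)) : C(K, G) :=
  (⟨f, hf⟩ : C(F, G)).comp γ

@[simp] theorem postcomp_apply {K F G : Type*} [TopologicalSpace K] [TopologicalSpace F]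
    [TopologicalSpace G] (f : F → G) (hf : Continuous f) (γ : C(K, F)) (t : K) :
    postcomp f hf γ t = f (γ t) := rfl

/-- A continuous field of linear maps `A t : F → G` acts pointwise on continuous maps `K → F`. -/
noncomputable def pointwiseApply (K F G : Type*) [TopologicalSpace K] [CompactSpace K]
    [NormedAddCommGroup F] [NormedSpace ℝ F] [NormedAddCommGroup G] [NormedSpace ℝ G] :
    C(K, F →L[ℝ] G) →L[ℝ] C(K, F) →L[ℝ] C(K, G) :=
  LinearMap.mkContinuous₂
    (LinearMap.mk₂ ℝ
      (fun (A : C(K, F →L[ℝ] G)) (h : C(K, F)) ↦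
        (⟨fun t ↦ A t (h t), A.continuous.clm_apply h.continuous⟩ : C(K, G)))
      (fun A A' h ↦ by ext; simp) (fun c A h ↦ by ext; simp)
      (fun A h h' ↦ by ext; simp) (fun c A h ↦ by ext; simp)) 1
    (fun A h ↦ by
      rw [ContinuousMap.norm_le _ (by positivity)]
      intro t
      simp only [LinearMap.mk₂_apply, ContinuousMap.coe_mk, one_mul]
      exact ((A t).le_opNorm _).trans (mul_le_mul (A.norm_coe_le_norm t) (h.norm_coe_le_norm t)
        (norm_nonneg _) (norm_nonneg A)))

@[simp] theorem pointwiseApply_apply {K F G : Type*} [TopologicalSpace K] [CompactSpace K]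
    [NormedAddCommGroup F] [NormedSpace ℝ F] [NormedAddCommGroup G] [NormedSpace ℝ G]
    (A : C(K, F →L[ℝ] G)) (h : C(K, F)) (t : K) : pointwiseApply K F G A h t = A t (h t) := rfl

/-- The operator `γ ↦ f ∘ γ` is differentiable, with derivative `h ↦ (Df ∘ γ) h`. -/
theorem hasFDerivAt_postcomp {K F G : Type*} [TopologicalSpace K] [CompactSpace K]
    [NormedAddCommGroup F] [NormedSpace ℝ F] [NormedAddCommGroup G] [NormedSpace ℝ G]
    {f : F → G} (hf : ContDiff ℝ 1 f) (γ : C(K, F)) :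
    HasFDerivAt (postcomp (K := K) f hf.continuous)
      (pointwiseApply K F G (postcomp (fderiv ℝ f) (hf.continuous_fderiv one_ne_zero) γ)) γ := by
  rw [hasFDerivAt_iff_isLittleO, Asymptotics.isLittleO_iff]
  intro ε hε
  have hc : Continuous (postcomp (K := K) (fderiv ℝ f) (hf.continuous_fderiv one_ne_zero)) :=
    ContinuousMap.continuous_postcomp _
  obtain ⟨δ, hδ, hball⟩ := (Metric.continuousAt_iff (α := C(K, F))
    (β := C(K, F →L[ℝ] G))).1 hc.continuousAt ε hε
  filter_upwards [Metric.ball_mem_nhds γ hδ] with γ' hγ'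
  rw [ContinuousMap.norm_le _ (by positivity)]
  intro t
  have hseg : ∀ z ∈ segment ℝ (γ t) (γ' t), ‖fderiv ℝ f z - fderiv ℝ f (γ t)‖ ≤ ε := by
    rintro z hz
    obtain ⟨θ, hθ, rfl⟩ := (segment_eq_image' ℝ (γ t) (γ' t)) ▸ hz
    have h1 : dist (γ + θ • (γ' - γ)) γ < δ := by
      rw [dist_eq_norm, add_sub_cancel_left, norm_smul, Real.norm_of_nonneg hθ.1]
      have h2 : ‖γ' - γ‖ < δ := by simpa [dist_eq_norm] using hγ'
      exact (mul_le_of_le_one_left (norm_nonneg _) hθ.2).trans_lt h2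
    have h3 := (ContinuousMap.dist_lt_iff hε).1 (hball h1) t
    simpa [dist_eq_norm] using h3.le
  have hmv := (convex_segment (γ t) (γ' t)).norm_image_sub_le_of_norm_hasFDerivWithin_le'
    (f := f) (f' := fderiv ℝ f) (φ := fderiv ℝ f (γ t)) (C := ε)
    (fun z _ ↦ (hf.differentiable one_ne_zero z).hasFDerivAt.hasFDerivWithinAt) hseg
    (left_mem_segment ℝ _ _) (right_mem_segment ℝ _ _)
  calc _ = ‖f (γ' t) - f (γ t) - fderiv ℝ f (γ t) (γ' t - γ t)‖ := by simp
    _ ≤ ε * ‖γ' t - γ t‖ := hmv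
    _ ≤ ε * ‖γ' - γ‖ := by
      gcongr
      exact (γ' - γ).norm_coe_le_norm t

/-- The induction on `n` applies the statement for `n` to the derivative of `f`, which takes values
in `F →L[ℝ] G`; hence the quantification over `G`, in the universe of `F`. -/
theorem contDiff_postcomp {K : Type*} {F : Type u} [TopologicalSpace K] [CompactSpace K]
    [NormedAddCommGroup F] [NormedSpace ℝ F] (n : ℕ) :
    ∀ {G : Type u} [NormedAddCommGroup G] [NormedSpace ℝ G] {f : F → G} (hf : ContDiff ℝ ∞ f),
    ContDiff ℝ n (postcomp (K := K) f hf.continuous) := by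
  induction n with
  | zero =>
    intro G _ _ f hf
    exact contDiff_zero.2 (ContinuousMap.continuous_postcomp _)
  | succ n ih =>
    intro G _ _ f hf
    have hf1 : ContDiff ℝ 1 f := hf.of_le (by norm_cast)
    refine contDiff_succ_iff_hasFDerivAt.2
      ⟨fun γ ↦ pointwiseApply K F G (postcomp (fderiv ℝ f) (hf1.continuous_fderiv one_ne_zero) γ),
        ContDiff.comp (g := fun A ↦ pointwiseApply K F G A) (by fun_prop)
          (ih (hf.fderiv_right (m := ∞) le_rfl)),
        fun γ ↦ hasFDerivAt_postcomp hf1 γ⟩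

theorem contDiff_infty_postcomp {K : Type*} {F G : Type u} [TopologicalSpace K] [CompactSpace K]
    [NormedAddCommGroup F] [NormedSpace ℝ F] [NormedAddCommGroup G] [NormedSpace ℝ G]
    {f : F → G} (hf : ContDiff ℝ ∞ f) : ContDiff ℝ ∞ (postcomp (K := K) f hf.continuous) :=
  contDiff_infty.2 fun n ↦ contDiff_postcomp n hf

end Postcomp

/-! ### Smooth local flows of Lipschitz vector fields -/

section LocalFlow

universe u

/-- The interval `[-1, 1]` as a type. -/
abbrev SymmInterval : Type := Icc (-1 : ℝ) 1

/-- The Volterra operator `(V g)(t) = ∫₀ᵗ g` on continuous functions on `[-1, 1]`, as a linear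
map. -/
noncomputable def volterraLin (F : Type*) [NormedAddCommGroup F] [NormedSpace ℝ F] :
    C(SymmInterval, F) →ₗ[ℝ] C(SymmInterval, F) where
  toFun g := ⟨fun t ↦ ∫ s in (0 : ℝ)..t, IccExtend (by norm_num) g s,
    (intervalIntegral.continuous_primitive
      (fun a b ↦ (g.continuous.Icc_extend' (h := by norm_num)).intervalIntegrable a b) 0).comp
      continuous_subtype_val⟩
  map_add' g g' := by
    ext t
    exact intervalIntegral.integral_add
      ((g.continuous.Icc_extend' (h := by norm_num)).intervalIntegrable _ _)
      ((g'.continuous.Icc_extend' (h := by norm_num)).intervalIntegrable _ _)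
  map_smul' c g := by
    ext t
    exact intervalIntegral.integral_smul c _

theorem norm_volterraLin_apply_le {F : Type*} [NormedAddCommGroup F] [NormedSpace ℝ F]
    (g : C(SymmInterval, F)) : ‖volterraLin F g‖ ≤ ‖g‖ := by
  rw [ContinuousMap.norm_le _ (by positivity)]
  intro t
  refine (intervalIntegral.norm_integral_le_of_norm_le_const (C := ‖g‖)
    fun s _ ↦ g.norm_coe_le_norm _).trans ?_
  have : |(t : ℝ) - 0| ≤ 1 := by rw [sub_zero, abs_le]; exact ⟨t.2.1, t.2.2⟩
  nlinarith [norm_nonneg g]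

/-- The Volterra operator as a continuous linear map. -/
noncomputable def volterra (F : Type*) [NormedAddCommGroup F] [NormedSpace ℝ F] :
    C(SymmInterval, F) →L[ℝ] C(SymmInterval, F) :=
  (volterraLin F).mkContinuous 1 fun g ↦ by simpa using norm_volterraLin_apply_le g

variable {F : Type u} [NormedAddCommGroup F] [NormedSpace ℝ F]

/-- The Picard operator `γ ↦ p + ε ∫₀ f(γ)`. Its fixed points are the solutions on `[-1, 1]` of
`γ' = ε f(γ)`, `γ(0) = p`. -/
noncomputable def picardOp (f : F → F) (hf : Continuous f) (ε : ℝ) (p : F)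
    (γ : C(SymmInterval, F)) : C(SymmInterval, F) :=
  ContinuousMap.const _ p + ε • volterra F (postcomp f hf γ)

theorem contractingWith_picardOp {f : F → F} {K : NNReal} (hf : LipschitzWith K f) {ε : ℝ}
    (hε : |ε| * (2 * K) ≤ 1) (p : F) :
    ContractingWith 2⁻¹ (picardOp f hf.continuous ε p) := by
  refine ⟨by rw [inv_lt_one_iff₀]; norm_num, LipschitzWith.of_dist_le_mul fun γ γ' ↦ ?_⟩
  have h1 : dist (postcomp f hf.continuous γ) (postcomp f hf.continuous γ') ≤ K * dist γ γ' := by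
    rw [ContinuousMap.dist_le (by positivity)]
    intro t
    exact (hf.dist_le_mul _ _).trans (by gcongr; exact ContinuousMap.dist_apply_le_dist t)
  have h2 : picardOp f hf.continuous ε p γ - picardOp f hf.continuous ε p γ' =
      ε • volterra F (postcomp f hf.continuous γ - postcomp f hf.continuous γ') := by
    rw [map_sub, smul_sub, picardOp, picardOp, add_sub_add_left_eq_sub]
  rw [dist_eq_norm, h2, norm_smul]
  have h3 := norm_volterraLin_apply_le (postcomp f hf.continuous γ - postcomp f hf.continuous γ')
  rw [← dist_eq_norm] at h3
  have h4 : |ε| * K * dist γ γ' ≤ 2⁻¹ * dist γ γ' := by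
    gcongr
    linarith
  calc ‖ε‖ * _ ≤ |ε| * (K * dist γ γ') := by
        rw [Real.norm_eq_abs]; gcongr; exact h3.trans h1
    _ ≤ _ := by simpa [mul_assoc] using h4

/-- The equation for the fixed points of the Picard operator depends smoothly on the speed `ε`, the
initial point `p` and the curve `γ`. -/
theorem contDiff_picardOp {f : F → F} (hf : ContDiff ℝ ∞ f) :
    ContDiff ℝ ∞ (fun q : (ℝ × F) × C(SymmInterval, F) ↦
      q.2 - picardOp f hf.continuous q.1.1 q.1.2 q.2) := by
  have h1 : ContDiff ℝ ∞ (fun q : (ℝ × F) × C(SymmInterval, F) ↦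
      volterra F (postcomp f hf.continuous q.2)) :=
    ContDiff.comp (g := fun g ↦ volterra F g) (by fun_prop)
      (ContDiff.comp (g := postcomp f hf.continuous) (contDiff_infty_postcomp hf) contDiff_snd)
  have h2 : ContDiff ℝ ∞ (fun q : (ℝ × F) × C(SymmInterval, F) ↦
      ContinuousMap.const SymmInterval q.1.2) := by
    have h3 : IsBoundedLinearMap ℝ (fun p : F ↦ ContinuousMap.const SymmInterval p) :=
      { map_add := fun _ _ ↦ rfl
        map_smul := fun _ _ ↦ rfl
        bound := ⟨1, one_pos, fun p ↦ by
          rw [ContinuousMap.norm_le _ (by positivity)]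
          simp⟩ }
    exact h3.contDiff.comp (contDiff_snd.comp contDiff_fst)
  exact contDiff_snd.sub (h2.add ((contDiff_fst.comp contDiff_fst).smul h1))

theorem isInvertible_one_sub {X : Type*} [NormedAddCommGroup X] [NormedSpace ℝ X]
    [CompleteSpace X] (D : X →L[ℝ] X) (hD : ‖D‖ < 1) :
    (ContinuousLinearMap.id ℝ X - D).IsInvertible := by
  refine ⟨ContinuousLinearEquiv.unitsEquiv ℝ X (Units.oneSub D hD), ?_⟩
  ext x
  rfl

variable [CompleteSpace F]

/-- For short times, a Lipschitz smooth vector field has a smooth flow. The flow at time `ε` is the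
value at `1` of the fixed point of the Picard operator of `ε f`, and that fixed point depends
smoothly on `ε` and on the initial point by the implicit function theorem. -/
theorem exists_local_smooth_flow {f : F → F} (hf : ContDiff ℝ ∞ f) {K : NNReal}
    (hK : LipschitzWith K f) :
    ∃ δ > 0, ∃ φ : ℝ × F → F, ContDiffOn ℝ ∞ φ (Ioo (-δ) δ ×ˢ univ) ∧
      ∀ p, φ (0, p) = p ∧ ∀ t ∈ Ioo (-δ) δ, HasDerivAt (fun s ↦ φ (s, p)) (f (φ (t, p))) t := by
  set δ : ℝ := (2 * (K + 1))⁻¹ with hδ_def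
  have hδ : 0 < δ := by positivity
  have hδK {ε : ℝ} (hε : |ε| ≤ δ) : |ε| * (2 * K) ≤ 1 := by
    calc |ε| * (2 * K) ≤ δ * (2 * (K + 1)) := by gcongr; linarith
      _ = 1 := by rw [hδ_def, inv_mul_cancel₀ (by positivity)]
  have hex : ∀ q : ℝ × F, ∃ γ : C(SymmInterval, F), |q.1| ≤ δ →
      picardOp f hf.continuous q.1 q.2 γ = γ := by
    intro q
    by_cases hq : |q.1| ≤ δ
    · exact ⟨_, fun _ ↦ (contractingWith_picardOp hK (hδK hq) q.2).fixedPoint_isFixedPt⟩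
    · exact ⟨0, fun h ↦ absurd h hq⟩
  choose Γ hΓ using hex
  have huniq {ε : ℝ} (hε : |ε| ≤ δ) (p : F) {γ : C(SymmInterval, F)}
      (hγ : picardOp f hf.continuous ε p γ = γ) : Γ (ε, p) = γ :=
    (contractingWith_picardOp hK (hδK hε) p).fixedPoint_unique' (hΓ (ε, p) hε) hγ
  have h1mem : (1 : ℝ) ∈ Icc (-1 : ℝ) 1 := ⟨by norm_num, le_rfl⟩
  have habs {ε : ℝ} (hε : ε ∈ Ioo (-δ) δ) : |ε| < δ := abs_lt.2 hε
  -- the curve through `p` at speed `δ`, reparametrised, gives the curves at all smaller speeds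
  have hrep (p : F) {ε : ℝ} (hε : ε ∈ Ioo (-δ) δ) :
      Γ (ε, p) ⟨1, h1mem⟩ =
        p + δ • ∫ s in (0 : ℝ)..(ε / δ), f (IccExtend (by norm_num) (Γ (δ, p)) s) := by
    have hc : |ε / δ| ≤ 1 := by
      rw [abs_div, abs_of_pos hδ, div_le_one hδ]; exact (habs hε).le
    have hmem (t : SymmInterval) : ε / δ * t ∈ Icc (-1 : ℝ) 1 := by
      rw [mem_Icc, ← abs_le, abs_mul]
      exact mul_le_one₀ hc (abs_nonneg _) (abs_le.2 t.2)
    set γ' : C(SymmInterval, F) := ⟨fun t ↦ Γ (δ, p) ⟨ε / δ * t, hmem t⟩, by fun_prop⟩ with hγ'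
    have hδfix (t : SymmInterval) : Γ (δ, p) t =
        p + δ • ∫ s in (0 : ℝ)..t, f (IccExtend (by norm_num) (Γ (δ, p)) s) := by
      conv_lhs => rw [← hΓ (δ, p) (abs_of_pos hδ).le]
      rfl
    have hfix : picardOp f hf.continuous ε p γ' = γ' := by
      ext t
      change p + ε • ∫ s in (0 : ℝ)..t, f (IccExtend (by norm_num) γ' s) = Γ (δ, p) _
      rw [hδfix]
      congr 1
      have h2 : ∫ s in (0 : ℝ)..t, f (IccExtend (by norm_num) γ' s) =
          ∫ s in (0 : ℝ)..t, f (IccExtend (by norm_num) (Γ (δ, p)) (ε / δ * s)) := by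
        refine intervalIntegral.integral_congr fun s hs ↦ ?_
        have hs1 : s ∈ Icc (-1 : ℝ) 1 :=
          uIcc_subset_Icc ⟨by norm_num, by norm_num⟩ t.2 hs
        simp only [IccExtend_of_mem _ _ hs1, IccExtend_of_mem _ _ (hmem ⟨s, hs1⟩)]
        rfl
      have h3 := intervalIntegral.smul_integral_comp_mul_left (a := 0) (b := t)
        (fun s ↦ f (IccExtend (by norm_num) (Γ (δ, p)) s)) (ε / δ)
      rw [mul_zero] at h3
      change _ = δ • ∫ s in (0 : ℝ)..(ε / δ * t), f (IccExtend (by norm_num) (Γ (δ, p)) s)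
      rw [h2, ← h3, smul_smul, mul_div_cancel₀ ε hδ.ne']
    rw [huniq (habs hε).le p hfix]
    change Γ (δ, p) _ = _
    rw [hδfix]
    simp
  refine ⟨δ, hδ, fun q ↦ Γ q ⟨1, h1mem⟩, ?_, fun p ↦ ⟨?_, fun t ht ↦ ?_⟩⟩
  · rintro ⟨ε, p⟩ ⟨hε, -⟩
    refine ContDiffAt.contDiffWithinAt ?_
    set H := fun q : (ℝ × F) × C(SymmInterval, F) ↦
      q.2 - picardOp f hf.continuous q.1.1 q.1.2 q.2 with hH
    have hHs : ContDiff ℝ ∞ H := contDiff_picardOp hf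
    set u : (ℝ × F) × C(SymmInterval, F) := ((ε, p), Γ (ε, p)) with hu
    have hHu : H u = 0 := sub_eq_zero.2 (hΓ (ε, p) (habs hε).le).symm
    have hder : HasFDerivAt (fun γ ↦ H ((ε, p), γ))
        (fderiv ℝ H u ∘L .inr ℝ (ℝ × F) C(SymmInterval, F)) (Γ (ε, p)) :=
      ((hHs.differentiable (by simp)) u).hasFDerivAt.comp (Γ (ε, p))
        (hasFDerivAt_prodMk_right (𝕜 := ℝ) (ε, p) (Γ (ε, p)))
    set D := ContinuousLinearMap.id ℝ C(SymmInterval, F) -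
      (fderiv ℝ H u ∘L .inr ℝ (ℝ × F) C(SymmInterval, F)) with hD
    have hderT : HasFDerivAt (picardOp f hf.continuous ε p) D (Γ (ε, p)) := by
      have := (hasFDerivAt_id (𝕜 := ℝ) (Γ (ε, p))).sub hder
      refine this.congr_of_eventuallyEq (Filter.Eventually.of_forall fun γ ↦ ?_)
      simp [hH]
    have hDn : ‖D‖ < 1 := by
      have := hderT.le_of_lipschitz (contractingWith_picardOp hK (hδK (habs hε).le) p).2
      refine this.trans_lt ?_
      norm_num
    have hinv : (fderiv ℝ H u ∘L .inr ℝ (ℝ × F) C(SymmInterval, F)).IsInvertible := by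
      have := isInvertible_one_sub D hDn
      rwa [hD, sub_sub_cancel] at this
    have hcd : ContDiffAt ℝ ∞ H u := hHs.contDiffAt
    have hsm := hcd.contDiffAt_implicitFunction (by simp) hinv
    have hev := hcd.eventually_apply_implicitFunction (by simp) hinv
    have hΓs : ContDiffAt ℝ ∞ Γ (ε, p) := by
      refine hsm.congr_of_eventuallyEq ?_
      have hnear : ∀ᶠ q : ℝ × F in 𝓝 (ε, p), |q.1| < δ :=
        (continuous_fst.abs.tendsto (ε, p)).eventually_lt_const (habs hε)
      filter_upwards [hev, hnear] with q hq hq1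
      rw [hHu] at hq
      exact huniq hq1.le q.2 (sub_eq_zero.1 hq).symm
    have hev1 : IsBoundedLinearMap ℝ (fun γ : C(SymmInterval, F) ↦ γ ⟨1, h1mem⟩) :=
      { map_add := fun _ _ ↦ rfl
        map_smul := fun _ _ ↦ rfl
        bound := ⟨1, one_pos, fun γ ↦ by simpa using γ.norm_coe_le_norm _⟩ }
    exact hev1.contDiff.contDiffAt.comp _ hΓs
  · have := hrep p (ε := 0) ⟨by linarith, hδ⟩
    simpa using this
  · have hcont : Continuous fun s ↦ f (IccExtend (by norm_num) (Γ (δ, p)) s) :=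
      hf.continuous.comp ((Γ (δ, p)).continuous.Icc_extend' (h := by norm_num))
    have hprim := (hcont.integral_hasStrictDerivAt 0 (t / δ)).hasDerivAt
    have hdiv : HasDerivAt (fun s : ℝ ↦ s / δ) (1 / δ) t := (hasDerivAt_id t).div_const δ
    have hcomp := ((hprim.scomp t hdiv).const_smul δ).const_add p
    have hval : f (Γ (t, p) ⟨1, h1mem⟩) =
        δ • (1 / δ) • f (IccExtend (by norm_num) (Γ (δ, p)) (t / δ)) := by
      have hmem : t / δ ∈ Icc (-1 : ℝ) 1 := by
        rw [mem_Icc, ← abs_le, abs_div, abs_of_pos hδ, div_le_one hδ]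
        exact (habs ht).le
      rw [smul_smul, mul_one_div_cancel hδ.ne', one_smul, hrep p ht, IccExtend_of_mem _ _ hmem]
      congr 1
      conv_rhs => rw [← hΓ (δ, p) (abs_of_pos hδ).le]
      rfl
    rw [hval]
    refine hcomp.congr_of_eventuallyEq ?_
    filter_upwards [isOpen_Ioo.mem_nhds ht] with s hs
    exact hrep p hs

end LocalFlow

/-! ### Smooth global flows and the variational equation -/

section SmoothFlow

universe u

/-- `φ` is a smooth global flow of the vector field `f` on a normed space. -/
structure IsSmoothFlow {F : Type*} [NormedAddCommGroup F] [NormedSpace ℝ F] (f : F → F)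
    (φ : ℝ → F → F) : Prop where
  contDiff : ContDiff ℝ ∞ (fun q : ℝ × F ↦ φ q.1 q.2)
  zero : ∀ p, φ 0 p = p
  hasDerivAt : ∀ p t, HasDerivAt (fun s ↦ φ s p) (f (φ t p)) t

theorem LipschitzWith.eq_of_hasDerivAt {F : Type*} [NormedAddCommGroup F] [NormedSpace ℝ F]
    {f : F → F} {K : NNReal} (hK : LipschitzWith K f) {c c' : ℝ → F}
    (hc : ∀ t, HasDerivAt c (f (c t)) t) (hc' : ∀ t, HasDerivAt c' (f (c' t)) t) {t₀ : ℝ}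
    (h : c t₀ = c' t₀) : c = c' :=
  ODE_solution_unique_univ (v := fun _ ↦ f) (s := fun _ ↦ univ) (fun _ ↦ hK.lipschitzOnWith)
    (fun t ↦ ⟨hc t, mem_univ _⟩) (fun t ↦ ⟨hc' t, mem_univ _⟩) h

/-- A smooth globally Lipschitz vector field on a Banach space has a smooth global flow. -/
theorem exists_isSmoothFlow {F : Type u} [NormedAddCommGroup F] [NormedSpace ℝ F]
    [CompleteSpace F] {f : F → F} (hf : ContDiff ℝ ∞ f) {K : NNReal} (hK : LipschitzWith K f) :
    ∃ φ, IsSmoothFlow f φ := by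
  obtain ⟨δ, hδ, φ, hφ, hφ'⟩ := exists_local_smooth_flow hf hK
  have hglob (p : F) : ∃ γ : ℝ → F, γ 0 = p ∧ ∀ t, HasDerivAt γ (f (γ t)) t := by
    obtain ⟨γ, h0, hγ⟩ := exists_isMIntegralCurve_of_isMIntegralCurveOn (I := 𝓘(ℝ, F)) (M := F)
      (v := f) ((contMDiff_vectorSpace_iff_contDiff (V := f)).2 (hf.of_le (by norm_cast))) hδ
      (fun p ↦ ⟨fun t ↦ φ (t, p), (hφ' p).1, fun t ht ↦
        (((hφ' p).2 t ht).hasFDerivAt.hasFDerivWithinAt).hasMFDerivWithinAt⟩) p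
    refine ⟨γ, h0, fun t ↦ ?_⟩
    have h1 : HasFDerivAt γ ((1 : ℝ →L[ℝ] ℝ).smulRight (f (γ t))) t :=
      hasMFDerivAt_iff_hasFDerivAt.1 (hγ t)
    simpa using h1.hasDerivAt
  choose Φ hΦ0 hΦ using hglob
  have hloc (p : F) {t : ℝ} (ht : t ∈ Ioo (-δ) δ) : Φ p t = φ (t, p) :=
    ODE_solution_unique_of_mem_Ioo (v := fun _ ↦ f) (s := fun _ ↦ univ) (t₀ := 0)
      (fun _ _ ↦ hK.lipschitzOnWith) ⟨by linarith, hδ⟩ (fun t _ ↦ ⟨hΦ p t, mem_univ _⟩)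
      (fun t ht ↦ ⟨(hφ' p).2 t ht, mem_univ _⟩) ((hΦ0 p).trans (hφ' p).1.symm) ht
  have hadd (p : F) (s t : ℝ) : Φ p (s + t) = Φ (Φ p t) s := by
    have := hK.eq_of_hasDerivAt (c := fun s ↦ Φ p (s + t)) (c' := Φ (Φ p t)) (t₀ := 0)
      (fun s ↦ (hΦ p (s + t)).comp_add_const s t) (hΦ _) (by simp [hΦ0])
    exact congrFun this s
  have hiter (n : ℕ) :
      ContDiffOn ℝ ∞ (fun q : ℝ × F ↦ Φ q.2 (n * q.1)) (Ioo (-δ) δ ×ˢ univ) := by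
    induction n with
    | zero => simpa [hΦ0] using contDiffOn_snd
    | succ n ih =>
      have h1 : ContDiffOn ℝ ∞ (fun q : ℝ × F ↦ φ (q.1, Φ q.2 (n * q.1)))
          (Ioo (-δ) δ ×ˢ univ) :=
        hφ.comp (contDiffOn_fst.prodMk ih) fun q hq ↦ ⟨hq.1, mem_univ _⟩
      refine h1.congr fun q hq ↦ ?_
      rw [← hloc _ hq.1, ← hadd]
      congr 1
      push_cast
      ring
  refine ⟨fun t p ↦ Φ p t, ?_, hΦ0, hΦ⟩
  rw [contDiff_iff_contDiffAt]
  rintro ⟨t, p⟩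
  obtain ⟨n, hn⟩ := exists_nat_gt (|t| / δ)
  have hn0 : (0 : ℝ) < n := (by positivity : 0 ≤ |t| / δ).trans_lt hn
  have hmem : t / n ∈ Ioo (-δ) δ := by
    rw [mem_Ioo, ← abs_lt, abs_div, abs_of_pos hn0, div_lt_iff₀ hn0, mul_comm]
    exact (div_lt_iff₀ hδ).1 hn
  have h1 : ContDiffAt ℝ ∞ (fun q : ℝ × F ↦ Φ q.2 (n * q.1)) (t / n, p) :=
    (hiter n).contDiffAt ((isOpen_Ioo.prod isOpen_univ).mem_nhds ⟨hmem, mem_univ _⟩)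
  have h2 : ContDiffAt ℝ ∞ (fun q : ℝ × F ↦ (q.1 / n, q.2)) (t, p) := by fun_prop
  have h3 := h1.comp (t, p) h2
  refine h3.congr_of_eventuallyEq (Filter.Eventually.of_forall fun q ↦ ?_)
  simp only [Function.comp]
  rw [mul_div_cancel₀ _ hn0.ne']

namespace IsSmoothFlow

variable {F : Type*} [NormedAddCommGroup F] [NormedSpace ℝ F] {f : F → F} {φ : ℝ → F → F}

theorem contDiff_apply (h : IsSmoothFlow f φ) (t : ℝ) : ContDiff ℝ ∞ (φ t) :=
  h.contDiff.comp (contDiff_prodMk_right t)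

theorem continuous_apply_left (h : IsSmoothFlow f φ) (p : F) : Continuous fun t ↦ φ t p :=
  continuous_iff_continuousAt.2 fun t ↦ (h.hasDerivAt p t).continuousAt

theorem add (h : IsSmoothFlow f φ) {K : NNReal} (hK : LipschitzWith K f) (s t : ℝ) (p : F) :
    φ (s + t) p = φ s (φ t p) :=
  congrFun (hK.eq_of_hasDerivAt (c := fun s ↦ φ (s + t) p) (c' := fun s ↦ φ s (φ t p)) (t₀ := 0)
    (fun s ↦ (h.hasDerivAt p (s + t)).comp_add_const s t) (h.hasDerivAt _) (by simp [h.zero])) s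

theorem neg_apply (h : IsSmoothFlow f φ) {K : NNReal} (hK : LipschitzWith K f) (t : ℝ) (p : F) :
    φ (-t) (φ t p) = p := by
  rw [← h.add hK, neg_add_cancel, h.zero]

theorem apply_neg (h : IsSmoothFlow f φ) {K : NNReal} (hK : LipschitzWith K f) (t : ℝ) (p : F) :
    φ t (φ (-t) p) = p := by
  rw [← h.add hK, add_neg_cancel, h.zero]

theorem eq_of_eq_zero (h : IsSmoothFlow f φ) {K : NNReal} (hK : LipschitzWith K f) {p : F}
    (hp : f p = 0) (t : ℝ) : φ t p = p :=
  congrFun (hK.eq_of_hasDerivAt (h.hasDerivAt p) (c' := fun _ ↦ p) (t₀ := 0)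
    (fun s ↦ by rw [hp]; exact hasDerivAt_const s p) (h.zero p)) t

theorem hasFDerivAt_apply (h : IsSmoothFlow f φ) (t : ℝ) (p : F) :
    HasFDerivAt (φ t) (fderiv ℝ (φ t) p) p :=
  ((h.contDiff_apply t).differentiable (by simp) p).hasFDerivAt

theorem fderiv_apply_eq (h : IsSmoothFlow f φ) (t : ℝ) (p u : F) :
    fderiv ℝ (φ t) p u = fderiv ℝ (fun q : ℝ × F ↦ φ q.1 q.2) (t, p) (0, u) := by
  have h1 : HasFDerivAt (φ t) _ p :=
    ((h.contDiff.differentiable (by simp)) (t, p)).hasFDerivAt.comp p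
      (hasFDerivAt_prodMk_right (𝕜 := ℝ) t p)
  rw [h1.fderiv]
  rfl

theorem contDiff_fderiv (h : IsSmoothFlow f φ) :
    ContDiff ℝ ∞ (fun q : ℝ × F ↦ fderiv ℝ (φ q.1) q.2) := by
  have h1 : ContDiff ℝ ∞ (fun q : ℝ × F ↦
      (fderiv ℝ (fun q : ℝ × F ↦ φ q.1 q.2) q).comp (ContinuousLinearMap.inr ℝ ℝ F)) :=
    (h.contDiff.fderiv_right (m := ∞) le_rfl).clm_comp contDiff_const
  convert h1 using 2 with q
  ext u
  exact h.fderiv_apply_eq q.1 q.2 u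

/-- The variational equation: the derivative of the flow in the initial point solves the
linearised differential equation. -/
theorem hasDerivAt_fderiv (h : IsSmoothFlow f φ) (hf : ContDiff ℝ ∞ f) (p u : F) (t : ℝ) :
    HasDerivAt (fun s ↦ fderiv ℝ (φ s) p u)
      (fderiv ℝ f (φ t p) (fderiv ℝ (φ t) p u)) t := by
  set Ψ := fun q : ℝ × F ↦ φ q.1 q.2 with hΨ
  have hd : Differentiable ℝ (fderiv ℝ Ψ) :=
    (h.contDiff.fderiv_right (m := ∞) le_rfl).differentiable (by simp)
  -- the time derivative of the derivative is a mixed second derivative, which is symmetric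
  have h1 : HasDerivAt (fun s ↦ fderiv ℝ Ψ (s, p) (0, u))
      (fderiv ℝ (fderiv ℝ Ψ) (t, p) (1, 0) (0, u)) t := by
    have hc : HasDerivAt (fun s : ℝ ↦ (s, p)) ((1 : ℝ), (0 : F)) t :=
      (hasDerivAt_id t).prodMk (hasDerivAt_const t p)
    have he : HasFDerivAt (fun q ↦ fderiv ℝ Ψ q (0, u))
        ((fderiv ℝ (fderiv ℝ Ψ) (t, p)).flip (0, u)) (t, p) :=
      ((ContinuousLinearMap.apply ℝ F ((0 : ℝ), u)).hasFDerivAt.comp (t, p)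
        (hd (t, p)).hasFDerivAt)
    exact he.comp_hasDerivAt t hc
  have hsymm : IsSymmSndFDerivAt ℝ Ψ (t, p) :=
    h.contDiff.contDiffAt.isSymmSndFDerivAt
      (by simpa using (WithTop.coe_le_coe.2 le_top : ((2 : ℕ∞) : WithTop ℕ∞) ≤ ∞))
  have h2 : ∀ q : ℝ × F, fderiv ℝ Ψ q (1, 0) = f (Ψ q) := by
    rintro ⟨s, y⟩
    have hc : HasDerivAt (fun s : ℝ ↦ (s, y)) ((1 : ℝ), (0 : F)) s :=
      (hasDerivAt_id s).prodMk (hasDerivAt_const s y)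
    have he : HasDerivAt (Ψ ∘ fun s ↦ (s, y)) (fderiv ℝ Ψ (s, y) (1, 0)) s :=
      ((h.contDiff.differentiable (by simp)) (s, y)).hasFDerivAt.comp_hasDerivAt s hc
    exact he.unique (h.hasDerivAt y s)
  have h3 : fderiv ℝ (fderiv ℝ Ψ) (t, p) (0, u) (1, 0) =
      fderiv ℝ f (Ψ (t, p)) (fderiv ℝ Ψ (t, p) (0, u)) := by
    have ha : HasFDerivAt (fun q ↦ fderiv ℝ Ψ q (1, 0))
        ((fderiv ℝ (fderiv ℝ Ψ) (t, p)).flip (1, 0)) (t, p) :=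
      ((ContinuousLinearMap.apply ℝ F ((1 : ℝ), (0 : F))).hasFDerivAt.comp (t, p)
        (hd (t, p)).hasFDerivAt)
    have hb : HasFDerivAt (fun q ↦ f (Ψ q))
        ((fderiv ℝ f (Ψ (t, p))).comp (fderiv ℝ Ψ (t, p))) (t, p) :=
      ((hf.differentiable (by simp)) (Ψ (t, p))).hasFDerivAt.comp (t, p)
        ((h.contDiff.differentiable (by simp)) (t, p)).hasFDerivAt
    have := ha.unique (hb.congr_of_eventuallyEq (Filter.Eventually.of_forall h2))
    exact DFunLike.congr_fun this ((0 : ℝ), u)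
  simp_rw [h.fderiv_apply_eq]
  rw [← h3, ← hsymm]
  exact h1

theorem eventually_forall_mem (h : IsSmoothFlow f φ) {R : Set F} (hR : IsOpen R) {z : F} {a b : ℝ}
    (hz : ∀ t ∈ Icc a b, φ t z ∈ R) : ∀ᶠ p in 𝓝 z, ∀ t ∈ Icc a b, φ t p ∈ R :=
  isCompact_Icc.eventually_forall_of_forall_eventually fun t ht ↦
    (h.contDiff.continuous.comp continuous_swap).continuousAt.eventually (hR.mem_nhds (hz t ht))

end IsSmoothFlow

/-! ### Integrals depending on a parameter -/

/-- Differentiation under the integral sign. -/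
theorem hasFDerivAt_intervalIntegral {H G : Type*} [NormedAddCommGroup H] [NormedSpace ℝ H]
    [NormedAddCommGroup G] [NormedSpace ℝ G] {g : ℝ → H → G}
    (hg : ContDiff ℝ 1 (fun q : ℝ × H ↦ g q.1 q.2)) (a b : ℝ) (p : H) :
    HasFDerivAt (fun p ↦ ∫ s in a..b, g s p) (∫ s in a..b, fderiv ℝ (g s) p) p := by
  have hg' : Continuous (fun q : ℝ × H ↦ fderiv ℝ (g q.1) q.2) := by
    have h1 : ∀ q : ℝ × H, fderiv ℝ (g q.1) q.2 =
        (fderiv ℝ (fun q : ℝ × H ↦ g q.1 q.2) q).comp (ContinuousLinearMap.inr ℝ ℝ H) := by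
      rintro ⟨s, y⟩
      exact HasFDerivAt.fderiv (((hg.differentiable one_ne_zero) (s, y)).hasFDerivAt.comp y
        (hasFDerivAt_prodMk_right (𝕜 := ℝ) s y))
    simp_rw [h1]
    exact (hg.continuous_fderiv one_ne_zero).clm_comp continuous_const
  have hbd : ∃ C, ∀ᶠ y in 𝓝 p, ∀ s ∈ uIcc a b, ‖fderiv ℝ (g s) y‖ < C := by
    obtain ⟨C, hC⟩ := (isCompact_uIcc (a := a) (b := b)).exists_bound_of_continuousOn
      (f := fun s ↦ fderiv ℝ (g s) p)
      (hg'.comp (Continuous.prodMk_left p)).continuousOn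
    refine ⟨C + 1, isCompact_uIcc.eventually_forall_of_forall_eventually fun s hs ↦ ?_⟩
    have hcont : Continuous fun q : H × ℝ ↦ ‖fderiv ℝ (g q.2) q.1‖ :=
      (hg'.comp continuous_swap).norm
    exact hcont.continuousAt.eventually_lt_const ((hC s hs).trans_lt (lt_add_one C))
  obtain ⟨C, hC⟩ := hbd
  have hslice (y : H) : Continuous fun s ↦ g s y := hg.continuous.comp (Continuous.prodMk_left y)
  refine intervalIntegral.hasFDerivAt_integral_of_dominated_of_fderiv_le
    (F := fun y s ↦ g s y) (F' := fun y s ↦ fderiv ℝ (g s) y) (bound := fun _ ↦ C) hC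
    (Filter.Eventually.of_forall fun y ↦ (hslice y).aestronglyMeasurable)
    ((hslice p).intervalIntegrable _ _)
    (hg'.comp (Continuous.prodMk_left p)).aestronglyMeasurable
    (Filter.Eventually.of_forall fun s hs y hy ↦ (hy s (uIoc_subset_uIcc hs)).le)
    intervalIntegrable_const
    (Filter.Eventually.of_forall fun s _ y _ ↦ ?_)
  exact (((hg.comp (contDiff_prodMk_right s)).differentiable one_ne_zero) y).hasFDerivAt

/-- As in `contDiff_postcomp`, the induction passes to the derivative, which changes the target
space `G`. -/
theorem contDiff_intervalIntegral {H : Type u} [NormedAddCommGroup H] [NormedSpace ℝ H] (a b : ℝ)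
    (n : ℕ) : ∀ {G : Type u} [NormedAddCommGroup G] [NormedSpace ℝ G] {g : ℝ → H → G}
    (_ : ContDiff ℝ ∞ (fun q : ℝ × H ↦ g q.1 q.2)), ContDiff ℝ n (fun p ↦ ∫ s in a..b, g s p) := by
  induction n with
  | zero =>
    intro G _ _ g hg
    exact contDiff_zero.2 (continuous_iff_continuousAt.2 fun p ↦
      (hasFDerivAt_intervalIntegral (hg.of_le (by norm_cast)) a b p).continuousAt)
  | succ n ih =>
    intro G _ _ g hg
    have h1 : ContDiff ℝ ∞ (fun q : ℝ × H ↦ fderiv ℝ (g q.1) q.2) := by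
      have h2 : ∀ q : ℝ × H, fderiv ℝ (g q.1) q.2 =
          (fderiv ℝ (fun q : ℝ × H ↦ g q.1 q.2) q).comp (ContinuousLinearMap.inr ℝ ℝ H) := by
        rintro ⟨s, y⟩
        exact HasFDerivAt.fderiv (((hg.differentiable (by simp)) (s, y)).hasFDerivAt.comp y
          (hasFDerivAt_prodMk_right (𝕜 := ℝ) s y))
      simp_rw [h2]
      exact (hg.fderiv_right (m := ∞) le_rfl).clm_comp contDiff_const
    exact contDiff_succ_iff_hasFDerivAt.2 ⟨_, ih h1,
      fun p ↦ hasFDerivAt_intervalIntegral (hg.of_le (by norm_cast)) a b p⟩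

theorem contDiff_infty_intervalIntegral {H G : Type u} [NormedAddCommGroup H] [NormedSpace ℝ H]
    [NormedAddCommGroup G] [NormedSpace ℝ G] {g : ℝ → H → G}
    (hg : ContDiff ℝ ∞ (fun q : ℝ × H ↦ g q.1 q.2)) (a b : ℝ) :
    ContDiff ℝ ∞ (fun p ↦ ∫ s in a..b, g s p) :=
  contDiff_infty.2 fun n ↦ contDiff_intervalIntegral a b n hg

end SmoothFlow

/-! ### One-forms on normed spaces and the computation behind Moser's argument -/

section Moser

set_option maxSynthPendingDepth 3

universe u

theorem two_le_infty : (2 : WithTop ℕ∞) ≤ ∞ := WithTop.coe_le_coe.2 le_top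

theorem HasFDerivAt.eval_const {H F G : Type*} [NormedAddCommGroup H] [NormedSpace ℝ H]
    [NormedAddCommGroup F] [NormedSpace ℝ F] [NormedAddCommGroup G] [NormedSpace ℝ G]
    {A : H → F →L[ℝ] G} {A' : H →L[ℝ] F →L[ℝ] G} {p : H} (h : HasFDerivAt A A' p) (v : F) :
    HasFDerivAt (fun q ↦ A q v) (A'.flip v) p :=
  (ContinuousLinearMap.apply ℝ G v).hasFDerivAt.comp p h

theorem HasDerivAt.bilin_apply {F : Type*} [NormedAddCommGroup F] [NormedSpace ℝ F]
    {A : ℝ → F →L[ℝ] F →L[ℝ] ℝ} {A' : F →L[ℝ] F →L[ℝ] ℝ} {u v : ℝ → F} {u' v' : F} {t : ℝ}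
    (hA : HasDerivAt A A' t) (hu : HasDerivAt u u' t) (hv : HasDerivAt v v' t) :
    HasDerivAt (fun s ↦ A s (u s) (v s)) (A' (u t) (v t) + A t u' (v t) + A t (u t) v') t := by
  have h1 : HasDerivAt (fun s ↦ A s (u s)) (A' (u t) + A t u') t := hA.clm_apply hu
  have h2 : HasDerivAt (fun s ↦ A s (u s) (v s)) ((A' (u t) + A t u') (v t) + A t (u t) v') t :=
    h1.clm_apply hv
  exact h2

/-- The transposition of bilinear forms, as a continuous linear map. -/
noncomputable def flipL (F : Type*) [NormedAddCommGroup F] [NormedSpace ℝ F] :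
    (F →L[ℝ] F →L[ℝ] ℝ) →L[ℝ] F →L[ℝ] F →L[ℝ] ℝ :=
  LinearMap.mkContinuous (E := F →L[ℝ] F →L[ℝ] ℝ) (F := F →L[ℝ] F →L[ℝ] ℝ)
    { toFun := fun A : F →L[ℝ] F →L[ℝ] ℝ ↦ A.flip
      map_add' := fun _ _ ↦ rfl
      map_smul' := fun _ _ ↦ rfl } 1 (fun A ↦ by
      rw [one_mul]; exact A.opNorm_flip.le)

section ExteriorDerivative

variable {F F' : Type*} [NormedAddCommGroup F] [NormedSpace ℝ F] [NormedAddCommGroup F']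
  [NormedSpace ℝ F']

/-- The exterior derivative of a one-form `Θ` on a normed space:
`(dΘ)_p(u, v) = (D_u Θ)(v) - (D_v Θ)(u)`. -/
noncomputable def oneFormDeriv (Θ : F → F →L[ℝ] ℝ) (p : F) : F →L[ℝ] F →L[ℝ] ℝ :=
  fderiv ℝ Θ p - (fderiv ℝ Θ p).flip

theorem oneFormDeriv_apply (Θ : F → F →L[ℝ] ℝ) (p u v : F) :
    oneFormDeriv Θ p u v = fderiv ℝ Θ p u v - fderiv ℝ Θ p v u := rfl

theorem oneFormDeriv_clm_apply (L : F →L[ℝ] F →L[ℝ] ℝ) (p u v : F) :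
    oneFormDeriv L p u v = L u v - L v u := by
  rw [oneFormDeriv_apply, L.fderiv]

theorem Filter.EventuallyEq.oneFormDeriv_eq {Θ Θ' : F → F →L[ℝ] ℝ} {p : F} (h : Θ =ᶠ[𝓝 p] Θ') :
    oneFormDeriv Θ p = oneFormDeriv Θ' p := by
  rw [oneFormDeriv, oneFormDeriv, h.fderiv_eq]

theorem contDiff_oneFormDeriv {Θ : F → F →L[ℝ] ℝ} (hΘ : ContDiff ℝ ∞ Θ) :
    ContDiff ℝ ∞ (oneFormDeriv Θ) := by
  have h1 : ContDiff ℝ ∞ (fderiv ℝ Θ) := hΘ.fderiv_right (m := ∞) le_rfl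
  exact h1.sub (ContDiff.comp (g := flipL F) (by fun_prop) h1)

/-- The derivative of the pullback `g^*Θ`. The term with the second derivative of `g` is symmetric
and drops out of the exterior derivative. -/
theorem differentiableAt_and_fderiv_pullback {Θ : F' → F' →L[ℝ] ℝ} {g : F → F'} {p : F}
    (hΘ : DifferentiableAt ℝ Θ (g p)) (hg : ContDiffAt ℝ 2 g p) :
    DifferentiableAt ℝ (fun q ↦ (Θ (g q)).comp (fderiv ℝ g q)) p ∧
    ∀ u v, fderiv ℝ (fun q ↦ (Θ (g q)).comp (fderiv ℝ g q)) p u v =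
      fderiv ℝ Θ (g p) (fderiv ℝ g p u) (fderiv ℝ g p v) +
        Θ (g p) (fderiv ℝ (fderiv ℝ g) p u v) := by
  have h1 : HasFDerivAt g (fderiv ℝ g p) p := (hg.differentiableAt (by simp)).hasFDerivAt
  have h2 : HasFDerivAt (fderiv ℝ g) (fderiv ℝ (fderiv ℝ g) p) p :=
    ((hg.fderiv_right (m := 1) (by norm_num)).differentiableAt one_ne_zero).hasFDerivAt
  have h3 := (hΘ.hasFDerivAt.comp p h1).clm_comp h2
  refine ⟨h3.differentiableAt, fun u v ↦ ?_⟩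
  have h4 := h3.fderiv
  simp only [Function.comp_def] at h4
  rw [h4]
  simp [add_comm]

/-- The exterior derivative commutes with pullback. -/
theorem oneFormDeriv_pullback {Θ : F' → F' →L[ℝ] ℝ} {g : F → F'} {p : F}
    (hΘ : DifferentiableAt ℝ Θ (g p)) (hg : ContDiffAt ℝ 2 g p) (u v : F) :
    oneFormDeriv (fun q ↦ (Θ (g q)).comp (fderiv ℝ g q)) p u v =
      oneFormDeriv Θ (g p) (fderiv ℝ g p u) (fderiv ℝ g p v) := by
  have hsymm : IsSymmSndFDerivAt ℝ g p := hg.isSymmSndFDerivAt (by simp)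
  rw [oneFormDeriv_apply, oneFormDeriv_apply, (differentiableAt_and_fderiv_pullback hΘ hg).2,
    (differentiableAt_and_fderiv_pullback hΘ hg).2, hsymm u v]
  ring

/-- The exterior derivative of a one-form is closed. -/
theorem oneFormDeriv_closed {Θ : F → F →L[ℝ] ℝ} (hΘ : ContDiff ℝ ∞ Θ) (p u v w : F) :
    fderiv ℝ (oneFormDeriv Θ) p u v w + fderiv ℝ (oneFormDeriv Θ) p v w u +
      fderiv ℝ (oneFormDeriv Θ) p w u v = 0 := by
  have h1 : HasFDerivAt (fderiv ℝ Θ) (fderiv ℝ (fderiv ℝ Θ) p) p :=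
    ((hΘ.fderiv_right (m := ∞) le_rfl).differentiable (by simp) p).hasFDerivAt
  have hf : HasFDerivAt (flipL F) (flipL F) (fderiv ℝ Θ p) :=
    ContinuousLinearMap.hasFDerivAt (E := F →L[ℝ] F →L[ℝ] ℝ) (F := F →L[ℝ] F →L[ℝ] ℝ) (flipL F)
  have h2 := h1.sub (HasFDerivAt.comp (F := F →L[ℝ] F →L[ℝ] ℝ) p hf h1)
  have h3 (a b c : F) : fderiv ℝ (oneFormDeriv Θ) p a b c =
      fderiv ℝ (fderiv ℝ Θ) p a b c - fderiv ℝ (fderiv ℝ Θ) p a c b := by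
    have h4 : fderiv ℝ (oneFormDeriv Θ) p = _ := h2.fderiv
    rw [h4]; rfl
  have hsymm : IsSymmSndFDerivAt ℝ Θ p :=
    hΘ.contDiffAt.isSymmSndFDerivAt (by simpa using two_le_infty)
  rw [h3, h3, h3, hsymm u v, hsymm v w, hsymm u w]
  ring

end ExteriorDerivative

/-- Two solutions on `[0, 1]` of a Lipschitz time-dependent differential equation that agree at one
of the end points agree on `[0, 1]`. -/
theorem eqOn_Icc_of_hasDerivWithinAt {F : Type*} [NormedAddCommGroup F] [NormedSpace ℝ F]
    {Y : ℝ → F → F} {K : NNReal} (hY : ∀ t ∈ Icc (0 : ℝ) 1, LipschitzWith K (Y t)) {γ γ' : ℝ → F}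
    (hγ : ∀ t ∈ Icc (0 : ℝ) 1, HasDerivWithinAt γ (Y t (γ t)) (Icc 0 1) t)
    (hγ' : ∀ t ∈ Icc (0 : ℝ) 1, HasDerivWithinAt γ' (Y t (γ' t)) (Icc 0 1) t)
    (h : γ 0 = γ' 0 ∨ γ 1 = γ' 1) : EqOn γ γ' (Icc 0 1) := by
  have hr {c : ℝ → F} (hc : ∀ t ∈ Icc (0 : ℝ) 1, HasDerivWithinAt c (Y t (c t)) (Icc 0 1) t) :
      ∀ t ∈ Ico (0 : ℝ) 1, HasDerivWithinAt c (Y t (c t)) (Ici t) t := fun t ht ↦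
    (hc t (Ico_subset_Icc_self ht)).mono_of_mem_nhdsWithin
      (Filter.mem_of_superset (Icc_mem_nhdsGE ht.2) (Icc_subset_Icc_left ht.1))
  have hl {c : ℝ → F} (hc : ∀ t ∈ Icc (0 : ℝ) 1, HasDerivWithinAt c (Y t (c t)) (Icc 0 1) t) :
      ∀ t ∈ Ioc (0 : ℝ) 1, HasDerivWithinAt c (Y t (c t)) (Iic t) t := fun t ht ↦
    (hc t (Ioc_subset_Icc_self ht)).mono_of_mem_nhdsWithin
      (Filter.mem_of_superset (Icc_mem_nhdsLE ht.1) (Icc_subset_Icc_right ht.2))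
  rcases h with h | h
  · exact ODE_solution_unique_of_mem_Icc_right (s := fun _ ↦ univ)
      (fun t ht ↦ (hY t (Ico_subset_Icc_self ht)).lipschitzOnWith)
      (HasDerivWithinAt.continuousOn hγ) (hr hγ) (fun _ _ ↦ mem_univ _)
      (HasDerivWithinAt.continuousOn hγ') (hr hγ') (fun _ _ ↦ mem_univ _) h
  · exact ODE_solution_unique_of_mem_Icc_left (s := fun _ ↦ univ)
      (fun t ht ↦ (hY t (Ioc_subset_Icc_self ht)).lipschitzOnWith)
      (HasDerivWithinAt.continuousOn hγ) (hl hγ) (fun _ _ ↦ mem_univ _)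
      (HasDerivWithinAt.continuousOn hγ') (hl hγ') (fun _ _ ↦ mem_univ _) h

variable {F : Type u} [NormedAddCommGroup F] [NormedSpace ℝ F]

/-- The linear interpolation `(1 - t) dL + t dΘ` between the exterior derivatives of a linear
one-form `L` and of a one-form `Θ`. -/
noncomputable def moserForm (L : F →L[ℝ] F →L[ℝ] ℝ) (Θ : F → F →L[ℝ] ℝ) (t : ℝ) (p : F) :
    F →L[ℝ] F →L[ℝ] ℝ :=
  (1 - t) • (L - L.flip) + t • oneFormDeriv Θ p

theorem moserForm_apply (L : F →L[ℝ] F →L[ℝ] ℝ) (Θ : F → F →L[ℝ] ℝ) (t : ℝ) (p u v : F) :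
    moserForm L Θ t p u v = (1 - t) * (L u v - L v u) + t * oneFormDeriv Θ p u v := rfl

theorem contDiff_moserForm (L : F →L[ℝ] F →L[ℝ] ℝ) {Θ : F → F →L[ℝ] ℝ} (hΘ : ContDiff ℝ ∞ Θ) :
    ContDiff ℝ ∞ (fun q : ℝ × F ↦ moserForm L Θ q.1 q.2) := by
  have h1 : ContDiff ℝ ∞ (fun q : ℝ × F ↦ oneFormDeriv Θ q.2) :=
    (contDiff_oneFormDeriv hΘ).comp contDiff_snd
  have h2 : ContDiff ℝ ∞ (fun q : ℝ × F ↦ (1 - q.1) • (L - L.flip)) := by fun_prop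
  have h3 : ContDiff ℝ ∞ (fun q : ℝ × F ↦ q.1 • oneFormDeriv Θ q.2) :=
    ContDiff.smul (F := F →L[ℝ] F →L[ℝ] ℝ) contDiff_fst h1
  exact h2.add h3

/-- The computation behind Moser's argument: the interpolating forms are constant along
the flow of a time-dependent vector field `Y` with `Ω_t(Y_t, ·) = L - Θ`. -/
theorem moserForm_const_along {L : F →L[ℝ] F →L[ℝ] ℝ} {Θ : F → F →L[ℝ] ℝ}
    (hΘ : ContDiff ℝ ∞ Θ) {Y : ℝ → F → F} {R : Set F} (hR : IsOpen R)
    (hY : ∀ t, Differentiable ℝ (Y t))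
    (hid : ∀ t ∈ Icc (0 : ℝ) 1, ∀ q ∈ R, ∀ w, moserForm L Θ t q (Y t q) w = L q w - Θ q w)
    {q u v : ℝ → F} (hq : ∀ t, HasDerivAt q (Y t (q t)) t)
    (hu : ∀ t, HasDerivAt u (fderiv ℝ (Y t) (q t) (u t)) t)
    (hv : ∀ t, HasDerivAt v (fderiv ℝ (Y t) (q t) (v t)) t)
    (hqR : ∀ t ∈ Icc (0 : ℝ) 1, q t ∈ R) :
    oneFormDeriv Θ (q 1) (u 1) (v 1) = L (u 0) (v 0) - L (v 0) (u 0) := by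
  set Ω := oneFormDeriv Θ with hΩ
  have hΩd : Differentiable ℝ Ω := (contDiff_oneFormDeriv hΘ).differentiable (by simp)
  -- the defining identity of `Y`, differentiated in a direction `a`
  have hdiff (t : ℝ) (ht : t ∈ Icc (0 : ℝ) 1) (a w : F) :
      (1 - t) * (L (fderiv ℝ (Y t) (q t) a) w - L w (fderiv ℝ (Y t) (q t) a)) +
        t * (fderiv ℝ Ω (q t) a (Y t (q t)) w + Ω (q t) (fderiv ℝ (Y t) (q t) a) w) =
      L a w - fderiv ℝ Θ (q t) a w := by
    have hYt := (hY t (q t)).hasFDerivAt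
    have h1 : HasFDerivAt (fun p ↦ (1 - t) * (L (Y t p) w - L w (Y t p)) + t * Ω p (Y t p) w)
        ((1 - t) • (((L.flip w).comp (fderiv ℝ (Y t) (q t))) -
          ((L w).comp (fderiv ℝ (Y t) (q t)))) +
          t • (((ContinuousLinearMap.apply ℝ ℝ w).comp
            ((Ω (q t)).comp (fderiv ℝ (Y t) (q t)) +
              (fderiv ℝ Ω (q t)).flip (Y t (q t)))))) (q t) := by
      have ha : HasFDerivAt (fun p ↦ L (Y t p) w) ((L.flip w).comp (fderiv ℝ (Y t) (q t))) (q t) :=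
        (L.flip w).hasFDerivAt.comp (q t) hYt
      have hb : HasFDerivAt (fun p ↦ L w (Y t p)) ((L w).comp (fderiv ℝ (Y t) (q t))) (q t) :=
        (L w).hasFDerivAt.comp (q t) hYt
      have hc := (hΩd (q t)).hasFDerivAt.clm_apply hYt
      have hd : HasFDerivAt (fun p ↦ Ω p (Y t p) w) _ (q t) :=
        (ContinuousLinearMap.apply ℝ ℝ w).hasFDerivAt.comp (q t) hc
      exact ((ha.sub hb).const_mul (1 - t)).add (hd.const_mul t)
    have h2 : HasFDerivAt (fun p ↦ L p w - Θ p w)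
        (L.flip w - (ContinuousLinearMap.apply ℝ ℝ w).comp (fderiv ℝ Θ (q t))) (q t) :=
      (L.flip w).hasFDerivAt.sub ((ContinuousLinearMap.apply ℝ ℝ w).hasFDerivAt.comp (q t)
        ((hΘ.differentiable (by simp)) (q t)).hasFDerivAt)
    have h3 : (fun p ↦ (1 - t) * (L (Y t p) w - L w (Y t p)) + t * Ω p (Y t p) w) =ᶠ[𝓝 (q t)]
        (fun p ↦ L p w - Θ p w) := by
      filter_upwards [hR.mem_nhds (hqR t ht)] with p hp
      exact hid t ht p hp w
    have h4 := DFunLike.congr_fun (h1.unique (h2.congr_of_eventuallyEq h3)) a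
    simp only [add_apply, sub_apply, smul_apply, ContinuousLinearMap.comp_apply,
      ContinuousLinearMap.flip_apply, ContinuousLinearMap.apply_apply, smul_eq_mul] at h4
    linarith
  have hskew (p a b : F) : Ω p a b = - Ω p b a := by
    simp [hΩ, oneFormDeriv_apply]
  have hskew' (p c a b : F) : fderiv ℝ Ω p c a b = - fderiv ℝ Ω p c b a := by
    have h1 := ((hΩd p).hasFDerivAt.eval_const a).eval_const b
    have h2 := ((hΩd p).hasFDerivAt.eval_const b).eval_const a
    have h3 := h1.unique (h2.neg.congr_of_eventuallyEq
      (Filter.Eventually.of_forall fun p ↦ hskew p a b))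
    simpa using DFunLike.congr_fun h3 c
  -- the interpolating form at time `t`, evaluated on the transported vectors `u t` and `v t`
  set m : ℝ → ℝ := fun t ↦
    (1 - t) * (L (u t) (v t) - L (v t) (u t)) + t * Ω (q t) (u t) (v t) with hm
  have hder (t : ℝ) (ht : t ∈ Icc (0 : ℝ) 1) : HasDerivAt m 0 t := by
    have h1 := (hasDerivAt_const t L).bilin_apply (hu t) (hv t)
    have h2 := (hasDerivAt_const t L).bilin_apply (hv t) (hu t)
    have h0 : HasDerivAt (fun t ↦ Ω (q t)) (fderiv ℝ Ω (q t) (Y t (q t))) t :=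
      (hΩd (q t)).hasFDerivAt.comp_hasDerivAt t (hq t)
    have h3 := h0.bilin_apply (hu t) (hv t)
    have h4 := (((hasDerivAt_id t).const_sub 1).mul (h1.sub h2)).add ((hasDerivAt_id t).mul h3)
    refine h4.congr_deriv ?_
    -- besides the differentiated identity, the closedness of `dΘ` is used
    have e1 := hdiff t ht (u t) (v t)
    have e2 := hdiff t ht (v t) (u t)
    have e3 := oneFormDeriv_closed hΘ (q t) (Y t (q t)) (u t) (v t)
    have e4 : Ω (q t) (u t) (v t) = fderiv ℝ Θ (q t) (u t) (v t) - fderiv ℝ Θ (q t) (v t) (u t) :=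
      rfl
    have e5 := hskew (q t) (u t) (fderiv ℝ (Y t) (q t) (v t))
    have e6 := hskew' (q t) (u t) (v t) (Y t (q t))
    rw [← hΩ] at e3
    rw [e6] at e3
    simp only [id, zero_apply, e5, zero_add, Pi.sub_apply]
    linear_combination e1 - e2 + t * e3 + e4
  have hconst := constant_of_has_deriv_right_zero (f := m) (a := 0) (b := 1)
    (fun t ht ↦ (hder t ht).continuousAt.continuousWithinAt)
    (fun t ht ↦ (hder t (Ico_subset_Icc_self ht)).hasDerivWithinAt) 1 (by simp)
  simpa [hm] using hconst

end Moser

/-! ### Moser's argument near a point -/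

section LocalMoser

set_option maxSynthPendingDepth 3

universe u

/-- A smooth map on an open set `O` of a finite-dimensional space agrees near a compact subset of
`O` with a compactly supported smooth map. -/
theorem exists_contDiff_hasCompactSupport_eq {H G : Type*} [NormedAddCommGroup H]
    [NormedSpace ℝ H] [FiniteDimensional ℝ H] [NormedAddCommGroup G] [NormedSpace ℝ G]
    {O K : Set H} (hO : IsOpen O) (hK : IsCompact K) (hKO : K ⊆ O) {g : H → G}
    (hg : ContDiffOn ℝ ∞ g O) :
    ∃ g' : H → G, ContDiff ℝ ∞ g' ∧ HasCompactSupport g' ∧ ∀ᶠ q in 𝓝ˢ K, g' q = g q := by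
  have : ProperSpace H := FiniteDimensional.proper ℝ H
  obtain ⟨C, hC, hKC, hCO⟩ := exists_compact_between hK hO hKO
  obtain ⟨χ, h0, h1, -⟩ := exists_contMDiffMap_zero_one_nhds_of_isClosed (n := ⊤) 𝓘(ℝ, H)
    isOpen_interior.isClosed_compl hK.isClosed
    (disjoint_compl_left_iff_subset.2 hKC)
  have hχ : ContDiff ℝ ∞ χ := χ.contMDiff.contDiff
  refine ⟨fun q ↦ χ q • g q, contDiff_iff_contDiffAt.2 fun p ↦ ?_,
    HasCompactSupport.intro hC fun p hp ↦ ?_, ?_⟩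
  · by_cases hp : p ∈ O
    · exact hχ.contDiffAt.smul (hg.contDiffAt (hO.mem_nhds hp))
    · have h2 : ∀ᶠ q in 𝓝 p, χ q = 0 :=
        (Filter.eventually_iff_exists_mem.1 h0).elim fun V hV ↦
          Filter.eventually_of_mem (mem_nhdsSet_iff_forall.1 hV.1 p
            fun h ↦ hp (hCO (interior_subset h))) hV.2
      have h3 : (fun q ↦ χ q • g q) =ᶠ[𝓝 p] fun _ ↦ 0 := by
        filter_upwards [h2] with q hq
        simp [hq]
      exact contDiffAt_const.congr_of_eventuallyEq h3
  · have : χ p = 0 := h0.self_of_nhdsSet p fun h ↦ hp (interior_subset h)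
    simp [this]
  · filter_upwards [h1] with q hq
    simp [hq]

/-- A nondegenerate bilinear form on a finite-dimensional space identifies it with its dual. -/
theorem isInvertible_of_injective {F : Type*} [NormedAddCommGroup F] [NormedSpace ℝ F]
    [FiniteDimensional ℝ F] (B : F →L[ℝ] F →L[ℝ] ℝ) (hB : Function.Injective B) :
    B.IsInvertible := by
  have hfr : Module.finrank ℝ F = Module.finrank ℝ (F →L[ℝ] ℝ) := by
    rw [(LinearMap.toContinuousLinearMap (𝕜 := ℝ) (E := F) (F' := ℝ)).symm.finrank_eq]
    exact (Subspace.dual_finrank_eq).symm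
  exact ⟨(LinearEquiv.ofInjectiveOfFinrankEq B.toLinearMap hB hfr).toContinuousLinearEquiv,
    by ext; rfl⟩

theorem isOpen_setOf_isInvertible {F G : Type*} [NormedAddCommGroup F] [NormedSpace ℝ F]
    [CompleteSpace F] [NormedAddCommGroup G] [NormedSpace ℝ G] :
    IsOpen {B : F →L[ℝ] G | B.IsInvertible} := by
  rw [isOpen_iff_mem_nhds]
  rintro _ ⟨e, rfl⟩
  exact Filter.mem_of_superset e.nhds fun B ⟨e', he'⟩ ↦ ⟨e', he'⟩

/-- The data produced by Moser's argument near a point `z`: a time-dependent vector field `Y`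
which solves `Ω_t(Y_t, ·) = L - Θ` on a neighbourhood `R` of `z`, its flow `κ` starting at time `0`,
and the inverse `inv` of the time-one map `κ 1`. -/
structure MoserData {F : Type*} [NormedAddCommGroup F] [NormedSpace ℝ F]
    (L : F →L[ℝ] F →L[ℝ] ℝ) (Θ : F → F →L[ℝ] ℝ) (z : F) where
  /-- The neighbourhood on which the vector field solves Moser's equation. -/
  R : Set F
  /-- The time-dependent vector field. -/
  Y : ℝ → F → F
  /-- A Lipschitz constant of the vector field. -/
  K : NNReal
  /-- The flow from time `0`. -/
  κ : ℝ → F → F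
  /-- The inverse of the time-one map. -/
  inv : F → F
  isOpen : IsOpen R
  mem : z ∈ R
  lipschitz : ∀ t, LipschitzWith K (Y t)
  eq_iff : ∀ t ∈ Icc (0 : ℝ) 1, ∀ q ∈ R, ∀ v,
    (∀ w, moserForm L Θ t q v w = L q w - Θ q w) ↔ v = Y t q
  contDiff : ContDiff ℝ ∞ (fun q : ℝ × F ↦ κ q.1 q.2)
  zero : ∀ p, κ 0 p = p
  hasDerivAt : ∀ p t, HasDerivAt (fun s ↦ κ s p) (Y t (κ t p)) t
  contDiff_inv : ContDiff ℝ ∞ inv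
  inv_apply : ∀ p, inv (κ 1 p) = p
  apply_inv : ∀ p, κ 1 (inv p) = p
  pullback : ∀ p, (∀ t ∈ Icc (0 : ℝ) 1, κ t p ∈ R) → ∀ u v,
    oneFormDeriv Θ (κ 1 p) (fderiv ℝ (κ 1) p u) (fderiv ℝ (κ 1) p v) = L u v - L v u

/-- Moser's argument near a point `z` at which the interpolating forms are nondegenerate. The field
`Y` is extended by a cut-off to a compactly supported one, and the flow of a time-dependent field is
obtained from that of the autonomous field `(1, Y)` on `ℝ × F`. -/
theorem nonempty_moserData {F : Type u} [NormedAddCommGroup F] [NormedSpace ℝ F]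
    [FiniteDimensional ℝ F] {L : F →L[ℝ] F →L[ℝ] ℝ} {Θ : F → F →L[ℝ] ℝ} (hΘ : ContDiff ℝ ∞ Θ)
    {z : F} (hnd : ∀ t ∈ Icc (0 : ℝ) 1, Function.Injective (moserForm L Θ t z)) :
    Nonempty (MoserData L Θ z) := by
  have hcomplete : CompleteSpace F := FiniteDimensional.complete ℝ F
  set B : ℝ × F → F →L[ℝ] F →L[ℝ] ℝ := fun q ↦ moserForm L Θ q.1 q.2 with hB
  have hBs : ContDiff ℝ ∞ B := contDiff_moserForm L hΘ
  set O : Set (ℝ × F) := {q | (B q).IsInvertible} with hO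
  have hOopen : IsOpen O := isOpen_setOf_isInvertible.preimage hBs.continuous
  have hKO : Icc (0 : ℝ) 1 ×ˢ {z} ⊆ O := by
    rintro ⟨t, q⟩ ⟨ht, rfl⟩
    exact isInvertible_of_injective _ (hnd t ht)
  have hY₀ : ContDiffOn ℝ ∞ (fun q ↦ (B q).inverse (L q.2 - Θ q.2)) O := by
    intro q hq
    have h1 : ContDiffAt ℝ ∞ (fun q ↦ (B q).inverse) q :=
      ContDiffAt.comp (f := B) (g := ContinuousLinearMap.inverse) q
        (ContinuousLinearMap.IsInvertible.contDiffAt_map_inverse hq) hBs.contDiffAt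
    have h2 : ContDiff ℝ ∞ (fun q : ℝ × F ↦ L q.2 - Θ q.2) :=
      (L.contDiff.comp contDiff_snd).sub (hΘ.comp contDiff_snd)
    exact (h1.clm_apply h2.contDiffAt).contDiffWithinAt
  obtain ⟨Y, hYs, hYc, hYeq⟩ := exists_contDiff_hasCompactSupport_eq hOopen
    (isCompact_Icc.prod isCompact_singleton) hKO hY₀
  obtain ⟨K, hK⟩ := hYs.lipschitzWith_of_hasCompactSupport hYc (by simp)
  -- a neighbourhood of `z` on which the forms are invertible and the cut-off is invisible
  have hev : ∀ᶠ p in 𝓝 z, ∀ t ∈ Icc (0 : ℝ) 1,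
      (t, p) ∈ O ∧ Y (t, p) = (B (t, p)).inverse (L p - Θ p) := by
    refine isCompact_Icc.eventually_forall_of_forall_eventually fun t ht ↦ ?_
    have h1 : ∀ᶠ q in 𝓝 (t, z), q ∈ O ∧ Y q = (B q).inverse (L q.2 - Θ q.2) := by
      refine (hOopen.eventually_mem (hKO ⟨ht, mem_singleton z⟩)).and ?_
      obtain ⟨V, hV, hV'⟩ := Filter.eventually_iff_exists_mem.1 hYeq
      exact Filter.eventually_of_mem (mem_nhdsSet_iff_forall.1 hV _ ⟨ht, mem_singleton z⟩) hV'
    exact (continuous_swap.tendsto (z, t)).eventually h1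
  obtain ⟨R, hRsub, hRopen, hzR⟩ := eventually_nhds_iff.1 hev
  -- the flow of the autonomous field `(1, Y)` on `ℝ × F`
  set f : ℝ × F → ℝ × F := fun q ↦ (1, Y q) with hf
  have hfs : ContDiff ℝ ∞ f := contDiff_const.prodMk hYs
  have hfK : LipschitzWith K f := by
    have := (LipschitzWith.const (α := ℝ × F) (1 : ℝ)).prodMk hK
    simpa using this
  obtain ⟨φ, hφ⟩ := exists_isSmoothFlow hfs hfK
  have hfst (q : ℝ × F) (t : ℝ) : (φ t q).1 = t + q.1 := by
    have h1 : ∀ s, HasDerivAt (fun s ↦ (φ s q).1 - s) 0 s := fun s ↦ by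
      have h2 : HasDerivAt (fun s ↦ (φ s q).1) 1 s := (hφ.hasDerivAt q s).fst
      have h3 := h2.sub (hasDerivAt_id' s)
      rw [sub_self] at h3
      exact h3
    have h2 := is_const_of_deriv_eq_zero (fun s ↦ (h1 s).differentiableAt)
      (fun s ↦ (h1 s).deriv) t 0
    simp only [hφ.zero] at h2
    linarith
  set κ : ℝ → F → F := fun t p ↦ (φ t (0, p)).2 with hκ
  have hφκ (t : ℝ) (p : F) : φ t (0, p) = (t, κ t p) :=
    Prod.ext (by simp [hfst]) rfl
  have hκs : ContDiff ℝ ∞ (fun q : ℝ × F ↦ κ q.1 q.2) :=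
    contDiff_snd.comp (hφ.contDiff.comp
      (contDiff_fst.prodMk (contDiff_const.prodMk contDiff_snd)))
  have hκd (p : F) (t : ℝ) : HasDerivAt (fun s ↦ κ s p) (Y (t, κ t p)) t := by
    have := (hφ.hasDerivAt (0, p) t).snd
    rwa [hφκ] at this
  have hYt (t : ℝ) : ContDiff ℝ ∞ (fun p ↦ Y (t, p)) := hYs.comp (contDiff_prodMk_right t)
  have hκt (t : ℝ) : ContDiff ℝ ∞ (κ t) := hκs.comp (contDiff_prodMk_right t)
  -- the variational equation for `κ`
  have hvar (p u : F) (t : ℝ) : HasDerivAt (fun s ↦ fderiv ℝ (κ s) p u)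
      (fderiv ℝ (fun p ↦ Y (t, p)) (κ t p) (fderiv ℝ (κ t) p u)) t := by
    have h1 := hφ.hasDerivAt_fderiv hfs (0, p) (0, u) t
    have h2 (s : ℝ) : fderiv ℝ (φ s) (0, p) (0, u) = (0, fderiv ℝ (κ s) p u) := by
      have ha : HasFDerivAt (fun p ↦ φ s (0, p))
          ((fderiv ℝ (φ s) (0, p)).comp (ContinuousLinearMap.inr ℝ ℝ F)) p :=
        (hφ.hasFDerivAt_apply s (0, p)).comp p (hasFDerivAt_prodMk_right (𝕜 := ℝ) (0 : ℝ) p)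
      have hb : HasFDerivAt (fun p ↦ φ s (0, p))
          ((0 : F →L[ℝ] ℝ).prod (fderiv ℝ (κ s) p)) p := by
        simp_rw [hφκ]
        exact (hasFDerivAt_const s p).prodMk (((hκt s).differentiable (by simp)) p).hasFDerivAt
      exact DFunLike.congr_fun (ha.unique hb) u
    simp_rw [h2, hφκ] at h1
    have h3 : fderiv ℝ f (t, κ t p) (0, fderiv ℝ (κ t) p u) =
        (0, fderiv ℝ (fun p ↦ Y (t, p)) (κ t p) (fderiv ℝ (κ t) p u)) := by
      have ha : HasFDerivAt f ((0 : ℝ × F →L[ℝ] ℝ).prod (fderiv ℝ Y (t, κ t p))) (t, κ t p) :=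
        (hasFDerivAt_const (1 : ℝ) _).prodMk ((hYs.differentiable (by simp)) _).hasFDerivAt
      have hb : HasFDerivAt (fun p ↦ Y (t, p))
          ((fderiv ℝ Y (t, κ t p)).comp (ContinuousLinearMap.inr ℝ ℝ F)) (κ t p) :=
        ((hYs.differentiable (by simp)) (t, κ t p)).hasFDerivAt.comp (κ t p)
          (hasFDerivAt_prodMk_right (𝕜 := ℝ) t (κ t p))
      rw [ha.fderiv, hb.fderiv]
      rfl
    rw [h3] at h1
    exact h1.snd
  have hiff : ∀ t ∈ Icc (0 : ℝ) 1, ∀ q ∈ R, ∀ v,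
      (∀ w, moserForm L Θ t q v w = L q w - Θ q w) ↔ v = Y (t, q) := by
    intro t ht q hq v
    obtain ⟨hinv, hYq⟩ := hRsub q hq t ht
    obtain ⟨e, he⟩ := hinv
    have h1 : (B (t, q)).inverse = (e.symm : (F →L[ℝ] ℝ) →L[ℝ] F) := by
      rw [← he, ContinuousLinearMap.inverse_equiv]
    have h2 (w : F) : moserForm L Θ t q v w = e v w := by
      rw [← ContinuousLinearEquiv.coe_coe, he]
    rw [hYq, h1, ContinuousLinearEquiv.coe_coe, ContinuousLinearEquiv.eq_symm_apply]
    exact ⟨fun h ↦ ContinuousLinearMap.ext fun w ↦ (h2 w).symm.trans (h w),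
      fun h w ↦ (h2 w).trans (by rw [h]; rfl)⟩
  refine ⟨{ R := R, Y := fun t p ↦ Y (t, p), K := K, κ := κ, inv := fun p ↦ (φ (-1) (1, p)).2,
            isOpen := hRopen, mem := hzR, eq_iff := hiff, contDiff := hκs, hasDerivAt := hκd,
            lipschitz := fun t ↦ ?_, zero := fun p ↦ by simp [hκ, hφ.zero],
            contDiff_inv := ?_, inv_apply := fun p ↦ ?_, apply_inv := fun p ↦ ?_,
            pullback := fun p hp u v ↦ ?_ }⟩
  · have h1 := hK.comp (LipschitzWith.prodMk_left (α := ℝ) (β := F) t)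
    rwa [mul_one] at h1
  · exact contDiff_snd.comp ((hφ.contDiff_apply (-1)).comp (contDiff_prodMk_right 1))
  · rw [← hφκ, hφ.neg_apply hfK]
  · have h1 : φ (-1) (1, p) = (0, (φ (-1) (1, p)).2) := Prod.ext (by simp [hfst]) rfl
    change (φ 1 (0, (φ (-1) (1, p)).2)).2 = p
    rw [← h1, hφ.apply_neg hfK]
  · have h0 : κ 0 = id := by
      ext q
      simp [hκ, hφ.zero]
    have := moserForm_const_along hΘ hRopen (fun t ↦ (hYt t).differentiable (by simp))
      (fun t ht q hq ↦ (hiff t ht q hq _).2 rfl) (hκd p) (hvar p u) (hvar p v) hp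
    rw [h0] at this
    simpa using this

namespace MoserData

variable {F : Type*} [NormedAddCommGroup F] [NormedSpace ℝ F]
  {L : F →L[ℝ] F →L[ℝ] ℝ} {Θ : F → F →L[ℝ] ℝ} {z : F} (D : MoserData L Θ z)

theorem contDiff_apply (t : ℝ) : ContDiff ℝ ∞ (D.κ t) :=
  D.contDiff.comp (contDiff_prodMk_right t)

/-- The points where the two one-forms agree are zeros of `Y` and are fixed by its flow. -/
theorem apply_eq_self {q : F} (hq : q ∈ D.R) (h : L q = Θ q) {t : ℝ} (ht : t ∈ Icc (0 : ℝ) 1) :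
    D.κ t q = q := by
  have h0 : ∀ s ∈ Icc (0 : ℝ) 1, (0 : F) = D.Y s q := fun s hs ↦
    (D.eq_iff s hs q hq 0).1 fun w ↦ by simp [h]
  exact eqOn_Icc_of_hasDerivWithinAt (fun t _ ↦ D.lipschitz t) (γ' := fun _ ↦ q)
    (fun s _ ↦ (D.hasDerivAt q s).hasDerivWithinAt)
    (fun s hs ↦ by rw [← h0 s hs]; exact hasDerivWithinAt_const s _ q) (Or.inl (D.zero q)) ht

theorem eventually_forall_mem (hz : L z = Θ z) {B : Set F} (hB : B ∈ 𝓝 z) :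
    ∀ᶠ p in 𝓝 z, ∀ t ∈ Icc (0 : ℝ) 1, D.κ t p ∈ B := by
  refine isCompact_Icc.eventually_forall_of_forall_eventually fun t ht ↦ ?_
  have h1 : Continuous fun q : F × ℝ ↦ D.κ q.2 q.1 := D.contDiff.continuous.comp continuous_swap
  refine h1.continuousAt.eventually ?_
  change ∀ᶠ y in 𝓝 (D.κ t z), y ∈ B
  rw [D.apply_eq_self D.mem hz ht]
  exact hB

theorem injective_oneFormDeriv {q : F} (hq : q ∈ D.R) {v : F}
    (hv : ∀ w, oneFormDeriv Θ q v w = 0) : v = 0 := by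
  have h1 : (1 : ℝ) ∈ Icc (0 : ℝ) 1 := ⟨zero_le_one, le_rfl⟩
  have h2 := (D.eq_iff 1 h1 q hq (D.Y 1 q)).2 rfl
  have h3 : D.Y 1 q + v = D.Y 1 q := (D.eq_iff 1 h1 q hq _).1 fun w ↦ by
    rw [← h2 w, map_add, add_apply]
    simp [moserForm_apply, hv w]
  simpa using h3

end MoserData

end LocalMoser

/-! ### Poisson sprays in coordinates -/

section LocalSpray

set_option maxSynthPendingDepth 3

universe u

/-- The canonical one-form of `E × E*`: at the point `q = (y, ξ)` it maps `(a, α)` to `ξ a`. -/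
noncomputable def liouvilleForm (E : Type*) [NormedAddCommGroup E] [NormedSpace ℝ E] :
    (E × (E →L[ℝ] ℝ)) →L[ℝ] (E × (E →L[ℝ] ℝ)) →L[ℝ] ℝ :=
  ((ContinuousLinearMap.compL ℝ (E × (E →L[ℝ] ℝ)) E ℝ).flip
    (ContinuousLinearMap.fst ℝ E (E →L[ℝ] ℝ))).comp (ContinuousLinearMap.snd ℝ E (E →L[ℝ] ℝ))

@[simp] theorem liouvilleForm_apply {E : Type*} [NormedAddCommGroup E] [NormedSpace ℝ E]
    (q u : E × (E →L[ℝ] ℝ)) : liouvilleForm E q u = q.2 u.1 := rfl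

/-- A linear differential equation on `[0, 1]` has a solution with a given value at any time `s₀`.
The bound on the coefficients lets the Picard–Lindelöf theorem apply on the whole interval at once.
-/
theorem exists_solution_of_linear {V : Type*} [NormedAddCommGroup V] [NormedSpace ℝ V]
    [CompleteSpace V] {A : ℝ → V →L[ℝ] V} {b : ℝ → V} (hA : ContinuousOn A (Icc 0 1))
    (hb : ContinuousOn b (Icc 0 1)) (hA4 : ∀ t ∈ Icc (0 : ℝ) 1, ‖A t‖ ≤ 1 / 4) {s₀ : ℝ}
    (hs₀ : s₀ ∈ Icc (0 : ℝ) 1) (x₀ : V) :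
    ∃ x : ℝ → V, x s₀ = x₀ ∧
      ∀ t ∈ Icc (0 : ℝ) 1, HasDerivWithinAt x (A t (x t) + b t) (Icc 0 1) t := by
  obtain ⟨C, hC⟩ := isCompact_Icc.exists_bound_of_continuousOn hb
  have hC0 : 0 ≤ C := (norm_nonneg _).trans (hC 0 ⟨le_rfl, zero_le_one⟩)
  -- the radius `a` of the Picard–Lindelöf ball satisfies `(‖x₀‖ + a) / 4 + C ≤ a`
  set a : NNReal := ⟨2 * C + ‖x₀‖ + 1, by positivity⟩ with ha
  have ha' : (a : ℝ) = 2 * C + ‖x₀‖ + 1 := rfl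
  have hPL : IsPicardLindelof (fun t x ↦ A t x + b t) (⟨s₀, hs₀⟩ : Icc (0 : ℝ) 1) x₀ a 0 a 1 :=
    { lipschitzOnWith := fun t ht ↦ by
        refine LipschitzWith.lipschitzOnWith (LipschitzWith.of_dist_le_mul fun x y ↦ ?_)
        rw [dist_add_right, dist_eq_norm, ← map_sub, dist_eq_norm]
        refine ((A t).le_opNorm _).trans ?_
        have := hA4 t ht
        rw [NNReal.coe_one]
        gcongr
        linarith
      continuousOn := fun x _ ↦ (hA.clm_apply continuousOn_const).add hb
      norm_le := fun t ht x hx ↦ by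
        have h1 : ‖x‖ ≤ ‖x₀‖ + a := by
          have h2 : ‖x - x₀‖ ≤ a := by simpa [dist_eq_norm] using hx
          have h3 := norm_add_le (x - x₀) x₀
          rw [sub_add_cancel] at h3
          linarith
        have h4 : ‖A t x‖ ≤ 1 / 4 * (‖x₀‖ + a) :=
          ((A t).le_opNorm _).trans (mul_le_mul (hA4 t ht) h1 (norm_nonneg _) (by norm_num))
        have h5 := norm_add_le (A t x) (b t)
        have h6 := hC t ht
        have h7 := norm_nonneg x₀
        linarith
      mul_max_le := by
        have : max (1 - s₀) (s₀ - 0) ≤ 1 := max_le (by linarith [hs₀.1]) (by linarith [hs₀.2])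
        simpa using mul_le_mul_of_nonneg_left this a.2 }
  exact hPL.exists_eq_forall_mem_Icc_hasDerivWithinAt₀

variable {E : Type u} [NormedAddCommGroup E] [NormedSpace ℝ E]

/-- The Poisson tensor is as smooth as the spray, because `P y` is the derivative at `0` of the
linear map `ξ ↦ (G (y, ξ)).1`. -/
theorem contDiffOn_of_fst_eq {U : Set E} {P : E → (E →L[ℝ] ℝ) →L[ℝ] E}
    {G : E × (E →L[ℝ] ℝ) → E × (E →L[ℝ] ℝ)} (hU : IsOpen U) (hG : ContDiffOn ℝ ∞ G (U ×ˢ univ))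
    (hfst : ∀ y ∈ U, ∀ ξ : E →L[ℝ] ℝ, (G (y, ξ)).1 = P y ξ) : ContDiffOn ℝ ∞ P U := by
  have hopen : IsOpen (U ×ˢ (univ : Set (E →L[ℝ] ℝ))) := hU.prod isOpen_univ
  have h1 : ContDiffOn ℝ ∞ (fun y ↦ fderiv ℝ G (y, 0)) U := by
    have h2 : ContDiffOn ℝ ∞ (fderiv ℝ G) (U ×ˢ univ) :=
      hG.fderiv_of_isOpen hopen (m := ∞) le_rfl
    exact h2.comp (contDiff_prodMk_left 0).contDiffOn fun y hy ↦ ⟨hy, mem_univ _⟩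
  have h3 : ContDiffOn ℝ ∞ (fun y ↦ ((ContinuousLinearMap.fst ℝ E (E →L[ℝ] ℝ)).comp
      (fderiv ℝ G (y, 0))).comp (ContinuousLinearMap.inr ℝ E (E →L[ℝ] ℝ))) U :=
    (contDiffOn_const.clm_comp h1).clm_comp contDiffOn_const
  refine h3.congr fun y hy ↦ ?_
  have h4 : HasFDerivAt (fun ξ ↦ (G (y, ξ)).1) (((ContinuousLinearMap.fst ℝ E (E →L[ℝ] ℝ)).comp
      (fderiv ℝ G (y, 0))).comp (ContinuousLinearMap.inr ℝ E (E →L[ℝ] ℝ))) 0 :=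
    ((ContinuousLinearMap.fst ℝ E (E →L[ℝ] ℝ)).hasFDerivAt.comp (y, (0 : E →L[ℝ] ℝ))
      ((hG.contDiffAt (hopen.mem_nhds ⟨hy, mem_univ _⟩)).differentiableAt
        (by simp)).hasFDerivAt).comp 0
      (hasFDerivAt_prodMk_right (𝕜 := ℝ) y 0)
  have h5 : (fun ξ ↦ (G (y, ξ)).1) = P y := funext (hfst y hy)
  rw [h5] at h4
  exact (P y).hasFDerivAt.unique h4

/-- The coordinate expression of a Poisson spray over an open subset `U` of the model space: `P` is
the coordinate expression of the Poisson tensor `π^#`, and `G` that of the vector field. The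
homogeneity of the first component of `G` follows from `fst_eq`. -/
structure IsLocalSpray (U : Set E) (P : E → (E →L[ℝ] ℝ) →L[ℝ] E)
    (G : E × (E →L[ℝ] ℝ) → E × (E →L[ℝ] ℝ)) : Prop where
  isOpen : IsOpen U
  contDiffOn : ContDiffOn ℝ ∞ G (U ×ˢ univ)
  fst_eq : ∀ y ∈ U, ∀ ξ : E →L[ℝ] ℝ, (G (y, ξ)).1 = P y ξ
  quadratic : ∀ y ∈ U, ∀ ξ : E →L[ℝ] ℝ, ∀ c : ℝ, c ≠ 0 → (G (y, c • ξ)).2 = c ^ 2 • (G (y, ξ)).2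
  skew : ∀ y ∈ U, ∀ ξ η : E →L[ℝ] ℝ, η (P y ξ) = -ξ (P y η)
  jacobi : ∀ y ∈ U, ∀ ξ η ζ : E →L[ℝ] ℝ, ξ (fderiv ℝ P y (P y ζ) η) + η (fderiv ℝ P y (P y ξ) ζ) +
    ζ (fderiv ℝ P y (P y η) ξ) = 0

namespace IsLocalSpray

variable {U : Set E} {P : E → (E →L[ℝ] ℝ) →L[ℝ] E} {G : E × (E →L[ℝ] ℝ) → E × (E →L[ℝ] ℝ)}

theorem isOpen_prod (h : IsLocalSpray U P G) : IsOpen (U ×ˢ (univ : Set (E →L[ℝ] ℝ))) :=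
  h.isOpen.prod isOpen_univ

theorem differentiableAt (h : IsLocalSpray U P G) {q : E × (E →L[ℝ] ℝ)} (hq : q.1 ∈ U) :
    DifferentiableAt ℝ G q :=
  (h.contDiffOn.contDiffAt (h.isOpen_prod.mem_nhds ⟨hq, mem_univ _⟩)).differentiableAt (by simp)

theorem contDiffOn_tensor (h : IsLocalSpray U P G) : ContDiffOn ℝ ∞ P U :=
  contDiffOn_of_fst_eq h.isOpen h.contDiffOn h.fst_eq

theorem hasFDerivAt_tensor (h : IsLocalSpray U P G) {y : E} (hy : y ∈ U) :
    HasFDerivAt P (fderiv ℝ P y) y :=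
  ((h.contDiffOn_tensor.contDiffAt (h.isOpen.mem_nhds hy)).differentiableAt
    (by simp)).hasFDerivAt

/-- The first component of the derivative of the spray. It involves `G` only through `P`, since
`(G (y, ξ)).1 = P y ξ`. -/
theorem fderiv_apply_fst (h : IsLocalSpray U P G) {q : E × (E →L[ℝ] ℝ)} (hq : q.1 ∈ U)
    (u : E × (E →L[ℝ] ℝ)) :
    (fderiv ℝ G q u).1 = fderiv ℝ P q.1 u.1 q.2 + P q.1 u.2 := by
  have h1 : HasFDerivAt (fun q ↦ (G q).1)
      ((ContinuousLinearMap.fst ℝ E (E →L[ℝ] ℝ)).comp (fderiv ℝ G q)) q :=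
    (ContinuousLinearMap.fst ℝ E (E →L[ℝ] ℝ)).hasFDerivAt.comp q
      (h.differentiableAt hq).hasFDerivAt
  have h2 : HasFDerivAt (fun q : E × (E →L[ℝ] ℝ) ↦ P q.1)
      ((fderiv ℝ P q.1).comp (ContinuousLinearMap.fst ℝ E (E →L[ℝ] ℝ))) q :=
    (h.hasFDerivAt_tensor hq).comp q hasFDerivAt_fst
  have h3 := h2.clm_apply (hasFDerivAt_snd (𝕜 := ℝ) (p := q))
  have h4 : (fun q ↦ (G q).1) =ᶠ[𝓝 q] fun q ↦ P q.1 q.2 := by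
    filter_upwards [h.isOpen_prod.mem_nhds ⟨hq, mem_univ _⟩] with q' hq'
    exact h.fst_eq q'.1 hq'.1 q'.2
  have h5 := DFunLike.congr_fun (h1.unique (h3.congr_of_eventuallyEq h4)) u
  simpa [add_comm] using h5

theorem fderiv_skew (h : IsLocalSpray U P G) {y : E} (hy : y ∈ U) (w : E) (ξ η : E →L[ℝ] ℝ) :
    η (fderiv ℝ P y w ξ) = -ξ (fderiv ℝ P y w η) := by
  have h1 (ξ η : E →L[ℝ] ℝ) : HasFDerivAt (fun y ↦ η (P y ξ)) (η.comp ((fderiv ℝ P y).flip ξ)) y :=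
    η.hasFDerivAt.comp y ((h.hasFDerivAt_tensor hy).eval_const ξ)
  have h2 : (fun y ↦ η (P y ξ)) =ᶠ[𝓝 y] fun y ↦ -ξ (P y η) := by
    filter_upwards [h.isOpen.mem_nhds hy] with y' hy'
    exact h.skew y' hy' ξ η
  exact DFunLike.congr_fun ((h1 ξ η).unique ((h1 η ξ).neg.congr_of_eventuallyEq h2)) w

theorem zero_section (h : IsLocalSpray U P G) {y : E} (hy : y ∈ U) : G (y, 0) = 0 := by
  refine Prod.ext (by rw [h.fst_eq y hy, map_zero]; rfl) ?_
  have h1 := h.quadratic y hy 0 2 two_ne_zero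
  rw [smul_zero] at h1
  have h2 : (3 : ℝ) • (G (y, 0)).2 = 0 := by
    have h3 : (3 : ℝ) • (G (y, 0)).2 = (2 : ℝ) ^ 2 • (G (y, 0)).2 - (G (y, 0)).2 := by module
    rw [h3, ← h1, sub_self]
  simpa using h2

/-- Along the zero section the linearisation of the spray is `(v, ξ) ↦ (P ξ, 0)`. -/
theorem fderiv_zero_section (h : IsLocalSpray U P G) {y : E} (hy : y ∈ U)
    (u : E × (E →L[ℝ] ℝ)) : fderiv ℝ G (y, 0) u = (P y u.2, 0) := by
  refine Prod.ext (by simpa using h.fderiv_apply_fst (q := (y, 0)) hy u) ?_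
  have hd := (h.differentiableAt (q := (y, 0)) hy).hasFDerivAt
  have hu : u = (u.1, 0) + (0, u.2) := by simp
  rw [hu, map_add]
  have h1 : fderiv ℝ G (y, 0) (u.1, 0) = 0 := by
    have ha : HasFDerivAt (fun y ↦ G (y, 0))
        ((fderiv ℝ G (y, 0)).comp (ContinuousLinearMap.inl ℝ E (E →L[ℝ] ℝ))) y :=
      hd.comp y (hasFDerivAt_prodMk_left (𝕜 := ℝ) y 0)
    have hb : (fun y ↦ G (y, 0)) =ᶠ[𝓝 y] fun _ ↦ 0 := by
      filter_upwards [h.isOpen.mem_nhds hy] with y' hy'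
      exact h.zero_section hy'
    exact DFunLike.congr_fun (ha.unique ((hasFDerivAt_const _ y).congr_of_eventuallyEq hb)) u.1
  have h2 : (fderiv ℝ G (y, 0) (0, u.2)).2 = 0 := by
    have hc : HasDerivAt (fun c : ℝ ↦ (y, c • u.2)) ((0 : E), u.2) 0 := by
      simpa using (hasDerivAt_const (0 : ℝ) y).prodMk ((hasDerivAt_id (0 : ℝ)).smul_const u.2)
    have ha : HasDerivAt (fun c : ℝ ↦ G (y, c • u.2)) (fderiv ℝ G (y, 0) (0, u.2)) 0 :=
      HasFDerivAt.comp_hasDerivAt (l := G) 0 (by simpa using hd) hc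
    have hb : (fun c : ℝ ↦ (G (y, c • u.2)).2) = fun c : ℝ ↦ c ^ 2 • (G (y, u.2)).2 := by
      ext1 c
      rcases eq_or_ne c 0 with rfl | hc0
      · simp [h.zero_section hy]
      · exact h.quadratic y hy u.2 c hc0
    have hc' : HasDerivAt (fun c : ℝ ↦ (G (y, c • u.2)).2) (fderiv ℝ G (y, 0) (0, u.2)).2 0 :=
      ha.snd
    rw [hb] at hc'
    have hd' : HasDerivAt (fun c : ℝ ↦ c ^ 2 • (G (y, u.2)).2) 0 0 := by
      simpa using (hasDerivAt_pow 2 (0 : ℝ)).smul_const (G (y, u.2)).2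
    exact hc'.unique hd'
  rw [h1, zero_add, h2]

end IsLocalSpray

end LocalSpray

/-! ### The averaged form -/

section AveragedForm

set_option maxSynthPendingDepth 3

universe u

variable {E : Type u} [NormedAddCommGroup E] [NormedSpace ℝ E]

/-- If two surjections `a`, `b` onto a space of half the dimension have the property that the
kernel of `a` is mapped by the nondegenerate form `Ω` into the annihilator of the kernel of `b`,
then, by equality of dimensions, it is mapped onto this annihilator. -/
theorem exists_mem_ker_of_finrank_eq {F V : Type*} [NormedAddCommGroup F] [NormedSpace ℝ F]
    [NormedAddCommGroup V] [NormedSpace ℝ V] [FiniteDimensional ℝ F] [FiniteDimensional ℝ V]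
    (hdim : Module.finrank ℝ F = 2 * Module.finrank ℝ V) {Ω : F →L[ℝ] F →L[ℝ] ℝ}
    (hΩ : ∀ v, (∀ w, Ω v w = 0) → v = 0) {a b : F →L[ℝ] V} (ha : Function.Surjective a)
    (hb : Function.Surjective b) (h : ∀ u, a u = 0 → ∃ η : V →L[ℝ] ℝ, ∀ w, Ω u w = η (b w))
    (η : V →L[ℝ] ℝ) : ∃ u, a u = 0 ∧ ∀ w, Ω u w = η (b w) := by
  have hΩinj : Function.Injective Ω.toLinearMap :=
    (injective_iff_map_eq_zero _).2 fun v hv ↦ hΩ v fun w ↦ DFunLike.congr_fun hv w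
  set J : (V →L[ℝ] ℝ) →ₗ[ℝ] (F →L[ℝ] ℝ) :=
    { toFun := fun η ↦ η.comp b, map_add' := fun _ _ ↦ rfl, map_smul' := fun _ _ ↦ rfl } with hJ
  have hJinj : Function.Injective J := fun η η' he ↦ by
    ext v
    obtain ⟨w, rfl⟩ := hb v
    exact DFunLike.congr_fun he w
  set N := LinearMap.ker a.toLinearMap with hN
  have hle : N.map Ω.toLinearMap ≤ LinearMap.range J := by
    rintro _ ⟨u, hu, rfl⟩
    obtain ⟨η', hη'⟩ := h u hu
    exact ⟨η', ContinuousLinearMap.ext fun w ↦ (hη' w).symm⟩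
  have h1 : Module.finrank ℝ (N.map Ω.toLinearMap) = Module.finrank ℝ N :=
    (Submodule.equivMapOfInjective _ hΩinj N).finrank_eq.symm
  have h2 : Module.finrank ℝ (LinearMap.range J) = Module.finrank ℝ V := by
    rw [LinearMap.finrank_range_of_inj hJinj,
      ← (LinearMap.toContinuousLinearMap (𝕜 := ℝ) (E := V) (F' := ℝ)).finrank_eq]
    exact Subspace.dual_finrank_eq
  have h3 := a.toLinearMap.finrank_range_add_finrank_ker
  rw [LinearMap.range_eq_top.2 ha, finrank_top] at h3
  change _ + Module.finrank ℝ N = _ at h3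
  have heq := Submodule.eq_of_le_of_finrank_eq hle (by rw [h1, h2]; omega)
  obtain ⟨u, hu, hu'⟩ : J η ∈ N.map Ω.toLinearMap := heq ▸ ⟨η, rfl⟩
  exact ⟨u, hu, fun w ↦ DFunLike.congr_fun hu' w⟩

/-- The average `∫₀¹ (φ_s)^* λ ds` of the pullbacks of the canonical one-form `λ` along a flow. -/
noncomputable def averagedLiouville (φ : ℝ → E × (E →L[ℝ] ℝ) → E × (E →L[ℝ] ℝ))
    (p : E × (E →L[ℝ] ℝ)) : (E × (E →L[ℝ] ℝ)) →L[ℝ] ℝ :=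
  ∫ s in (0 : ℝ)..1, (liouvilleForm E (φ s p)).comp (fderiv ℝ (φ s) p)

namespace IsSmoothFlow

variable {f : E × (E →L[ℝ] ℝ) → E × (E →L[ℝ] ℝ)} {φ : ℝ → E × (E →L[ℝ] ℝ) → E × (E →L[ℝ] ℝ)}

theorem contDiff_pullback_liouvilleForm (h : IsSmoothFlow f φ) :
    ContDiff ℝ ∞ (fun q : ℝ × (E × (E →L[ℝ] ℝ)) ↦
      (liouvilleForm E (φ q.1 q.2)).comp (fderiv ℝ (φ q.1) q.2)) :=
  ((liouvilleForm E).contDiff.comp h.contDiff).clm_comp h.contDiff_fderiv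

theorem contDiff_averagedLiouville (h : IsSmoothFlow f φ) :
    ContDiff ℝ ∞ (averagedLiouville φ) :=
  contDiff_infty_intervalIntegral
    (g := fun s p ↦ (liouvilleForm E (φ s p)).comp (fderiv ℝ (φ s) p))
    h.contDiff_pullback_liouvilleForm 0 1

theorem continuous_canonicalFormModel (h : IsSmoothFlow f φ) (p u v : E × (E →L[ℝ] ℝ)) :
    Continuous fun s ↦ canonicalFormModel E (fderiv ℝ (φ s) p u) (fderiv ℝ (φ s) p v) := by
  have h1 : Continuous fun s ↦ fderiv ℝ (φ s) p :=
    h.contDiff_fderiv.continuous.comp (Continuous.prodMk_left p)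
  exact ((canonicalFormModel E).continuous.comp (h1.clm_apply continuous_const)).clm_apply
    (h1.clm_apply continuous_const)

/-- The exterior derivative of the averaged one-form is the average of the pullbacks of the
canonical symplectic form. -/
theorem oneFormDeriv_averagedLiouville (h : IsSmoothFlow f φ) (p u v : E × (E →L[ℝ] ℝ)) :
    oneFormDeriv (averagedLiouville φ) p u v =
      ∫ s in (0 : ℝ)..1, canonicalFormModel E (fderiv ℝ (φ s) p u) (fderiv ℝ (φ s) p v) := by
  set g : ℝ → E × (E →L[ℝ] ℝ) → (E × (E →L[ℝ] ℝ)) →L[ℝ] ℝ :=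
    fun s p ↦ (liouvilleForm E (φ s p)).comp (fderiv ℝ (φ s) p) with hg
  have hgs : ContDiff ℝ ∞ (fun q : ℝ × (E × (E →L[ℝ] ℝ)) ↦ g q.1 q.2) :=
    h.contDiff_pullback_liouvilleForm
  have hD := (hasFDerivAt_intervalIntegral (hgs.of_le (by norm_cast)) 0 1 p).fderiv
  have hcont : Continuous fun s ↦ fderiv ℝ (g s) p := by
    have h1 : ∀ s, fderiv ℝ (g s) p = (fderiv ℝ (fun q : ℝ × (E × (E →L[ℝ] ℝ)) ↦ g q.1 q.2)
        (s, p)).comp (ContinuousLinearMap.inr ℝ ℝ (E × (E →L[ℝ] ℝ))) := fun s ↦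
      (((hgs.differentiable (by simp)) (s, p)).hasFDerivAt.comp p
        (hasFDerivAt_prodMk_right (𝕜 := ℝ) s p)).fderiv
    simp_rw [h1]
    exact ((hgs.continuous_fderiv (by simp)).comp (Continuous.prodMk_left p)).clm_comp
      continuous_const
  have hval (a b : E × (E →L[ℝ] ℝ)) : fderiv ℝ (averagedLiouville φ) p a b =
      ∫ s in (0 : ℝ)..1, fderiv ℝ (g s) p a b := by
    have h1 : fderiv ℝ (averagedLiouville φ) p = ∫ s in (0 : ℝ)..1, fderiv ℝ (g s) p := hD
    rw [h1, ContinuousLinearMap.intervalIntegral_apply (hcont.intervalIntegrable 0 1),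
      ContinuousLinearMap.intervalIntegral_apply
        ((hcont.clm_apply continuous_const).intervalIntegrable 0 1)]
  rw [oneFormDeriv_apply, hval, hval, ← intervalIntegral.integral_sub
    (((hcont.clm_apply continuous_const).clm_apply continuous_const).intervalIntegrable 0 1)
    (((hcont.clm_apply continuous_const).clm_apply continuous_const).intervalIntegrable 0 1)]
  refine intervalIntegral.integral_congr fun s _ ↦ ?_
  have h2 := oneFormDeriv_pullback (Θ := liouvilleForm E) (g := φ s) (p := p)
    (liouvilleForm E).differentiableAt ((h.contDiff_apply s).contDiffAt.of_le two_le_infty) u v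
  rw [oneFormDeriv_clm_apply] at h2
  exact h2

end IsSmoothFlow

end AveragedForm

/-! ### The flow of a Poisson spray in coordinates -/

section SprayModel

set_option maxSynthPendingDepth 3

universe u

variable {E : Type u} [NormedAddCommGroup E] [NormedSpace ℝ E]

/-- A complete flow that describes a local spray `G` near a point `z`: the spray is replaced by a
globally Lipschitz field that agrees with it on a neighbourhood `Rs` of `z`, and
solutions that start in `R₀` remain in `Rs` up to time `1`. On `Rs` the derivative of the Poisson
tensor in the direction of the momentum is small, so that linear differential equations whose
coefficients are bounded by it can be solved on the whole of `[0, 1]`. -/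
structure SprayModel (U : Set E) (P : E → (E →L[ℝ] ℝ) →L[ℝ] E)
    (G : E × (E →L[ℝ] ℝ) → E × (E →L[ℝ] ℝ)) (z : E × (E →L[ℝ] ℝ)) where
  /-- The globally defined field. -/
  field : E × (E →L[ℝ] ℝ) → E × (E →L[ℝ] ℝ)
  /-- Its flow. -/
  φ : ℝ → E × (E →L[ℝ] ℝ) → E × (E →L[ℝ] ℝ)
  /-- Its Lipschitz constant. -/
  K : NNReal
  /-- The neighbourhood where the field agrees with the spray. -/
  Rs : Set (E × (E →L[ℝ] ℝ))
  /-- The set of initial values of solutions that remain in `Rs`. -/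
  R₀ : Set (E × (E →L[ℝ] ℝ))
  contDiff_field : ContDiff ℝ ∞ field
  lipschitz : LipschitzWith K field
  isSmoothFlow : IsSmoothFlow field φ
  isOpen_Rs : IsOpen Rs
  subset : Rs ⊆ U ×ˢ univ
  eqOn : EqOn field G Rs
  small : ∀ q ∈ Rs, ‖(fderiv ℝ P q.1).flip q.2‖ ≤ 1 / 4
  isOpen_R₀ : IsOpen R₀
  mem : z ∈ R₀
  mapsTo : ∀ p ∈ R₀, ∀ s ∈ Icc (0 : ℝ) 1, φ s p ∈ Rs

/-- Points of the zero section are fixed by the flow, so the trajectories of nearby points remain in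
`Rs` up to time `1`. -/
theorem IsLocalSpray.nonempty_sprayModel [FiniteDimensional ℝ E] {U : Set E}
    {P : E → (E →L[ℝ] ℝ) →L[ℝ] E} {G : E × (E →L[ℝ] ℝ) → E × (E →L[ℝ] ℝ)}
    (h : IsLocalSpray U P G) {y : E} (hy : y ∈ U) : Nonempty (SprayModel U P G (y, 0)) := by
  have hcomplete : CompleteSpace E := FiniteDimensional.complete ℝ E
  obtain ⟨G', hG's, hG'c, hG'⟩ := exists_contDiff_hasCompactSupport_eq h.isOpen_prod
    (isCompact_singleton (x := (y, (0 : E →L[ℝ] ℝ))))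
    (singleton_subset_iff.2 ⟨hy, mem_univ _⟩) h.contDiffOn
  rw [nhdsSet_singleton] at hG'
  obtain ⟨K, hK⟩ := hG's.lipschitzWith_of_hasCompactSupport hG'c (by simp)
  obtain ⟨φ, hφ⟩ := exists_isSmoothFlow hG's hK
  have hsmall : ∀ᶠ q : E × (E →L[ℝ] ℝ) in 𝓝 (y, 0), ‖(fderiv ℝ P q.1).flip q.2‖ ≤ 1 / 4 := by
    have h1 : ContinuousAt (fderiv ℝ P) y :=
      ((h.contDiffOn_tensor.fderiv_of_isOpen h.isOpen (m := ∞) le_rfl).continuousOn.continuousAt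
        (h.isOpen.mem_nhds hy))
    have h2 : ContinuousAt (fun q : E × (E →L[ℝ] ℝ) ↦ ‖fderiv ℝ P q.1‖ * ‖q.2‖) (y, 0) :=
      ((ContinuousAt.comp (f := Prod.fst) (x := (y, (0 : E →L[ℝ] ℝ))) h1
        continuousAt_fst).norm).mul continuousAt_snd.norm
    have h3 : ∀ᶠ q : E × (E →L[ℝ] ℝ) in 𝓝 (y, 0), ‖fderiv ℝ P q.1‖ * ‖q.2‖ < 1 / 4 :=
      h2.eventually_lt_const (by simp)
    filter_upwards [h3] with q hq
    refine ((fderiv ℝ P q.1).flip.le_opNorm q.2).trans ?_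
    rw [ContinuousLinearMap.opNorm_flip]
    exact hq.le
  obtain ⟨Rs, hRs, hRsopen, hzRs⟩ := eventually_nhds_iff.1
    ((hG'.and hsmall).and (h.isOpen_prod.eventually_mem
      (show (y, (0 : E →L[ℝ] ℝ)) ∈ U ×ˢ univ from ⟨hy, mem_univ _⟩)))
  have hfix : G' (y, 0) = 0 := by rw [(hRs _ hzRs).1.1, h.zero_section hy]
  have hev := hφ.eventually_forall_mem hRsopen (z := (y, 0)) (a := 0) (b := 1)
    fun t _ ↦ by rwa [hφ.eq_of_eq_zero hK hfix]
  obtain ⟨R₀, hR₀, hR₀open, hzR₀⟩ := eventually_nhds_iff.1 hev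
  exact ⟨⟨G', φ, K, Rs, R₀, hG's, hK, hφ, hRsopen, fun q hq ↦ (hRs q hq).2,
    fun q hq ↦ (hRs q hq).1.1, fun q hq ↦ (hRs q hq).1.2, hR₀open, hzR₀, hR₀⟩⟩

namespace SprayModel

variable {U : Set E} {P : E → (E →L[ℝ] ℝ) →L[ℝ] E} {G : E × (E →L[ℝ] ℝ) → E × (E →L[ℝ] ℝ)}
  {z : E × (E →L[ℝ] ℝ)} (S : SprayModel U P G z)

theorem fderiv_field {q : E × (E →L[ℝ] ℝ)} (hq : q ∈ S.Rs) : fderiv ℝ S.field q = fderiv ℝ G q :=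
  (S.eqOn.eventuallyEq_of_mem (S.isOpen_Rs.mem_nhds hq)).fderiv_eq

theorem R₀_subset : S.R₀ ⊆ S.Rs := fun p hp ↦ by
  simpa [S.isSmoothFlow.zero] using S.mapsTo p hp 0 ⟨le_rfl, zero_le_one⟩

theorem apply_zero_section (h : IsLocalSpray U P G) {y : E} (hy : (y, 0) ∈ S.Rs) (s : ℝ) :
    S.φ s (y, 0) = (y, 0) :=
  S.isSmoothFlow.eq_of_eq_zero S.lipschitz
    (by rw [S.eqOn hy, h.zero_section (S.subset hy).1]) s

theorem averagedLiouville_zero_section (h : IsLocalSpray U P G) {y : E} (hy : (y, 0) ∈ S.Rs) :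
    averagedLiouville S.φ (y, 0) = 0 := by
  simp_rw [averagedLiouville, S.apply_zero_section h hy]
  have h1 : liouvilleForm E (y, 0) = 0 := by ext <;> simp
  simp [h1]

/-- Along the zero section the linearised flow is `(v, ξ) ↦ (v + s P ξ, ξ)`. -/
theorem fderiv_zero_section (h : IsLocalSpray U P G) {y : E} (hy : (y, 0) ∈ S.Rs) (s : ℝ)
    (u : E × (E →L[ℝ] ℝ)) : fderiv ℝ (S.φ s) (y, 0) u = (u.1 + s • P y u.2, u.2) := by
  have h1 := S.isSmoothFlow.hasDerivAt_fderiv S.contDiff_field (y, 0) u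
  simp_rw [S.apply_zero_section h hy, S.fderiv_field hy] at h1
  have h2 (t : ℝ) : HasDerivAt (fun s : ℝ ↦ (u.1 + s • P y u.2, u.2))
      (fderiv ℝ G (y, 0) (u.1 + t • P y u.2, u.2)) t := by
    rw [h.fderiv_zero_section (S.subset hy).1]
    have h3 := ((hasDerivAt_id t).smul_const (P y u.2)).const_add u.1
    rw [one_smul] at h3
    exact h3.prodMk (hasDerivAt_const t u.2)
  have h0 : S.φ 0 = id := funext S.isSmoothFlow.zero
  exact congrFun ((fderiv ℝ G (y, 0)).lipschitz.eq_of_hasDerivAt h1 h2 (t₀ := 0)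
    (by simp [h0])) s

/-- At points of the zero section the interpolating forms are nondegenerate: pairing `(v, ξ)` with
`(w, 0)` gives `ξ w`, and once `ξ = 0`, pairing with `(0, η)` gives `-η v`. -/
theorem injective_moserForm (h : IsLocalSpray U P G) {y : E} (hy : (y, 0) ∈ S.Rs) (t : ℝ) :
    Function.Injective (moserForm (liouvilleForm E) (averagedLiouville S.φ) t (y, 0)) := by
  refine (injective_iff_map_eq_zero _).2 fun u hu ↦ ?_
  have h1 (w : E × (E →L[ℝ] ℝ)) : (1 - t) * (u.2 w.1 - w.2 u.1) + t * ∫ s in (0 : ℝ)..1,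
      (u.2 (w.1 + s • P y w.2) - w.2 (u.1 + s • P y u.2)) = 0 := by
    have h2 := DFunLike.congr_fun hu w
    rw [moserForm_apply, S.isSmoothFlow.oneFormDeriv_averagedLiouville] at h2
    simp_rw [S.fderiv_zero_section h hy, canonicalFormModel_apply] at h2
    exact h2
  have h2 : u.2 = 0 := by
    ext w
    have h3 := h1 (w, 0)
    simp only [map_zero, smul_zero, add_zero, zero_apply, sub_zero, intervalIntegral.integral_const,
      smul_eq_mul] at h3
    rw [zero_apply]
    linarith
  have h3 : u.1 = 0 := by
    refine SeparatingDual.eq_zero_of_forall_dual_eq_zero (R := ℝ) fun η ↦ ?_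
    have h4 := h1 (0, η)
    simp only [h2, zero_apply, zero_sub, map_zero, smul_zero, add_zero,
      intervalIntegral.integral_const, smul_eq_mul, sub_zero] at h4
    linarith
  exact Prod.ext h3 h2

/-- The mechanism behind the symplectic orthogonality and the Poisson properties. If a solution
`v_s` of the linearised flow satisfies `τ_* v_s = π^# η` at one of the times `0`, `1`, then
`η` propagates to a family of covectors such that `τ_* v_s = π^# η_s` at all times; this is where
the Jacobi identity enters. As `η_s (τ_* w_s)` has the derivative
`ω(v_s, w_s)`, the boundary values of `η_s` compute the averaged form. -/
theorem exists_covector_along [CompleteSpace E] (h : IsLocalSpray U P G) {p : E × (E →L[ℝ] ℝ)}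
    (hp : p ∈ S.R₀) (v : E × (E →L[ℝ] ℝ)) {s₀ : ℝ} (hs₀ : s₀ = 0 ∨ s₀ = 1) (η₀ : E →L[ℝ] ℝ)
    (hη₀ : (fderiv ℝ (S.φ s₀) p v).1 = P (S.φ s₀ p).1 η₀) :
    ∃ η : ℝ → E →L[ℝ] ℝ, η s₀ = η₀ ∧
      (∀ s ∈ Icc (0 : ℝ) 1, (fderiv ℝ (S.φ s) p v).1 = P (S.φ s p).1 (η s)) ∧
      ∀ w, oneFormDeriv (averagedLiouville S.φ) p v w =
        η 1 (fderiv ℝ (S.φ 1) p w).1 - η 0 w.1 := by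
  have hmem : s₀ ∈ Icc (0 : ℝ) 1 := by rcases hs₀ with rfl | rfl <;> simp
  set q : ℝ → E × (E →L[ℝ] ℝ) := fun s ↦ S.φ s p with hq
  have hqRs : ∀ s ∈ Icc (0 : ℝ) 1, q s ∈ S.Rs := S.mapsTo p hp
  have hqU : ∀ s ∈ Icc (0 : ℝ) 1, (q s).1 ∈ U := fun s hs ↦ (S.subset (hqRs s hs)).1
  have hqc : Continuous q := S.isSmoothFlow.continuous_apply_left p
  have hqd : ∀ s ∈ Icc (0 : ℝ) 1, HasDerivAt (fun s ↦ (q s).1) (P (q s).1 (q s).2) s := by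
    intro s hs
    have h1 : HasDerivAt (fun s ↦ (q s).1) (S.field (q s)).1 s :=
      (S.isSmoothFlow.hasDerivAt p s).fst
    rwa [S.eqOn (hqRs s hs), ← Prod.mk.eta (p := q s), h.fst_eq _ (hqU s hs)] at h1
  set V : E × (E →L[ℝ] ℝ) → ℝ → E × (E →L[ℝ] ℝ) := fun w s ↦ fderiv ℝ (S.φ s) p w with hV
  have hVd (w : E × (E →L[ℝ] ℝ)) : ∀ s ∈ Icc (0 : ℝ) 1,
      HasDerivAt (V w) (fderiv ℝ G (q s) (V w s)) s := by
    intro s hs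
    have h1 := S.isSmoothFlow.hasDerivAt_fderiv S.contDiff_field p w s
    rwa [S.fderiv_field (hqRs s hs)] at h1
  have hVa (w : E × (E →L[ℝ] ℝ)) : ∀ s ∈ Icc (0 : ℝ) 1, HasDerivAt (fun s ↦ (V w s).1)
      (fderiv ℝ P (q s).1 (V w s).1 (q s).2 + P (q s).1 (V w s).2) s := by
    intro s hs
    have h1 : HasDerivAt (fun s ↦ (V w s).1) (fderiv ℝ G (q s) (V w s)).1 s := (hVd w s hs).fst
    rwa [h.fderiv_apply_fst (hqU s hs)] at h1
  -- the linear equation `η' = α - η ∘ B` for the covectors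
  set B : ℝ → E →L[ℝ] E := fun s ↦ (fderiv ℝ P (q s).1).flip (q s).2 with hB
  have hB4 : ∀ s ∈ Icc (0 : ℝ) 1, ‖B s‖ ≤ 1 / 4 := fun s hs ↦ S.small _ (hqRs s hs)
  have hPc : ContinuousOn (fun s ↦ fderiv ℝ P (q s).1) (Icc 0 1) :=
    (h.contDiffOn_tensor.fderiv_of_isOpen h.isOpen (m := ∞) le_rfl).continuousOn.comp
      (continuous_fst.comp hqc).continuousOn hqU
  have hBc : ContinuousOn B (Icc 0 1) := by
    have h1 : ContinuousOn (fun s ↦ (fderiv ℝ P (q s).1).flip) (Icc 0 1) :=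
      (ContinuousLinearMap.flipₗᵢ ℝ E (E →L[ℝ] ℝ) E).continuous.comp_continuousOn hPc
    exact h1.clm_apply (continuous_snd.comp hqc).continuousOn
  set A : ℝ → (E →L[ℝ] ℝ) →L[ℝ] E →L[ℝ] ℝ :=
    fun s ↦ -(ContinuousLinearMap.compL ℝ E E ℝ).flip (B s) with hA
  have hAapply (s : ℝ) (η : E →L[ℝ] ℝ) : A s η = -η.comp (B s) := rfl
  have hAc : ContinuousOn A (Icc 0 1) :=
    ((ContinuousLinearMap.compL ℝ E E ℝ).flip.continuous.comp_continuousOn hBc).neg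
  have hA4 : ∀ s ∈ Icc (0 : ℝ) 1, ‖A s‖ ≤ 1 / 4 := fun s hs ↦ by
    refine (ContinuousLinearMap.opNorm_le_bound _ (norm_nonneg (B s)) fun η ↦ ?_).trans (hB4 s hs)
    rw [hAapply, norm_neg, mul_comm]
    exact η.opNorm_comp_le (B s)
  have hαc : Continuous fun s ↦ (V v s).2 := by
    have h1 : Continuous (V v) := continuous_iff_continuousAt.2 fun s ↦
      (S.isSmoothFlow.hasDerivAt_fderiv S.contDiff_field p v s).continuousAt
    exact continuous_snd.comp h1
  obtain ⟨η, hηs₀, hηd⟩ := exists_solution_of_linear hAc hαc.continuousOn hA4 hmem η₀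
  have hderiv : ∀ s ∈ Icc (0 : ℝ) 1, (V v s).1 = P (q s).1 (η s) := by
    have hY : ∀ s ∈ Icc (0 : ℝ) 1, LipschitzWith (1 / 4 : NNReal) (fun x ↦ B s x) := fun s hs ↦
      (B s).lipschitz.weaken (by
        rw [← NNReal.coe_le_coe]; simpa using hB4 s hs)
    -- by the Jacobi identity the defect `δ = τ_* v - π^# η` satisfies the equation `δ' = B δ`
    have hδ : ∀ s ∈ Icc (0 : ℝ) 1, HasDerivWithinAt (fun s ↦ (V v s).1 - P (q s).1 (η s))
        (B s ((V v s).1 - P (q s).1 (η s))) (Icc 0 1) s := by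
      intro s hs
      have h1 : HasDerivAt (fun s ↦ P (q s).1) (fderiv ℝ P (q s).1 (P (q s).1 (q s).2)) s :=
        HasFDerivAt.comp_hasDerivAt (l := P) (f := fun s ↦ (q s).1) s
          (h.hasFDerivAt_tensor (hqU s hs)) (hqd s hs)
      have h2 := (hVa v s hs).hasDerivWithinAt.sub
        (h1.hasDerivWithinAt.clm_apply (hηd s hs))
      refine h2.congr_deriv (eq_of_sub_eq_zero ?_)
      refine SeparatingDual.eq_zero_of_forall_dual_eq_zero (R := ℝ) fun ζ ↦ ?_
      have hj := h.jacobi (q s).1 (hqU s hs) (q s).2 (η s) ζ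
      have e1 := h.fderiv_skew (hqU s hs) (P (q s).1 ζ) (q s).2 (η s)
      have e2 := h.skew (q s).1 (hqU s hs) ((η s).comp (B s)) ζ
      have e3 := h.fderiv_skew (hqU s hs) (P (q s).1 (q s).2) (η s) ζ
      have e4 : ((η s).comp (B s)) (P (q s).1 ζ) =
        (η s) (fderiv ℝ P (q s).1 (P (q s).1 ζ) (q s).2) := rfl
      simp only [hAapply, hB, map_add, map_sub, map_neg, ContinuousLinearMap.flip_apply]
        at e2 e4 ⊢
      linear_combination hj + e2 - e4 - e1 - e3
    refine fun s hs ↦ sub_eq_zero.1 (eqOn_Icc_of_hasDerivWithinAt hY hδ (γ' := fun _ ↦ 0)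
      (fun t _ ↦ by simpa using hasDerivWithinAt_const t (Icc (0 : ℝ) 1) (0 : E)) ?_ hs)
    rcases hs₀ with rfl | rfl
    · exact Or.inl (by rw [hηs₀]; exact sub_eq_zero.2 hη₀)
    · exact Or.inr (by rw [hηs₀]; exact sub_eq_zero.2 hη₀)
  refine ⟨η, hηs₀, hderiv, fun w ↦ ?_⟩
  have h0 : V w 0 = w := by
    have : S.φ 0 = id := funext S.isSmoothFlow.zero
    simp [hV, this]
  have hpair : ∀ s ∈ Icc (0 : ℝ) 1, HasDerivWithinAt (fun s ↦ η s (V w s).1)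
      (canonicalFormModel E (V v s) (V w s)) (Icc 0 1) s := by
    intro s hs
    refine ((hηd s hs).clm_apply (hVa w s hs).hasDerivWithinAt).congr_deriv ?_
    have e1 := h.skew (q s).1 (hqU s hs) (V w s).2 (η s)
    rw [← hderiv s hs] at e1
    simp only [hAapply, hB, add_apply, neg_apply, ContinuousLinearMap.comp_apply, map_add,
      ContinuousLinearMap.flip_apply, canonicalFormModel_apply]
    linear_combination e1
  rw [S.isSmoothFlow.oneFormDeriv_averagedLiouville]
  have hFTC := intervalIntegral.integral_eq_sub_of_hasDerivAt_of_le (f := fun s ↦ η s (V w s).1)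
    zero_le_one (fun s hs ↦ (hpair s hs).continuousWithinAt)
    (fun s hs ↦ (hpair s (Ioo_subset_Icc_self hs)).hasDerivAt (Icc_mem_nhds hs.1 hs.2))
    ((S.isSmoothFlow.continuous_canonicalFormModel p v w).intervalIntegrable 0 1)
  rw [hFTC, h0]

/-- The derivative of the flow is inverted by that of the flow at the opposite time. -/
theorem surjective_fderiv (s : ℝ) (p : E × (E →L[ℝ] ℝ)) :
    Function.Surjective (fderiv ℝ (S.φ s) p) := by
  have h1 : HasFDerivAt (fun q ↦ S.φ s (S.φ (-s) q)) ((fderiv ℝ (S.φ s) p).comp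
      (fderiv ℝ (S.φ (-s)) (S.φ s p))) (S.φ s p) := by
    have h2 := S.isSmoothFlow.hasFDerivAt_apply s p
    nth_rw 2 [← S.isSmoothFlow.neg_apply S.lipschitz s p] at h2
    exact h2.comp (S.φ s p) (S.isSmoothFlow.hasFDerivAt_apply (-s) (S.φ s p))
  simp_rw [S.isSmoothFlow.apply_neg S.lipschitz] at h1
  intro v
  exact ⟨_, DFunLike.congr_fun (h1.unique (hasFDerivAt_id _)) v⟩

theorem finrank_prod_dual [FiniteDimensional ℝ E] :
    Module.finrank ℝ (E × (E →L[ℝ] ℝ)) = 2 * Module.finrank ℝ E := by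
  have : Module.finrank ℝ (E →L[ℝ] ℝ) = Module.finrank ℝ E := by
    rw [← (LinearMap.toContinuousLinearMap (𝕜 := ℝ) (E := E) (F' := ℝ)).finrank_eq]
    exact Subspace.dual_finrank_eq
  rw [Module.finrank_prod, this, two_mul]

section Dirac

variable [FiniteDimensional ℝ E] {p : E × (E →L[ℝ] ℝ)}

/-- The fibres of `τ` and of `τ ∘ φ₁` are orthogonal for the averaged form. -/
theorem orthogonal (h : IsLocalSpray U P G) (hp : p ∈ S.R₀) {u v : E × (E →L[ℝ] ℝ)}
    (hu : u.1 = 0) (hv : (fderiv ℝ (S.φ 1) p v).1 = 0) :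
    oneFormDeriv (averagedLiouville S.φ) p u v = 0 := by
  have hcomplete : CompleteSpace E := FiniteDimensional.complete ℝ E
  have h0 : S.φ 0 = id := funext S.isSmoothFlow.zero
  obtain ⟨η, hη, -, hw⟩ := S.exists_covector_along h hp u (Or.inl rfl) 0 (by simp [h0, hu])
  simp [hw, hη, hv]

/-- The projection `τ` is a Poisson map for the averaged form: the Hamiltonian vector `x` of a
function of `τ` whose differential is `η ∘ τ_*` satisfies `τ_* x = π^# η`. -/
theorem fst_eq_of_forall_oneFormDeriv (h : IsLocalSpray U P G) (hp : p ∈ S.R₀)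
    (hnd : ∀ v, (∀ w, oneFormDeriv (averagedLiouville S.φ) p v w = 0) → v = 0)
    {x : E × (E →L[ℝ] ℝ)} {η : E →L[ℝ] ℝ}
    (hx : ∀ w, oneFormDeriv (averagedLiouville S.φ) p w x = η w.1) : x.1 = P p.1 η := by
  have hcomplete : CompleteSpace E := FiniteDimensional.complete ℝ E
  have h0 : S.φ 0 = id := funext S.isSmoothFlow.zero
  -- vectors tangent to the fibres of `τ ∘ φ₁`
  have key (u : E × (E →L[ℝ] ℝ)) (hu : (fderiv ℝ (S.φ 1) p u).1 = 0) : ∃ η : E →L[ℝ] ℝ,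
      u.1 = P p.1 η ∧ ∀ w, oneFormDeriv (averagedLiouville S.φ) p u w = -η w.1 := by
    obtain ⟨η, hη, hη', hw⟩ := S.exists_covector_along h hp u (Or.inr rfl) 0 (by simp [hu])
    exact ⟨η 0, by simpa [h0] using hη' 0 (by simp), fun w ↦ by simp [hw, hη]⟩
  obtain ⟨u, hu, huw⟩ := exists_mem_ker_of_finrank_eq finrank_prod_dual hnd
    (a := (ContinuousLinearMap.fst ℝ E (E →L[ℝ] ℝ)).comp (fderiv ℝ (S.φ 1) p))
    (b := ContinuousLinearMap.fst ℝ E (E →L[ℝ] ℝ))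
    (Prod.fst_surjective.comp (S.surjective_fderiv 1 p)) Prod.fst_surjective
    (fun u hu ↦ by
      obtain ⟨η, -, hη⟩ := key u hu
      exact ⟨-η, hη⟩) (-η)
  have hxu : x = u := by
    refine sub_eq_zero.1 (hnd _ fun w ↦ ?_)
    have h1 := hx w
    rw [oneFormDeriv_apply] at h1
    rw [map_sub, sub_apply, huw, oneFormDeriv_apply]
    simp only [ContinuousLinearMap.coe_fst', neg_apply]
    linarith
  obtain ⟨η', hη', hw'⟩ := key u hu
  have : η' = η := by
    ext b
    have h1 := (hw' (b, 0)).symm.trans (huw (b, 0))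
    simpa using h1
  rw [hxu, hη', this]

/-- The map `β = τ ∘ φ₁` is anti-Poisson for the averaged form: the Hamiltonian vector `x` of a
function of `β` whose differential is `η ∘ β_*` satisfies `β_* x = -π^# η`. -/
theorem fst_fderiv_eq_of_forall_oneFormDeriv (h : IsLocalSpray U P G) (hp : p ∈ S.R₀)
    (hnd : ∀ v, (∀ w, oneFormDeriv (averagedLiouville S.φ) p v w = 0) → v = 0)
    {x : E × (E →L[ℝ] ℝ)} {η : E →L[ℝ] ℝ}
    (hx : ∀ w, oneFormDeriv (averagedLiouville S.φ) p w x = η (fderiv ℝ (S.φ 1) p w).1) :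
    (fderiv ℝ (S.φ 1) p x).1 = -P (S.φ 1 p).1 η := by
  have hcomplete : CompleteSpace E := FiniteDimensional.complete ℝ E
  have h0 : S.φ 0 = id := funext S.isSmoothFlow.zero
  -- vectors tangent to the fibres of `τ`
  have key (u : E × (E →L[ℝ] ℝ)) (hu : u.1 = 0) : ∃ η : E →L[ℝ] ℝ,
      (fderiv ℝ (S.φ 1) p u).1 = P (S.φ 1 p).1 η ∧
      ∀ w, oneFormDeriv (averagedLiouville S.φ) p u w = η (fderiv ℝ (S.φ 1) p w).1 := by
    obtain ⟨η, hη, hη', hw⟩ := S.exists_covector_along h hp u (Or.inl rfl) 0 (by simp [h0, hu])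
    exact ⟨η 1, hη' 1 (by simp), fun w ↦ by simp [hw, hη]⟩
  have hsurj : Function.Surjective
      ((ContinuousLinearMap.fst ℝ E (E →L[ℝ] ℝ)).comp (fderiv ℝ (S.φ 1) p)) :=
    Prod.fst_surjective.comp (S.surjective_fderiv 1 p)
  obtain ⟨u, hu, huw⟩ := exists_mem_ker_of_finrank_eq finrank_prod_dual hnd
    (a := ContinuousLinearMap.fst ℝ E (E →L[ℝ] ℝ))
    (b := (ContinuousLinearMap.fst ℝ E (E →L[ℝ] ℝ)).comp (fderiv ℝ (S.φ 1) p))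
    Prod.fst_surjective hsurj
    (fun u hu ↦ by
      obtain ⟨η, -, hη⟩ := key u hu
      exact ⟨η, hη⟩) (-η)
  have hxu : x = u := by
    refine sub_eq_zero.1 (hnd _ fun w ↦ ?_)
    have h1 := hx w
    rw [oneFormDeriv_apply] at h1
    rw [map_sub, sub_apply, huw, oneFormDeriv_apply]
    simp only [ContinuousLinearMap.comp_apply, ContinuousLinearMap.coe_fst', neg_apply]
    linarith
  obtain ⟨η', hη', hw'⟩ := key u hu
  have : η' = -η := by
    ext b
    obtain ⟨w, rfl⟩ := hsurj b
    exact (hw' w).symm.trans (huw w)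
  rw [hxu, hη', this, map_neg]

end Dirac

end SprayModel

end SprayModel

/-! ### Charts of the cotangent bundle -/

section CotangentCharts

set_option maxSynthPendingDepth 3

variable {E : Type*} [NormedAddCommGroup E] [NormedSpace ℝ E]
  {M : Type*} [TopologicalSpace M] [ChartedSpace E M] [IsManifold 𝓘(ℝ, E) ∞ M]

/-- Two points of a fibre bundle are separated in the base or, if they lie in the same fibre, in a
local trivialisation. -/
theorem FiberBundle.t2Space_totalSpace {B F : Type*} {V : B → Type*} [TopologicalSpace B]
    [TopologicalSpace F] [TopologicalSpace (Bundle.TotalSpace F V)]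
    [∀ b, TopologicalSpace (V b)] [FiberBundle F V]
    [T2Space B] [T2Space F] : T2Space (Bundle.TotalSpace F V) := by
  refine ⟨fun p q hpq ↦ ?_⟩
  by_cases h : p.1 = q.1
  · have hp := mem_trivializationAt_proj_source (F := F) (E := V) (x := p)
    have hq : q ∈ (trivializationAt F V p.1).source := by
      rw [Bundle.Trivialization.mem_source, ← h]
      exact mem_baseSet_trivializationAt F V p.1
    set e := (trivializationAt F V p.1).toOpenPartialHomeomorph
    have hne : e p ≠ e q := fun he ↦ hpq (e.injOn hp hq he)
    obtain ⟨u, v, hu, hv, hpu, hqv, huv⟩ := t2_separation hne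
    exact ⟨e.source ∩ e ⁻¹' u, e.source ∩ e ⁻¹' v, e.isOpen_inter_preimage hu,
      e.isOpen_inter_preimage hv, ⟨hp, hpu⟩, ⟨hq, hqv⟩,
      (huv.preimage e).mono inter_subset_right inter_subset_right⟩
  · obtain ⟨u, v, hu, hv, hpu, hqv, huv⟩ := t2_separation h
    have hc := FiberBundle.continuous_proj F V
    exact ⟨_, _, hu.preimage hc, hv.preimage hc, hpu, hqv, huv.preimage _⟩

theorem cotangentBundle_t2Space [T2Space M] : T2Space (CotangentBundle E M) :=
  FiberBundle.t2Space_totalSpace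

/-- The chart of `T*M` induced by the chart of `M` at `x`. Mathlib's preferred chart at a point of
`T*M` depends on the base point only, so `0_x` serves as the point. -/
noncomputable abbrev cotangentChart (x : M) :
    PartialEquiv (CotangentBundle E M) (E × (E →L[ℝ] ℝ)) :=
  extChartAt (cotangentModel E) (zeroCovector x : CotangentBundle E M)

/-- The derivative at `m` of the chart of `M` at `x`. -/
noncomputable def chartDeriv (x m : M) : TangentSpace 𝓘(ℝ, E) m →L[ℝ] E :=
  mfderiv 𝓘(ℝ, E) 𝓘(ℝ, E) (extChartAt 𝓘(ℝ, E) x) m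

/-- The derivative at `p` of the chart of `T*M` induced by the chart of `M` at `x`. -/
noncomputable def cotangentChartDeriv (x : M) (p : CotangentBundle E M) :
    TangentSpace (cotangentModel E) p →L[ℝ] E × (E →L[ℝ] ℝ) :=
  mfderiv (cotangentModel E) 𝓘(ℝ, E × (E →L[ℝ] ℝ)) (cotangentChart x) p

theorem cotangentChart_eq (x : M) : cotangentChart (E := E) x =
    (trivializationAt (E →L[ℝ] ℝ) (CotangentSpace E M) x).toPartialEquiv.trans
      ((extChartAt 𝓘(ℝ, E) x).prod (PartialEquiv.refl (E →L[ℝ] ℝ))) :=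
  FiberBundle.extChartAt (IB := 𝓘(ℝ, E)) (zeroCovector x : CotangentBundle E M)

theorem extChartAt_cotangentModel (p : CotangentBundle E M) :
    extChartAt (cotangentModel E) p = cotangentChart p.1 := by
  rw [cotangentChart_eq, FiberBundle.extChartAt (IB := 𝓘(ℝ, E)) p]

theorem trivializationAt_cotangent_baseSet (x : M) :
    (trivializationAt (E →L[ℝ] ℝ) (CotangentSpace E M) x).baseSet = (chartAt E x).source := by
  rw [hom_trivializationAt_baseSet, TangentBundle.trivializationAt_baseSet]
  simp

theorem mem_cotangentChart_source {x : M} {p : CotangentBundle E M} :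
    p ∈ (cotangentChart (E := E) x).source ↔ p.1 ∈ (chartAt E x).source := by
  rw [extChartAt_source, FiberBundle.chartedSpace_chartAt]
  simp only [zeroCovector, mfld_simps]
  exact ⟨fun h ↦ h.1.1, fun h ↦ ⟨⟨h, mem_univ _⟩, by
    rwa [Bundle.Trivialization.coe_fst' _ (by rwa [trivializationAt_cotangent_baseSet])]⟩⟩

theorem cotangentChart_fst {x : M} {p : CotangentBundle E M}
    (hp : p.1 ∈ (chartAt E x).source) :
    (cotangentChart (E := E) x p).1 = extChartAt 𝓘(ℝ, E) x p.1 := by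
  rw [cotangentChart_eq]
  have h1 : ((trivializationAt (E →L[ℝ] ℝ) (CotangentSpace E M) x) p).1 = p.1 :=
    Bundle.Trivialization.coe_fst' _ (by rwa [trivializationAt_cotangent_baseSet])
  exact congrArg (extChartAt 𝓘(ℝ, E) x) h1

theorem cotangentChart_target (x : M) :
    (cotangentChart (E := E) x).target = (extChartAt 𝓘(ℝ, E) x).target ×ˢ univ := by
  ext q
  constructor
  · intro hq
    have h1 := (cotangentChart (E := E) x).map_target hq
    rw [mem_cotangentChart_source] at h1
    have h2 := cotangentChart_fst h1
    rw [(cotangentChart x).right_inv hq] at h2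
    refine ⟨?_, mem_univ _⟩
    rw [h2]
    exact (extChartAt 𝓘(ℝ, E) x).map_source (by rwa [extChartAt_source])
  · rintro ⟨hq, -⟩
    rw [cotangentChart_eq, PartialEquiv.trans_target]
    refine ⟨⟨hq, mem_univ _⟩, ?_⟩
    have h1 := (extChartAt 𝓘(ℝ, E) x).map_target hq
    rw [extChartAt_source, ← trivializationAt_cotangent_baseSet] at h1
    exact ((trivializationAt (E →L[ℝ] ℝ) (CotangentSpace E M) x).mem_target).2 h1

/-- The momentum coordinates `ξ` of a covector `p` are characterised by `ξ ∘ D = p`, where `D` is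
the derivative of the chart of the base. -/
theorem cotangentChart_snd_apply {x : M} {p : CotangentBundle E M}
    (hp : p.1 ∈ (chartAt E x).source) (v : TangentSpace 𝓘(ℝ, E) p.1) :
    (cotangentChart (E := E) x p).2 (chartDeriv x p.1 v) = p.2 v := by
  rw [cotangentChart_eq]
  have h0 : p.1 ∈ (trivializationAt E (TangentSpace 𝓘(ℝ, E)) x).baseSet := by
    rwa [TangentBundle.trivializationAt_baseSet]
  have h1 : ((trivializationAt (E →L[ℝ] ℝ) (CotangentSpace E M) x) p).2 =
      ContinuousLinearMap.inCoordinates E (TangentSpace 𝓘(ℝ, E)) ℝ (Bundle.Trivial M ℝ)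
        x p.1 x p.1 p.2 := by
    rw [hom_trivializationAt_apply]
  have h2 := ContinuousLinearMap.inCoordinates_eq (ϕ := p.2) (F' := ℝ) (E' := Bundle.Trivial M ℝ)
    (y₀ := x) h0 (mem_univ p.1)
  have h3 : chartDeriv x p.1 v = (trivializationAt E (TangentSpace 𝓘(ℝ, E)) x).continuousLinearMapAt
      ℝ p.1 v := by
    rw [TangentBundle.continuousLinearMapAt_trivializationAt hp]
    rfl
  have h4 : (trivializationAt E (TangentSpace 𝓘(ℝ, E)) x).continuousLinearMapAt ℝ p.1 v =
      (trivializationAt E (TangentSpace 𝓘(ℝ, E)) x).continuousLinearEquivAt ℝ p.1 h0 v := by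
    rw [Bundle.Trivialization.coe_continuousLinearEquivAt_eq]
  refine (DFunLike.congr_fun (h1.trans h2) (chartDeriv x p.1 v)).trans ?_
  rw [h3, h4]
  exact congrArg p.2 (ContinuousLinearEquiv.symm_apply_apply _ v)

theorem isInvertible_chartDeriv {x m : M} (hm : m ∈ (chartAt E x).source) :
    (chartDeriv (E := E) x m).IsInvertible :=
  isInvertible_mfderiv_extChartAt (by rwa [extChartAt_source])

theorem isInvertible_cotangentChartDeriv {x : M} {p : CotangentBundle E M}
    (hp : p ∈ (cotangentChart (E := E) x).source) : (cotangentChartDeriv x p).IsInvertible :=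
  isInvertible_mfderiv_extChartAt hp

theorem cotangentChart_zeroCovector {x y : M} (hy : y ∈ (chartAt E x).source) :
    cotangentChart (E := E) x (zeroCovector y) = (extChartAt 𝓘(ℝ, E) x y, 0) := by
  refine Prod.ext (cotangentChart_fst hy) ?_
  ext v
  obtain ⟨e, he⟩ := isInvertible_chartDeriv hy
  have h1 := cotangentChart_snd_apply (E := E) (p := zeroCovector y) hy (e.symm v)
  have h2 : chartDeriv (E := E) x (zeroCovector (E := E) y).1 (e.symm v) = v := by
    change chartDeriv x y (e.symm v) = v
    rw [← he]
    exact e.apply_symm_apply v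
  rw [h2] at h1
  exact h1

theorem hasMFDerivAt_cotangentChart {x : M} {p : CotangentBundle E M}
    (hp : p ∈ (cotangentChart (E := E) x).source) :
    HasMFDerivAt (cotangentModel E) 𝓘(ℝ, E × (E →L[ℝ] ℝ)) (cotangentChart x) p
      (cotangentChartDeriv x p) :=
  (mdifferentiableAt_extChartAt (by rwa [extChartAt_source] at hp)).hasMFDerivAt

theorem contMDiff_cotangentProj :
    ContMDiff (cotangentModel E) 𝓘(ℝ, E) ∞ (cotangentProj : CotangentBundle E M → M) :=
  Bundle.contMDiff_proj (CotangentSpace E M)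

theorem hasMFDerivAt_cotangentProj (p : CotangentBundle E M) :
    HasMFDerivAt (cotangentModel E) 𝓘(ℝ, E) cotangentProj p
      (mfderiv (cotangentModel E) 𝓘(ℝ, E) cotangentProj p) :=
  ((contMDiff_cotangentProj p).mdifferentiableAt (by simp)).hasMFDerivAt

/-- The derivative `τ_*` of the cotangent projection, with target stated as the tangent space at
`p.1`. -/
noncomputable def cotangentProjDeriv (p : CotangentBundle E M) :
    TangentSpace (cotangentModel E) p →L[ℝ] TangentSpace 𝓘(ℝ, E) p.1 :=
  mfderiv (cotangentModel E) 𝓘(ℝ, E) cotangentProj p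

theorem cotangentChartDeriv_fst {x : M} {p : CotangentBundle E M}
    (hp : p ∈ (cotangentChart (E := E) x).source) (u : TangentSpace (cotangentModel E) p) :
    (cotangentChartDeriv x p u).1 =
      chartDeriv x p.1 (cotangentProjDeriv p u) := by
  have hp' := mem_cotangentChart_source.1 hp
  set A : TangentSpace (cotangentModel E) p →L[ℝ] E :=
    (chartDeriv x p.1).comp (cotangentProjDeriv p)
  have h1 : HasMFDerivAt (cotangentModel E) 𝓘(ℝ, E) (extChartAt 𝓘(ℝ, E) x ∘ cotangentProj) p A :=
    HasMFDerivAt.comp p ((mdifferentiableAt_extChartAt hp').hasMFDerivAt)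
      (hasMFDerivAt_cotangentProj p)
  set B : TangentSpace (cotangentModel E) p →L[ℝ] E :=
    (ContinuousLinearMap.fst ℝ E (E →L[ℝ] ℝ)).comp (cotangentChartDeriv x p)
  have h2 : HasMFDerivAt (cotangentModel E) 𝓘(ℝ, E) (fun p ↦ (cotangentChart (E := E) x p).1) p
      B :=
    HasMFDerivAt.comp p
      (ContinuousLinearMap.fst ℝ E (E →L[ℝ] ℝ)).hasFDerivAt.hasMFDerivAt
      (hasMFDerivAt_cotangentChart hp)
  have h3 : (fun p ↦ (cotangentChart (E := E) x p).1) =ᶠ[𝓝 p]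
      (extChartAt 𝓘(ℝ, E) x ∘ cotangentProj) := by
    filter_upwards [(isOpen_extChartAt_source (I := cotangentModel E) _).mem_nhds hp] with q hq
    exact cotangentChart_fst (mem_cotangentChart_source.1 hq)
  exact DFunLike.congr_fun (hasMFDerivAt_unique h2 (h1.congr_of_eventuallyEq h3)) u

/-- Tangent vectors at `p` are by definition represented in the preferred chart at `p`. -/
theorem cotangentChartDeriv_self (p : CotangentBundle E M) (u : TangentSpace (cotangentModel E) p) :
    cotangentChartDeriv p.1 p u = u := by
  have h := mfderiv_extChartAt_self (I := cotangentModel E) (x := p)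
  rw [extChartAt_cotangentModel] at h
  exact DFunLike.congr_fun h u

/-- In a cotangent chart the canonical one-form is the model one-form. -/
theorem liouvilleForm_cotangentChart {x : M} {p : CotangentBundle E M}
    (hp : p ∈ (cotangentChart (E := E) x).source) (u : TangentSpace (cotangentModel E) p) :
    liouvilleForm E (cotangentChart x p) (cotangentChartDeriv x p u) =
      p.2 (cotangentProjDeriv p u) := by
  rw [liouvilleForm_apply, cotangentChartDeriv_fst hp,
    cotangentChart_snd_apply (mem_cotangentChart_source.1 hp)]

theorem isOpen_cotangentChart_source (x : M) : IsOpen (cotangentChart (E := E) x).source :=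
  isOpen_extChartAt_source _

theorem isOpen_cotangentChart_target (x : M) : IsOpen (cotangentChart (E := E) x).target :=
  isOpen_extChartAt_target _

theorem contMDiffOn_cotangentChart (x : M) :
    ContMDiffOn (cotangentModel E) 𝓘(ℝ, E × (E →L[ℝ] ℝ)) ∞ (cotangentChart (E := E) x)
      (cotangentChart (E := E) x).source := by
  rw [extChartAt_source]
  exact contMDiffOn_extChartAt

theorem contMDiffOn_cotangentChart_symm (x : M) :
    ContMDiffOn 𝓘(ℝ, E × (E →L[ℝ] ℝ)) (cotangentModel E) ∞ (cotangentChart (E := E) x).symm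
      (cotangentChart (E := E) x).target :=
  contMDiffOn_extChartAt_symm _

/-- The chain rule in cotangent charts: if `g` is the coordinate expression of `f`, then `Dg` is
the coordinate expression of the derivative of `f`. -/
theorem cotangentChartDeriv_mfderiv {x x' : M} {f : CotangentBundle E M → CotangentBundle E M}
    {g : E × (E →L[ℝ] ℝ) → E × (E →L[ℝ] ℝ)} {p : CotangentBundle E M}
    (hp : p ∈ (cotangentChart (E := E) x).source) (hfp : f p ∈ (cotangentChart (E := E) x').source)
    (hf : MDifferentiableAt (cotangentModel E) (cotangentModel E) f p)
    (hg : DifferentiableAt ℝ g (cotangentChart x p))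
    (h : ∀ᶠ q in 𝓝 p, cotangentChart x' (f q) = g (cotangentChart x q))
    (u : TangentSpace (cotangentModel E) p) :
    cotangentChartDeriv x' (f p) (mfderiv (cotangentModel E) (cotangentModel E) f p u) =
      fderiv ℝ g (cotangentChart x p) (cotangentChartDeriv x p u) := by
  set A : TangentSpace (cotangentModel E) p →L[ℝ] E × (E →L[ℝ] ℝ) :=
    (cotangentChartDeriv x' (f p)).comp (mfderiv (cotangentModel E) (cotangentModel E) f p)
  set B : TangentSpace (cotangentModel E) p →L[ℝ] E × (E →L[ℝ] ℝ) :=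
    (fderiv ℝ g (cotangentChart x p)).comp (cotangentChartDeriv x p)
  have h1 : HasMFDerivAt (cotangentModel E) 𝓘(ℝ, E × (E →L[ℝ] ℝ)) (cotangentChart x' ∘ f) p A :=
    HasMFDerivAt.comp p (hasMFDerivAt_cotangentChart hfp) hf.hasMFDerivAt
  have h2 : HasMFDerivAt (cotangentModel E) 𝓘(ℝ, E × (E →L[ℝ] ℝ)) (g ∘ cotangentChart x) p B :=
    HasMFDerivAt.comp p hg.hasFDerivAt.hasMFDerivAt (hasMFDerivAt_cotangentChart hp)
  exact DFunLike.congr_fun (hasMFDerivAt_unique h1 (h2.congr_of_eventuallyEq h)) u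

/-- Cotangent charts are symplectic: the changes between them preserve the canonical one-form,
hence its exterior derivative. -/
theorem canonicalFormModel_cotangentChartDeriv {x : M} {p : CotangentBundle E M}
    (hp : p ∈ (cotangentChart (E := E) x).source) (u v : TangentSpace (cotangentModel E) p) :
    canonicalFormModel E (cotangentChartDeriv x p u) (cotangentChartDeriv x p v) =
      canonicalForm p u v := by
  set e := cotangentChart (E := E) x with he
  set e' := cotangentChart (E := E) p.1 with he'
  set O := e'.target ∩ e'.symm ⁻¹' e.source with hO
  have hp' : p ∈ e'.source :=
    mem_cotangentChart_source.2 (mem_chart_source E p.1)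
  have hOopen : IsOpen O := (contMDiffOn_cotangentChart_symm p.1).continuousOn.isOpen_inter_preimage
    (isOpen_cotangentChart_target p.1) (isOpen_cotangentChart_source x)
  set g : E × (E →L[ℝ] ℝ) → E × (E →L[ℝ] ℝ) := fun q ↦ e (e'.symm q) with hg
  have hgs : ContDiffOn ℝ ∞ g O := contMDiffOn_iff_contDiffOn.1
    ((contMDiffOn_cotangentChart x).comp ((contMDiffOn_cotangentChart_symm p.1).mono
      inter_subset_left) fun q hq ↦ hq.2)
  have hgd (q) (hq : q ∈ O) : ContDiffAt ℝ ∞ g q := hgs.contDiffAt (hOopen.mem_nhds hq)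
  -- the derivative of the transition map
  have hder (p' : CotangentBundle E M) (h1 : p' ∈ e.source) (h2 : p' ∈ e'.source)
      (w : TangentSpace (cotangentModel E) p') :
      fderiv ℝ g (e' p') (cotangentChartDeriv p.1 p' w) = cotangentChartDeriv x p' w := by
    have hmem : e' p' ∈ O := ⟨e'.map_source h2, by rwa [mem_preimage, e'.left_inv h2]⟩
    have h3 := cotangentChartDeriv_mfderiv (f := id) (g := g) (x := p.1) (x' := x) h2 h1
      mdifferentiableAt_id ((hgd _ hmem).differentiableAt (by simp)) (by
        filter_upwards [(isOpen_cotangentChart_source p.1).mem_nhds h2] with q hq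
        simp only [hg, id]
        rw [e'.left_inv hq]) w
    rw [mfderiv_id] at h3
    exact h3.symm
  have hmem : e' p ∈ O := ⟨e'.map_source hp', by rwa [mem_preimage, e'.left_inv hp']⟩
  have hev : (fun q ↦ (liouvilleForm E (g q)).comp (fderiv ℝ g q)) =ᶠ[𝓝 (e' p)]
      liouvilleForm E := by
    filter_upwards [hOopen.mem_nhds hmem] with q hq
    refine ContinuousLinearMap.ext fun w ↦ ?_
    have hq' : e'.symm q ∈ e'.source := e'.map_target hq.1
    obtain ⟨ε, hε⟩ := isInvertible_cotangentChartDeriv hq'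
    have hw : cotangentChartDeriv p.1 (e'.symm q) (ε.symm w) = w := by
      rw [← hε]
      exact ε.apply_symm_apply w
    have h1 := hder _ hq.2 hq' (ε.symm w)
    rw [hw, e'.right_inv hq.1] at h1
    have h2 := liouvilleForm_cotangentChart hq.2 (ε.symm w)
    have h3 := liouvilleForm_cotangentChart hq' (ε.symm w)
    rw [hw, ← he', e'.right_inv hq.1] at h3
    rw [ContinuousLinearMap.comp_apply, h1]
    exact h2.trans h3.symm
  have h1 := oneFormDeriv_pullback (Θ := liouvilleForm E) (g := g) (p := e' p)
    (liouvilleForm E).differentiableAt ((hgd _ hmem).of_le two_le_infty)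
    (cotangentChartDeriv p.1 p u) (cotangentChartDeriv p.1 p v)
  rw [hev.oneFormDeriv_eq, oneFormDeriv_clm_apply, oneFormDeriv_clm_apply, hder p hp hp',
    hder p hp hp', cotangentChartDeriv_self, cotangentChartDeriv_self] at h1
  exact h1.symm

end CotangentCharts

/-! ### The chart expression of a Poisson spray -/

section ChartExpression

set_option maxSynthPendingDepth 3

variable {E : Type*} [NormedAddCommGroup E] [NormedSpace ℝ E]
  {M : Type*} [TopologicalSpace M] [ChartedSpace E M] [IsManifold 𝓘(ℝ, E) ∞ M]

theorem fibreMul_mem_cotangentChart_source {x : M} {p : CotangentBundle E M} (c : ℝ)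
    (hp : p ∈ (cotangentChart (E := E) x).source) :
    fibreMul c p ∈ (cotangentChart (E := E) x).source := by
  rw [mem_cotangentChart_source] at hp ⊢
  simpa only [fibreMul] using hp

theorem cotangentChart_fibreMul {x : M} {p : CotangentBundle E M} (c : ℝ)
    (hp : p ∈ (cotangentChart (E := E) x).source) :
    cotangentChart (E := E) x (fibreMul c p) =
      ((cotangentChart x p).1, c • (cotangentChart x p).2) := by
  have hp' := mem_cotangentChart_source.1 hp
  have hc : (fibreMul c p).1 ∈ (chartAt E x).source := hp'
  refine Prod.ext ((cotangentChart_fst hc).trans (cotangentChart_fst hp').symm) ?_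
  refine ContinuousLinearMap.ext fun v ↦ ?_
  obtain ⟨ε, hε⟩ := isInvertible_chartDeriv hp'
  have h0 : chartDeriv x p.1 (ε.symm v) = v := by
    rw [← hε]
    exact ε.apply_symm_apply v
  have h1 := cotangentChart_snd_apply hc (ε.symm v)
  have h2 := cotangentChart_snd_apply hp' (ε.symm v)
  have h3 : chartDeriv x (fibreMul c p).1 (ε.symm v) = v := h0
  rw [h0] at h2
  rw [h3] at h1
  refine h1.trans ?_
  rw [smul_apply, h2]
  rfl

/-- The multiplication by `c ≠ 0` on the second factor. -/
noncomputable def prodSMul (V W : Type*) [NormedAddCommGroup V] [NormedSpace ℝ V]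
    [NormedAddCommGroup W] [NormedSpace ℝ W] (c : ℝ) (hc : c ≠ 0) : (V × W) ≃L[ℝ] (V × W) :=
  (ContinuousLinearEquiv.refl ℝ V).prodCongr (ContinuousLinearEquiv.smulLeft (Units.mk0 c hc))

theorem prodSMul_apply {V W : Type*} [NormedAddCommGroup V] [NormedSpace ℝ V]
    [NormedAddCommGroup W] [NormedSpace ℝ W] {c : ℝ} (hc : c ≠ 0) (q : V × W) :
    prodSMul V W c hc q = (q.1, c • q.2) := rfl

theorem mdifferentiableAt_fibreMul {c : ℝ} (hc : c ≠ 0) (p : CotangentBundle E M) :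
    MDifferentiableAt (cotangentModel E) (cotangentModel E) (fibreMul c) p := by
  set x := p.1
  have hps : p ∈ (cotangentChart (E := E) x).source :=
    mem_cotangentChart_source.2 (mem_chart_source E p.1)
  have hcs (q : CotangentBundle E M) (hq : q ∈ (cotangentChart (E := E) x).source) :
      fibreMul c q ∈ (cotangentChart (E := E) x).source :=
    fibreMul_mem_cotangentChart_source c hq
  have h1 : ContMDiffAt (cotangentModel E) (cotangentModel E) ∞
      (fun q ↦ (cotangentChart x).symm (prodSMul E (E →L[ℝ] ℝ) c hc (cotangentChart x q))) p := by
    have h2 := ((contMDiffOn_cotangentChart x).contMDiffAt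
      ((isOpen_cotangentChart_source x).mem_nhds hps))
    have h3 := (contMDiffOn_cotangentChart_symm x).contMDiffAt
      (x := prodSMul E (E →L[ℝ] ℝ) c hc (cotangentChart x p))
      ((isOpen_cotangentChart_target x).mem_nhds (by
        rw [prodSMul_apply, ← cotangentChart_fibreMul c hps]
        exact (cotangentChart x).map_source (hcs p hps)))
    exact h3.comp p (((prodSMul E (E →L[ℝ] ℝ) c hc).contDiff.contMDiff _).comp p h2)
  refine (h1.congr_of_eventuallyEq ?_).mdifferentiableAt (by simp)
  filter_upwards [(isOpen_cotangentChart_source x).mem_nhds hps] with q hq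
  rw [prodSMul_apply, ← cotangentChart_fibreMul c hq, (cotangentChart x).left_inv (hcs q hq)]

theorem cotangentChartDeriv_fibreMul {x : M} {p : CotangentBundle E M}
    (hp : p ∈ (cotangentChart (E := E) x).source) {c : ℝ} (hc : c ≠ 0)
    (u : TangentSpace (cotangentModel E) p) :
    cotangentChartDeriv x (fibreMul c p)
      (mfderiv (cotangentModel E) (cotangentModel E) (fibreMul c) p u) =
      prodSMul E (E →L[ℝ] ℝ) c hc (cotangentChartDeriv x p u) := by
  have h1 := cotangentChartDeriv_mfderiv (g := prodSMul E (E →L[ℝ] ℝ) c hc) (x' := x) hp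
    (fibreMul_mem_cotangentChart_source c hp)
    (mdifferentiableAt_fibreMul hc p) (prodSMul E (E →L[ℝ] ℝ) c hc).differentiableAt
    (by filter_upwards [(isOpen_cotangentChart_source x).mem_nhds hp] with q hq
        exact (cotangentChart_fibreMul c hq).trans (prodSMul_apply hc _).symm) u
  rwa [(prodSMul E (E →L[ℝ] ℝ) c hc).fderiv] at h1

/-- `ContinuousLinearMap.inverse` has the value `0` at maps that are not invertible; the
equivalences exhibit `A` as invertible. -/
theorem ContinuousLinearMap.eq_of_inverse_apply_eq {V W F : Type*} [TopologicalSpace V]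
    [AddCommGroup V] [Module ℝ V] [TopologicalSpace W] [AddCommGroup W] [Module ℝ W]
    [TopologicalSpace F] [AddCommGroup F] [Module ℝ F] {A : V →L[ℝ] W} {ε : V ≃L[ℝ] F}
    {ε' : W ≃L[ℝ] F} {μ : F ≃L[ℝ] F} (h : ∀ u, ε' (A u) = μ (ε u)) {w : W} {v : V}
    (hw : A.inverse w = v) : w = A v := by
  have hA : A = ((ε.trans μ).trans ε'.symm : V ≃L[ℝ] W) := by
    refine ContinuousLinearMap.ext fun u ↦ ε'.injective ?_
    simp [h]
  rw [hA, ContinuousLinearMap.inverse_equiv] at hw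
  rw [hA]
  exact (ContinuousLinearEquiv.symm_apply_eq _).1 hw

/-- The coordinate expression of the Poisson tensor in the chart at `x`: conjugation of `π^#` by the
derivative `D` of the chart, `ζ ↦ D (π^# (ζ ∘ D))`. -/
noncomputable def PoissonStructure.localTensor (π : PoissonStructure E M) (x : M) (y : E) :
    (E →L[ℝ] ℝ) →L[ℝ] E :=
  (chartDeriv x ((extChartAt 𝓘(ℝ, E) x).symm y)).comp
    ((π.sharp ((extChartAt 𝓘(ℝ, E) x).symm y)).comp
      ((chartDeriv x ((extChartAt 𝓘(ℝ, E) x).symm y)).precomp ℝ))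

theorem PoissonStructure.localTensor_extChartAt (π : PoissonStructure E M) {x m : M}
    (hm : m ∈ (chartAt E x).source) (ζ : E →L[ℝ] ℝ) :
    π.localTensor x (extChartAt 𝓘(ℝ, E) x m) ζ =
      chartDeriv x m (π.sharp m (ζ.comp (chartDeriv x m))) := by
  rw [PoissonStructure.localTensor,
    (extChartAt 𝓘(ℝ, E) x).left_inv (by rwa [extChartAt_source])]
  rfl

/-- The coordinate expression of a vector field on `T*M` in the cotangent chart at `x`. -/
noncomputable def localSpray (X : ∀ p : CotangentBundle E M, TangentSpace (cotangentModel E) p)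
    (x : M) (q : E × (E →L[ℝ] ℝ)) : E × (E →L[ℝ] ℝ) :=
  cotangentChartDeriv x ((cotangentChart x).symm q) (X ((cotangentChart x).symm q))

theorem localSpray_cotangentChart
    (X : ∀ p : CotangentBundle E M, TangentSpace (cotangentModel E) p) {x : M}
    {p : CotangentBundle E M} (hp : p ∈ (cotangentChart (E := E) x).source) :
    localSpray X x (cotangentChart x p) = cotangentChartDeriv x p (X p) := by
  rw [localSpray, (cotangentChart x).left_inv hp]

namespace IsPoissonSpray

variable {π : PoissonStructure E M}
  {X : ∀ p : CotangentBundle E M, TangentSpace (cotangentModel E) p}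

theorem contDiffOn_localSpray (hX : IsPoissonSpray π X) (x : M) :
    ContDiffOn ℝ ∞ (localSpray X x) (cotangentChart (E := E) x).target := by
  set z : CotangentBundle E M := zeroCovector x
  set T := trivializationAt (E × (E →L[ℝ] ℝ)) (TangentSpace (cotangentModel E)) z
  have h1 : ContMDiffOn (cotangentModel E) ((cotangentModel E).prod 𝓘(ℝ, E × (E →L[ℝ] ℝ))) ∞
      (fun p ↦ T ⟨p, X p⟩) (cotangentChart (E := E) x).source := by
    refine (T.contMDiffOn (IB := cotangentModel E) (n := ∞)).comp hX.contMDiff.contMDiffOn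
      fun p hp ↦ ?_
    rw [extChartAt_source] at hp
    rw [mem_preimage, Bundle.Trivialization.mem_source]
    simpa [T] using hp
  have h2 := contMDiff_snd.comp_contMDiffOn h1
  have h3 : ContMDiffOn (cotangentModel E) 𝓘(ℝ, E × (E →L[ℝ] ℝ)) ∞
      (fun p ↦ cotangentChartDeriv x p (X p)) (cotangentChart (E := E) x).source := by
    refine h2.congr fun p hp ↦ ?_
    rw [extChartAt_source] at hp
    have h4 := TangentBundle.continuousLinearMapAt_trivializationAt (I := cotangentModel E) hp
    have h5 := DFunLike.congr_fun h4 (X p)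
    refine h5.symm.trans ?_
    rw [Bundle.Trivialization.continuousLinearMapAt_apply, Bundle.Trivialization.linearMapAt_apply,
      if_pos (by simpa [T] using hp)]
    rfl
  exact contMDiffOn_iff_contDiffOn.1 (h3.comp (contMDiffOn_cotangentChart_symm x)
    fun q hq ↦ (cotangentChart x).map_target hq)

/-- The condition `τ_* X(ξ) = π^# ξ` in coordinates. -/
theorem localSpray_fst (hX : IsPoissonSpray π X) {x : M} {y : E}
    (hy : y ∈ (extChartAt 𝓘(ℝ, E) x).target) (ξ : E →L[ℝ] ℝ) :
    (localSpray X x (y, ξ)).1 = π.localTensor x y ξ := by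
  have hq : (y, ξ) ∈ (cotangentChart (E := E) x).target := by
    rw [cotangentChart_target]
    exact ⟨hy, mem_univ _⟩
  set p := (cotangentChart (E := E) x).symm (y, ξ) with hp
  have hps : p ∈ (cotangentChart (E := E) x).source := (cotangentChart x).map_target hq
  have hps' := mem_cotangentChart_source.1 hps
  have hep : cotangentChart x p = (y, ξ) := (cotangentChart x).right_inv hq
  have h1 : extChartAt 𝓘(ℝ, E) x p.1 = y := by
    rw [← cotangentChart_fst hps', hep]
  have h2 : ξ.comp (chartDeriv x p.1) = p.2 := by
    refine ContinuousLinearMap.ext fun v ↦ ?_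
    have := cotangentChart_snd_apply hps' v
    rw [hep] at this
    exact this
  rw [← hep, localSpray_cotangentChart X hps, cotangentChartDeriv_fst hps, ← h1,
    π.localTensor_extChartAt hps']
  have h3 : cotangentProjDeriv p (X p) = π.sharp p.1 p.2 := hX.proj_eq p
  rw [h3]
  exact congrArg (fun ζ ↦ chartDeriv x p.1 (π.sharp p.1 ζ)) h2.symm

/-- The homogeneity of `X` in coordinates: `m_c^* X = c X` and the linearity of `m_c` make the
second component quadratic. -/
theorem localSpray_smul (hX : IsPoissonSpray π X) {x : M} {p : CotangentBundle E M}
    (hp : p ∈ (cotangentChart (E := E) x).source) {c : ℝ} (hc : c ≠ 0) :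
    localSpray X x (cotangentChart x (fibreMul c p)) =
      (c • (localSpray X x (cotangentChart x p)).1,
        c ^ 2 • (localSpray X x (cotangentChart x p)).2) := by
  have hcs : fibreMul c p ∈ (cotangentChart (E := E) x).source :=
    fibreMul_mem_cotangentChart_source c hp
  have hX1 : X (fibreMul c p) = mfderiv (cotangentModel E) (cotangentModel E) (fibreMul c) p
      (c • X p) :=
    have ⟨_, hε⟩ := isInvertible_cotangentChartDeriv hp
    have ⟨_, hε'⟩ := isInvertible_cotangentChartDeriv hcs
    ContinuousLinearMap.eq_of_inverse_apply_eq
      (fun u ↦ by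
        have h1 := cotangentChartDeriv_fibreMul hp hc u
        rw [← hε, ← hε'] at h1
        exact h1) (congrFun (hX.homogeneous c hc) p)
  rw [localSpray_cotangentChart X hp, localSpray_cotangentChart X hcs, hX1,
    cotangentChartDeriv_fibreMul hp hc, map_smul]
  refine Prod.ext rfl ?_
  change c • (c • (cotangentChartDeriv x p (X p)).2) = c ^ 2 • (cotangentChartDeriv x p (X p)).2
  rw [smul_smul, pow_two]

theorem localSpray_snd_smul (hX : IsPoissonSpray π X) {x : M} {y : E}
    (hy : y ∈ (extChartAt 𝓘(ℝ, E) x).target) (ξ : E →L[ℝ] ℝ) {c : ℝ} (hc : c ≠ 0) :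
    (localSpray X x (y, c • ξ)).2 = c ^ 2 • (localSpray X x (y, ξ)).2 := by
  have hq : (y, ξ) ∈ (cotangentChart (E := E) x).target := by
    rw [cotangentChart_target]
    exact ⟨hy, mem_univ _⟩
  have h1 := hX.localSpray_smul ((cotangentChart (E := E) x).map_target hq) hc
  rw [cotangentChart_fibreMul c ((cotangentChart (E := E) x).map_target hq),
    (cotangentChart x).right_inv hq] at h1
  rw [h1]

end IsPoissonSpray

theorem mvfderiv_eq_fderiv_comp_chartDeriv {x m : M} (hm : m ∈ (chartAt E x).source) {f : M → ℝ}
    {h : E → ℝ} (hh : DifferentiableAt ℝ h (extChartAt 𝓘(ℝ, E) x m))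
    (hf : f =ᶠ[𝓝 m] h ∘ extChartAt 𝓘(ℝ, E) x) (v : TangentSpace 𝓘(ℝ, E) m) :
    mvfderiv 𝓘(ℝ, E) f m v = fderiv ℝ h (extChartAt 𝓘(ℝ, E) x m) (chartDeriv x m v) := by
  set A : TangentSpace 𝓘(ℝ, E) m →L[ℝ] ℝ :=
    (fderiv ℝ h (extChartAt 𝓘(ℝ, E) x m)).comp (chartDeriv x m)
  have h1 : HasMFDerivAt 𝓘(ℝ, E) 𝓘(ℝ, ℝ) (h ∘ extChartAt 𝓘(ℝ, E) x) m A :=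
    HasMFDerivAt.comp m hh.hasFDerivAt.hasMFDerivAt (mdifferentiableAt_extChartAt hm).hasMFDerivAt
  have h2 := (h1.congr_of_eventuallyEq hf).mfderiv
  exact DFunLike.congr_fun h2 v

variable [FiniteDimensional ℝ E] [T2Space M]

/-- Near `x` every linear function of the coordinates is the restriction of a smooth function on
`M`. -/
theorem exists_contMDiff_eq_linear (x : M) : ∃ O : Set M, IsOpen O ∧ x ∈ O ∧
    O ⊆ (chartAt E x).source ∧ ∀ ζ : E →L[ℝ] ℝ, ∃ f : M → ℝ, ContMDiff 𝓘(ℝ, E) 𝓘(ℝ, ℝ) ∞ f ∧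
      EqOn f (ζ ∘ extChartAt 𝓘(ℝ, E) x) O := by
  obtain ⟨χ⟩ : Nonempty (SmoothBumpFunction 𝓘(ℝ, E) x) := inferInstance
  obtain ⟨O, hO, hOopen, hxO⟩ := eventually_nhds_iff.1
    (χ.eventuallyEq_one.and ((chartAt E x).open_source.eventually_mem (mem_chart_source E x)))
  refine ⟨O, hOopen, hxO, fun m hm ↦ (hO m hm).2, fun ζ ↦
    ⟨fun m ↦ χ m • ζ (extChartAt 𝓘(ℝ, E) x m), χ.contMDiff_smul ?_, fun m hm ↦ ?_⟩⟩
  · exact ζ.contDiff.contMDiff.comp_contMDiffOn contMDiffOn_extChartAt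
  · simp [(hO m hm).1]

/-- The coordinate expression of a Poisson spray near a point. Skew-symmetry and the Jacobi identity
for the coordinate expression of `π` come from the brackets of global smooth functions that are
linear in the coordinates near the point. -/
theorem IsPoissonSpray.exists_isLocalSpray {π : PoissonStructure E M}
    {X : ∀ p : CotangentBundle E M, TangentSpace (cotangentModel E) p} (hX : IsPoissonSpray π X)
    (x : M) : ∃ U : Set E, U ⊆ (extChartAt 𝓘(ℝ, E) x).target ∧ extChartAt 𝓘(ℝ, E) x x ∈ U ∧
      IsLocalSpray U (π.localTensor x) (localSpray X x) := by
  obtain ⟨O, hOopen, hxO, hOs, hfun⟩ := exists_contMDiff_eq_linear (E := E) x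
  set c := extChartAt 𝓘(ℝ, E) x with hc
  set U := c.target ∩ c.symm ⁻¹' O with hU
  have hcs {m : M} (hm : m ∈ O) : m ∈ c.source := by
    rw [hc, extChartAt_source]; exact hOs hm
  have hUopen : IsOpen U :=
    (continuousOn_extChartAt_symm x).isOpen_inter_preimage (isOpen_extChartAt_target x) hOopen
  have hG : ContDiffOn ℝ ∞ (localSpray X x) (U ×ˢ univ) :=
    (hX.contDiffOn_localSpray x).mono (by
      rw [cotangentChart_target]; exact prod_mono inter_subset_left subset_rfl)
  have hfst : ∀ y ∈ U, ∀ ξ : E →L[ℝ] ℝ, (localSpray X x (y, ξ)).1 = π.localTensor x y ξ :=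
    fun y hy ξ ↦ hX.localSpray_fst hy.1 ξ
  have hP := contDiffOn_of_fst_eq hUopen hG hfst
  choose f hf hf' using hfun
  have hmU {m : M} (hm : m ∈ O) : c m ∈ U :=
    ⟨c.map_source (hcs hm), by rwa [mem_preimage, c.left_inv (hcs hm)]⟩
  -- the derivative of a coordinate function, and the brackets of two and three of them
  have hdf (ζ : E →L[ℝ] ℝ) {m : M} (hm : m ∈ O) :
      mvfderiv 𝓘(ℝ, E) (f ζ) m = ζ.comp (chartDeriv x m) := by
    refine ContinuousLinearMap.ext fun v ↦ ?_
    have h1 := mvfderiv_eq_fderiv_comp_chartDeriv (hOs hm) ζ.differentiableAt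
      (Filter.eventuallyEq_of_mem (hOopen.mem_nhds hm) (hf' ζ)) v
    rw [ζ.fderiv] at h1
    exact h1
  have hbr (ξ η : E →L[ℝ] ℝ) {m : M} (hm : m ∈ O) :
      tensorBracket π.sharp (f ξ) (f η) m = ξ (π.localTensor x (c m) η) := by
    rw [tensorBracket, hdf ξ hm, hdf η hm, π.localTensor_extChartAt (hOs hm)]
    rfl
  have hbr3 (ξ η ζ : E →L[ℝ] ℝ) {m : M} (hm : m ∈ O) :
      tensorBracket π.sharp (tensorBracket π.sharp (f ξ) (f η)) (f ζ) m =
        ξ (fderiv ℝ (π.localTensor x) (c m) (π.localTensor x (c m) ζ) η) := by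
    have hd : HasFDerivAt (fun y ↦ ξ (π.localTensor x y η))
        (ξ.comp ((fderiv ℝ (π.localTensor x) (c m)).flip η)) (c m) :=
      ξ.hasFDerivAt.comp (c m) ((((hP.contDiffAt (hUopen.mem_nhds (hmU hm))).differentiableAt
        (by simp)).hasFDerivAt).eval_const η)
    rw [tensorBracket, hdf ζ hm, mvfderiv_eq_fderiv_comp_chartDeriv (hOs hm) hd.differentiableAt
      (Filter.eventuallyEq_of_mem (hOopen.mem_nhds hm) fun m' hm' ↦ hbr ξ η hm'),
      hd.fderiv, π.localTensor_extChartAt (hOs hm)]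
    rfl
  refine ⟨U, inter_subset_left, hmU hxO, hUopen, hG, hfst,
    fun y hy ξ a ha ↦ hX.localSpray_snd_smul hy.1 ξ ha, fun y hy ξ η ↦ ?_, fun y hy ξ η ζ ↦ ?_⟩
  · have h1 := π.skew (f η) (f ξ) (hf η) (hf ξ) (c.symm y)
    rwa [hbr _ _ hy.2, hbr _ _ hy.2, c.right_inv hy.1] at h1
  · have h1 := π.jacobi (f ξ) (f η) (f ζ) (hf ξ) (hf η) (hf ζ) (c.symm y)
    rwa [hbr3 _ _ _ hy.2, hbr3 _ _ _ hy.2, hbr3 _ _ _ hy.2, c.right_inv hy.1] at h1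

end ChartExpression

/-! ### The flow of a Poisson spray on the cotangent bundle -/

section SprayChart

set_option maxSynthPendingDepth 3

variable {E : Type*} [NormedAddCommGroup E] [NormedSpace ℝ E]
  {M : Type*} [TopologicalSpace M] [ChartedSpace E M] [IsManifold 𝓘(ℝ, E) ∞ M]

theorem hasMFDerivAt_cotangentChart_symm {x : M} {q : E × (E →L[ℝ] ℝ)}
    (hq : q ∈ (cotangentChart (E := E) x).target) :
    HasMFDerivAt 𝓘(ℝ, E × (E →L[ℝ] ℝ)) (cotangentModel E) (cotangentChart (E := E) x).symm q
      (mfderiv 𝓘(ℝ, E × (E →L[ℝ] ℝ)) (cotangentModel E) (cotangentChart (E := E) x).symm q) :=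
  (((contMDiffOn_cotangentChart_symm x).contMDiffAt
    ((isOpen_cotangentChart_target x).mem_nhds hq)).mdifferentiableAt (by simp)).hasMFDerivAt

theorem cotangentChartDeriv_mfderiv_symm {x : M} {q : E × (E →L[ℝ] ℝ)}
    (hq : q ∈ (cotangentChart (E := E) x).target) (w : E × (E →L[ℝ] ℝ)) :
    cotangentChartDeriv x ((cotangentChart (E := E) x).symm q)
      (mfderiv 𝓘(ℝ, E × (E →L[ℝ] ℝ)) (cotangentModel E) (cotangentChart (E := E) x).symm q w) =
      w := by
  set A : (E × (E →L[ℝ] ℝ)) →L[ℝ] (E × (E →L[ℝ] ℝ)) :=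
    (cotangentChartDeriv x ((cotangentChart (E := E) x).symm q)).comp
      (mfderiv 𝓘(ℝ, E × (E →L[ℝ] ℝ)) (cotangentModel E) (cotangentChart (E := E) x).symm q)
  have h1 : HasMFDerivAt 𝓘(ℝ, E × (E →L[ℝ] ℝ)) 𝓘(ℝ, E × (E →L[ℝ] ℝ))
      (cotangentChart x ∘ (cotangentChart (E := E) x).symm) q A :=
    HasMFDerivAt.comp q (hasMFDerivAt_cotangentChart ((cotangentChart x).map_target hq))
      (hasMFDerivAt_cotangentChart_symm hq)
  have h2 : HasFDerivAt (cotangentChart x ∘ (cotangentChart (E := E) x).symm) A q :=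
    h1.hasFDerivAt
  have h3 : (cotangentChart x ∘ (cotangentChart (E := E) x).symm) =ᶠ[𝓝 q] id := by
    filter_upwards [(isOpen_cotangentChart_target x).mem_nhds hq] with q' hq'
    exact (cotangentChart x).right_inv hq'
  exact DFunLike.congr_fun (h2.unique ((hasFDerivAt_id q).congr_of_eventuallyEq h3)) w

/-- The velocity of a curve in `T*M`, read in a cotangent chart. -/
theorem HasMFDerivWithinAt.hasDerivWithinAt_cotangentChart {x : M} {γ : ℝ → CotangentBundle E M}
    {S : Set ℝ} {t : ℝ} {v : TangentSpace (cotangentModel E) (γ t)}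
    (hγ : HasMFDerivWithinAt 𝓘(ℝ, ℝ) (cotangentModel E) γ S t
      ((1 : ℝ →L[ℝ] ℝ).smulRight v)) (ht : γ t ∈ (cotangentChart (E := E) x).source) :
    HasDerivWithinAt (fun s ↦ cotangentChart x (γ s)) (cotangentChartDeriv x (γ t) v) S t := by
  set A : ℝ →L[ℝ] E × (E →L[ℝ] ℝ) :=
    (cotangentChartDeriv x (γ t)).comp ((1 : ℝ →L[ℝ] ℝ).smulRight v)
  have h1 : HasMFDerivWithinAt 𝓘(ℝ, ℝ) 𝓘(ℝ, E × (E →L[ℝ] ℝ)) (cotangentChart x ∘ γ) S t A :=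
    HasMFDerivAt.comp_hasMFDerivWithinAt t (hasMFDerivAt_cotangentChart ht) hγ
  have h2 : HasFDerivWithinAt (cotangentChart x ∘ γ) A S t := h1.hasFDerivWithinAt
  have h3 := h2.hasDerivWithinAt
  have h4 : A 1 = cotangentChartDeriv x (γ t) v := by
    change cotangentChartDeriv x (γ t) ((1 : ℝ) • v) = _
    rw [one_smul]
  rw [h4] at h3
  exact h3

/-- The velocity of a curve in `T*M` defined in a cotangent chart. -/
theorem HasDerivWithinAt.hasMFDerivWithinAt_cotangentChart_symm {x : M} {c : ℝ → E × (E →L[ℝ] ℝ)}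
    {S : Set ℝ} {t : ℝ} {w : E × (E →L[ℝ] ℝ)} (hc : HasDerivWithinAt c w S t)
    (ht : c t ∈ (cotangentChart (E := E) x).target)
    {v : TangentSpace (cotangentModel E) ((cotangentChart (E := E) x).symm (c t))}
    (hv : cotangentChartDeriv x _ v = w) :
    HasMFDerivWithinAt 𝓘(ℝ, ℝ) (cotangentModel E) (fun s ↦ (cotangentChart (E := E) x).symm (c s))
      S t ((1 : ℝ →L[ℝ] ℝ).smulRight v) := by
  have h1 := hc.hasFDerivWithinAt.hasMFDerivWithinAt
  have h2 := HasMFDerivAt.comp_hasMFDerivWithinAt t (hasMFDerivAt_cotangentChart_symm ht) h1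
  have hv' : mfderiv 𝓘(ℝ, E × (E →L[ℝ] ℝ)) (cotangentModel E) (cotangentChart (E := E) x).symm
      (c t) w = v := by
    obtain ⟨ε, hε⟩ := isInvertible_cotangentChartDeriv ((cotangentChart (E := E) x).map_target ht)
    have h3 := (cotangentChartDeriv_mfderiv_symm ht w).trans hv.symm
    rw [← hε] at h3
    exact ε.injective h3
  have h3 : (1 : ℝ →L[ℝ] ℝ).smulRight v = (mfderiv 𝓘(ℝ, E × (E →L[ℝ] ℝ)) (cotangentModel E)
      (cotangentChart (E := E) x).symm (c t)).comp (ContinuousLinearMap.toSpanSingleton ℝ w) := by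
    refine ContinuousLinearMap.ext fun s ↦ ?_
    refine Eq.trans ?_ (map_smul (mfderiv 𝓘(ℝ, E × (E →L[ℝ] ℝ)) (cotangentModel E)
      (cotangentChart (E := E) x).symm (c t)) s w).symm
    exact (congrArg (fun y ↦ s • y) hv').symm
  rw [h3]
  exact h2

/-- A cotangent chart at `0_x` together with a complete flow that describes the Poisson spray
there. -/
structure SprayChart (π : PoissonStructure E M)
    (X : ∀ p : CotangentBundle E M, TangentSpace (cotangentModel E) p) (x : M) where
  /-- The domain of the coordinates on `M`. -/
  U : Set E
  subset : U ⊆ (extChartAt 𝓘(ℝ, E) x).target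
  isLocalSpray : IsLocalSpray U (π.localTensor x) (localSpray X x)
  /-- The complete flow. -/
  model : SprayModel U (π.localTensor x) (localSpray X x) (extChartAt 𝓘(ℝ, E) x x, 0)

theorem IsPoissonSpray.nonempty_sprayChart [FiniteDimensional ℝ E] [T2Space M]
    {π : PoissonStructure E M}
    {X : ∀ p : CotangentBundle E M, TangentSpace (cotangentModel E) p} (hX : IsPoissonSpray π X)
    (x : M) : Nonempty (SprayChart π X x) := by
  obtain ⟨U, hU, hxU, h⟩ := hX.exists_isLocalSpray x
  obtain ⟨S⟩ := h.nonempty_sprayModel hxU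
  exact ⟨⟨U, hU, h, S⟩⟩

namespace SprayChart

variable {π : PoissonStructure E M}
  {X : ∀ p : CotangentBundle E M, TangentSpace (cotangentModel E) p} {x : M}
  (C : SprayChart π X x)

/-- The set of points of `T*M` whose trajectories up to time `1` are described by the chart. -/
def dom : Set (CotangentBundle E M) :=
  (cotangentChart (E := E) x).source ∩ cotangentChart (E := E) x ⁻¹' C.model.R₀

theorem isOpen_dom : IsOpen C.dom :=
  (contMDiffOn_cotangentChart x).continuousOn.isOpen_inter_preimage
    (isOpen_cotangentChart_source x) C.model.isOpen_R₀

theorem zeroCovector_mem_dom : zeroCovector x ∈ C.dom := by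
  refine ⟨mem_extChartAt_source _, ?_⟩
  rw [mem_preimage, cotangentChart_zeroCovector (mem_chart_source E x)]
  exact C.model.mem

theorem Rs_subset : C.model.Rs ⊆ (cotangentChart (E := E) x).target := fun q hq ↦ by
  rw [cotangentChart_target]
  exact ⟨C.subset (C.model.subset hq).1, mem_univ _⟩

theorem field_eq {p : CotangentBundle E M} (hp : p ∈ (cotangentChart (E := E) x).source)
    (hp' : cotangentChart x p ∈ C.model.Rs) :
    C.model.field (cotangentChart x p) = cotangentChartDeriv x p (X p) := by
  rw [C.model.eqOn hp', localSpray_cotangentChart X hp]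

variable {p : CotangentBundle E M}

theorem flow_mem_Rs (hp : p ∈ C.dom) {s : ℝ} (hs : s ∈ Icc (0 : ℝ) 1) :
    C.model.φ s (cotangentChart x p) ∈ C.model.Rs :=
  C.model.mapsTo _ hp.2 s hs

theorem flow_mem_target (hp : p ∈ C.dom) {s : ℝ} (hs : s ∈ Icc (0 : ℝ) 1) :
    C.model.φ s (cotangentChart x p) ∈ (cotangentChart (E := E) x).target :=
  C.Rs_subset (C.flow_mem_Rs hp hs)

/-- The solution in coordinates is an integral curve of the spray. -/
theorem isMIntegralCurveOn (hp : p ∈ C.dom) : IsMIntegralCurveOn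
    (fun s ↦ (cotangentChart x).symm (C.model.φ s (cotangentChart x p))) X (Icc 0 1) := by
  intro t ht
  have h1 := (C.model.isSmoothFlow.hasDerivAt (cotangentChart x p) t).hasDerivWithinAt
    (s := Icc (0 : ℝ) 1)
  refine h1.hasMFDerivWithinAt_cotangentChart_symm (C.flow_mem_target hp ht) ?_
  rw [← C.field_eq ((cotangentChart x).map_target (C.flow_mem_target hp ht)),
    (cotangentChart x).right_inv (C.flow_mem_target hp ht)]
  rw [(cotangentChart x).right_inv (C.flow_mem_target hp ht)]
  exact C.flow_mem_Rs hp ht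

/-- An integral curve that starts in `C.dom` is the one described by the chart. It is not assumed to
stay in the chart: the set of times up to which the two curves agree is closed and open. -/
theorem eqOn_of_isMIntegralCurveOn [T2Space M] (hp : p ∈ C.dom) {s : ℝ} (hs : s ∈ Icc (0 : ℝ) 1)
    {γ : ℝ → CotangentBundle E M} (hγ : IsMIntegralCurveOn γ X (Icc 0 s)) (h0 : γ 0 = p) :
    EqOn γ (fun s ↦ (cotangentChart x).symm (C.model.φ s (cotangentChart x p))) (Icc 0 s) := by
  have hT2 : T2Space (CotangentBundle E M) := cotangentBundle_t2Space
  set ρ : ℝ → CotangentBundle E M :=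
    fun s ↦ (cotangentChart x).symm (C.model.φ s (cotangentChart x p)) with hρ
  have hγc : ContinuousOn γ (Icc 0 s) := fun t ht ↦ (hγ t ht).continuousWithinAt
  have hρc : ContinuousOn ρ (Icc 0 s) := fun t ht ↦
    (C.isMIntegralCurveOn hp t ⟨ht.1, ht.2.trans hs.2⟩).continuousWithinAt.mono
      (Icc_subset_Icc_right hs.2)
  refine IsClosed.Icc_subset_of_forall_mem_nhdsWithin (s := {t | γ t = ρ t}) ?_ ?_ ?_
  · have h1 := isClosed_Icc.isClosed_eq hγc hρc
    rwa [inter_comm]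
  · change γ 0 = ρ 0
    rw [h0, hρ]
    simp only [C.model.isSmoothFlow.zero]
    exact ((cotangentChart x).left_inv hp.1).symm
  · rintro t ⟨hteq, ht⟩
    have ht01 : t ∈ Icc (0 : ℝ) 1 := ⟨ht.1, ht.2.le.trans hs.2⟩
    set O := (cotangentChart (E := E) x).source ∩ cotangentChart (E := E) x ⁻¹' C.model.Rs with hO
    have hOopen : IsOpen O := (contMDiffOn_cotangentChart x).continuousOn.isOpen_inter_preimage
      (isOpen_cotangentChart_source x) C.model.isOpen_Rs
    have htO : γ t ∈ O := by
      rw [mem_ofPred.1 hteq]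
      refine ⟨(cotangentChart x).map_target (C.flow_mem_target hp ht01), ?_⟩
      rw [mem_preimage, (cotangentChart x).right_inv (C.flow_mem_target hp ht01)]
      exact C.flow_mem_Rs hp ht01
    have hev : ∀ᶠ r in 𝓝[≥] t, γ r ∈ O := by
      have h1 := (hγc t (Ico_subset_Icc_self ht)).preimage_mem_nhdsWithin (hOopen.mem_nhds htO)
      exact nhdsWithin_le_of_mem (Filter.mem_of_superset (Icc_mem_nhdsGE ht.2)
        (Icc_subset_Icc_left ht.1)) h1
    obtain ⟨b, hb, hbO⟩ := mem_nhdsGE_iff_exists_Icc_subset.1 (Filter.inter_mem hev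
      (Icc_mem_nhdsGE ht.2))
    have htb : t < b := hb
    have hbs : b ≤ s := (hbO (right_mem_Icc.2 htb.le)).2.2
    have hsub : Icc t b ⊆ Icc 0 s := Icc_subset_Icc ht.1 hbs
    have hd : ∀ r ∈ Icc t b, HasDerivWithinAt (fun r ↦ cotangentChart x (γ r))
        (C.model.field (cotangentChart x (γ r))) (Icc 0 s) r := fun r hr ↦ by
      have hrO := (hbO hr).1
      rw [C.field_eq hrO.1 hrO.2]
      exact (hγ r (hsub hr)).hasDerivWithinAt_cotangentChart hrO.1
    have heq := ODE_solution_unique_of_mem_Icc_right (v := fun _ ↦ C.model.field)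
      (s := fun _ ↦ univ) (a := t) (b := b) (f := fun r ↦ cotangentChart x (γ r))
      (g := fun r ↦ C.model.φ r (cotangentChart x p))
      (fun _ _ ↦ C.model.lipschitz.lipschitzOnWith)
      (fun r hr ↦ (hd r hr).continuousWithinAt.mono hsub)
      (fun r hr ↦ (hd r (Ico_subset_Icc_self hr)).mono_of_mem_nhdsWithin
        (Filter.mem_of_superset (Icc_mem_nhdsGE hr.2)
          (Icc_subset_Icc (ht.1.trans hr.1) hbs))) (fun _ _ ↦ mem_univ _)
      (C.model.isSmoothFlow.continuous_apply_left _).continuousOn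
      (fun r _ ↦ (C.model.isSmoothFlow.hasDerivAt _ r).hasDerivWithinAt) (fun _ _ ↦ mem_univ _)
      (by
        simp only [mem_ofPred.1 hteq, hρ]
        exact (cotangentChart x).right_inv (C.flow_mem_target hp ht01))
    refine Filter.mem_of_superset (Ioc_mem_nhdsGT htb) fun r hr ↦ ?_
    have h1 := heq (Ioc_subset_Icc_self hr)
    have h2 := (hbO (Ioc_subset_Icc_self hr)).1.1
    rw [mem_ofPred, hρ, ← (cotangentChart x).left_inv h2]
    exact congrArg _ h1

variable [T2Space M]

theorem flowsTo_iff (hp : p ∈ C.dom) {s : ℝ} (hs : s ∈ Icc (0 : ℝ) 1) {q : CotangentBundle E M} :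
    FlowsTo X s p q ↔ q = (cotangentChart x).symm (C.model.φ s (cotangentChart x p)) := by
  constructor
  · rintro ⟨γ, hγ, h0, rfl⟩
    rw [uIcc_of_le hs.1] at hγ
    exact C.eqOn_of_isMIntegralCurveOn hp hs hγ h0 (right_mem_Icc.2 hs.1)
  · rintro rfl
    refine ⟨fun s ↦ (cotangentChart x).symm (C.model.φ s (cotangentChart x p)), ?_, ?_, rfl⟩
    · rw [uIcc_of_le hs.1]
      exact (C.isMIntegralCurveOn hp).mono (Icc_subset_Icc_right hs.2)
    · simp only [C.model.isSmoothFlow.zero]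
      exact (cotangentChart x).left_inv hp.1

theorem dom_subset_flowDomain : C.dom ⊆ flowDomain X 1 := fun _ hp ↦
  ⟨_, (C.flowsTo_iff hp ⟨zero_le_one, le_rfl⟩).2 rfl⟩

theorem flow_eq (hp : p ∈ C.dom) {s : ℝ} (hs : s ∈ Icc (0 : ℝ) 1) :
    flow X s p = (cotangentChart x).symm (C.model.φ s (cotangentChart x p)) := by
  have h : ∃ q, FlowsTo X s p q := ⟨_, (C.flowsTo_iff hp hs).2 rfl⟩
  rw [flow, dif_pos h]
  exact (C.flowsTo_iff hp hs).1 h.choose_spec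

theorem flow_mem_source (hp : p ∈ C.dom) {s : ℝ} (hs : s ∈ Icc (0 : ℝ) 1) :
    flow X s p ∈ (cotangentChart (E := E) x).source := by
  rw [C.flow_eq hp hs]
  exact (cotangentChart x).map_target (C.flow_mem_target hp hs)

theorem cotangentChart_flow (hp : p ∈ C.dom) {s : ℝ} (hs : s ∈ Icc (0 : ℝ) 1) :
    cotangentChart x (flow X s p) = C.model.φ s (cotangentChart x p) := by
  rw [C.flow_eq hp hs, (cotangentChart x).right_inv (C.flow_mem_target hp hs)]

theorem contMDiffOn_flow :
    ContMDiffOn (𝓘(ℝ, ℝ).prod (cotangentModel E)) (cotangentModel E) ∞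
      (fun q : ℝ × CotangentBundle E M ↦ flow X q.1 q.2) (Icc 0 1 ×ˢ C.dom) := by
  have h1 : ContMDiffOn (𝓘(ℝ, ℝ).prod (cotangentModel E)) 𝓘(ℝ, ℝ × (E × (E →L[ℝ] ℝ))) ∞
      (fun q : ℝ × CotangentBundle E M ↦ (q.1, cotangentChart x q.2)) (Icc 0 1 ×ˢ C.dom) := by
    refine contMDiffOn_fst.prodMk_space ?_
    exact (contMDiffOn_cotangentChart x).comp contMDiffOn_snd fun q hq ↦ hq.2.1
  have h2 := C.model.isSmoothFlow.contDiff.contMDiff.comp_contMDiffOn h1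
  refine ((contMDiffOn_cotangentChart_symm x).comp h2
    fun q hq ↦ C.flow_mem_target hq.2 hq.1).congr fun q hq ↦ ?_
  exact C.flow_eq hq.2 hq.1

theorem contMDiffAt_flow (hp : p ∈ C.dom) {s : ℝ} (hs : s ∈ Icc (0 : ℝ) 1) :
    ContMDiffAt (cotangentModel E) (cotangentModel E) ∞ (flow X s) p := by
  have h1 : ContMDiffOn (cotangentModel E) (cotangentModel E) ∞ (flow X s) C.dom :=
    C.contMDiffOn_flow.comp (contMDiffOn_const.prodMk contMDiffOn_id) fun q hq ↦ ⟨hs, hq⟩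
  exact h1.contMDiffAt (C.isOpen_dom.mem_nhds hp)

theorem cotangentChartDeriv_mfderiv_flow (hp : p ∈ C.dom) {s : ℝ} (hs : s ∈ Icc (0 : ℝ) 1)
    (u : TangentSpace (cotangentModel E) p) :
    cotangentChartDeriv x (flow X s p)
      (mfderiv (cotangentModel E) (cotangentModel E) (flow X s) p u) =
      fderiv ℝ (C.model.φ s) (cotangentChart x p) (cotangentChartDeriv x p u) :=
  cotangentChartDeriv_mfderiv hp.1 (C.flow_mem_source hp hs)
    ((C.contMDiffAt_flow hp hs).mdifferentiableAt (by simp))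
    (C.model.isSmoothFlow.hasFDerivAt_apply s _).differentiableAt
    (by filter_upwards [C.isOpen_dom.mem_nhds hp] with q hq using C.cotangentChart_flow hq hs) u

theorem flow_zeroCovector {y : M} (hy : zeroCovector y ∈ C.dom) {s : ℝ}
    (hs : s ∈ Icc (0 : ℝ) 1) : flow X s (zeroCovector y) = zeroCovector y := by
  have hys : y ∈ (chartAt E x).source := mem_cotangentChart_source.1 hy.1
  have h1 : cotangentChart (E := E) x (zeroCovector y) = (extChartAt 𝓘(ℝ, E) x y, 0) :=
    cotangentChart_zeroCovector hys
  have hRs : (extChartAt 𝓘(ℝ, E) x y, (0 : E →L[ℝ] ℝ)) ∈ C.model.Rs :=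
    C.model.R₀_subset (h1 ▸ hy.2)
  rw [C.flow_eq hy hs, h1, C.model.apply_zero_section C.isLocalSpray hRs, ← h1]
  exact (cotangentChart x).left_inv hy.1

/-- The coordinate expression of the averaged form. -/
theorem averagedForm_eq (hp : p ∈ C.dom) (u v : TangentSpace (cotangentModel E) p) :
    averagedForm X p u v = oneFormDeriv (averagedLiouville C.model.φ) (cotangentChart x p)
      (cotangentChartDeriv x p u) (cotangentChartDeriv x p v) := by
  rw [C.model.isSmoothFlow.oneFormDeriv_averagedLiouville, averagedForm]
  refine intervalIntegral.integral_congr fun s hs ↦ ?_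
  rw [uIcc_of_le zero_le_one] at hs
  rw [← canonicalFormModel_cotangentChartDeriv (C.flow_mem_source hp hs),
    C.cotangentChartDeriv_mfderiv_flow hp hs, C.cotangentChartDeriv_mfderiv_flow hp hs]

end SprayChart

/-- The one-form `∫₀¹ (Φ^s)^* λ ds`, where `λ` is the canonical one-form of `T*M`. -/
noncomputable def averagedOneForm
    (X : ∀ p : CotangentBundle E M, TangentSpace (cotangentModel E) p) (p : CotangentBundle E M)
    (u : TangentSpace (cotangentModel E) p) : ℝ :=
  ∫ s in (0 : ℝ)..1, (flow X s p).2 (cotangentProjDeriv (flow X s p)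
    (mfderiv (cotangentModel E) (cotangentModel E) (flow X s) p u))

/-- The coordinate expression of the averaged one-form. -/
theorem SprayChart.averagedOneForm_eq [T2Space M] {π : PoissonStructure E M}
    {X : ∀ p : CotangentBundle E M, TangentSpace (cotangentModel E) p} {x : M}
    (C : SprayChart π X x) {p : CotangentBundle E M} (hp : p ∈ C.dom)
    (u : TangentSpace (cotangentModel E) p) :
    averagedOneForm X p u =
      averagedLiouville C.model.φ (cotangentChart x p) (cotangentChartDeriv x p u) := by
  have hc : Continuous fun s ↦ (liouvilleForm E (C.model.φ s (cotangentChart x p))).comp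
      (fderiv ℝ (C.model.φ s) (cotangentChart x p)) :=
    C.model.isSmoothFlow.contDiff_pullback_liouvilleForm.continuous.comp (Continuous.prodMk_left _)
  rw [averagedLiouville, ContinuousLinearMap.intervalIntegral_apply (hc.intervalIntegrable 0 1),
    averagedOneForm]
  refine intervalIntegral.integral_congr fun s hs ↦ ?_
  rw [uIcc_of_le zero_le_one] at hs
  rw [← liouvilleForm_cotangentChart (C.flow_mem_source hp hs),
    C.cotangentChartDeriv_mfderiv_flow hp hs, C.cotangentChart_flow hp hs]
  rfl

end SprayChart

/-! ### Moser curves on the cotangent bundle -/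

section MoserChart

set_option maxSynthPendingDepth 3

variable {E : Type*} [NormedAddCommGroup E] [NormedSpace ℝ E]
  {M : Type*} [TopologicalSpace M] [ChartedSpace E M] [IsManifold 𝓘(ℝ, E) ∞ M]

/-- The curves `γ` on `[0, 1]` produced by Moser's argument, described without coordinates:
`((1 - t) ω + t Ω)(γ', ·) = λ - Λ`, where `λ` is the canonical one-form, `Λ` the averaged one-form
and `Ω` the averaged form. -/
def IsMoserCurve (X : ∀ p : CotangentBundle E M, TangentSpace (cotangentModel E) p)
    (γ : ℝ → CotangentBundle E M) : Prop :=
  ∀ t ∈ Icc (0 : ℝ) 1, ∃ v : TangentSpace (cotangentModel E) (γ t),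
    HasMFDerivWithinAt 𝓘(ℝ, ℝ) (cotangentModel E) γ (Icc 0 1) t ((1 : ℝ →L[ℝ] ℝ).smulRight v) ∧
    ∀ w, (1 - t) * canonicalForm (γ t) v w + t * averagedForm X (γ t) v w =
      (γ t).2 (cotangentProjDeriv (γ t) w) - averagedOneForm X (γ t) w

/-- A chart that describes both the Poisson spray and the Moser curves near `0_x`. -/
structure MoserChart (π : PoissonStructure E M)
    (X : ∀ p : CotangentBundle E M, TangentSpace (cotangentModel E) p) (x : M) extends
    SprayChart π X x where
  /-- The solution of Moser's equation in the chart. -/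
  moser : MoserData (liouvilleForm E) (averagedLiouville toSprayChart.model.φ)
    (extChartAt 𝓘(ℝ, E) x x, 0)

theorem IsPoissonSpray.nonempty_moserChart [FiniteDimensional ℝ E] [T2Space M]
    {π : PoissonStructure E M}
    {X : ∀ p : CotangentBundle E M, TangentSpace (cotangentModel E) p} (hX : IsPoissonSpray π X)
    (x : M) : Nonempty (MoserChart π X x) := by
  obtain ⟨C⟩ := hX.nonempty_sprayChart x
  obtain ⟨D⟩ := nonempty_moserData C.model.isSmoothFlow.contDiff_averagedLiouville
    (z := (extChartAt 𝓘(ℝ, E) x x, 0)) (L := liouvilleForm E)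
    fun t _ ↦ C.model.injective_moserForm C.isLocalSpray (C.model.R₀_subset C.model.mem) t
  exact ⟨⟨C, D⟩⟩

namespace MoserChart

variable {π : PoissonStructure E M}
  {X : ∀ p : CotangentBundle E M, TangentSpace (cotangentModel E) p} {x : M}
  (K : MoserChart π X x)

/-- The part of `T*M` on which the Moser curves are described by the chart. -/
def region : Set (CotangentBundle E M) :=
  K.dom ∩ cotangentChart (E := E) x ⁻¹' K.moser.R

/-- The Moser curve starting at `p`, defined in the chart. -/
noncomputable def curve (p : CotangentBundle E M) (t : ℝ) : CotangentBundle E M :=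
  (cotangentChart x).symm (K.moser.κ t (cotangentChart x p))

/-- The end point of the Moser curve starting at `p`. -/
noncomputable def endpoint (p : CotangentBundle E M) : CotangentBundle E M := K.curve p 1

theorem isOpen_region : IsOpen K.region :=
  ((contMDiffOn_cotangentChart x).continuousOn.mono inter_subset_left).isOpen_inter_preimage
    K.isOpen_dom K.moser.isOpen

theorem liouvilleForm_eq_averagedLiouville :
    liouvilleForm E (extChartAt 𝓘(ℝ, E) x x, 0) =
      averagedLiouville K.model.φ (extChartAt 𝓘(ℝ, E) x x, 0) := by
  rw [K.model.averagedLiouville_zero_section K.isLocalSpray (K.model.R₀_subset K.model.mem)]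
  ext <;> simp

theorem zeroCovector_mem_region : zeroCovector x ∈ K.region := by
  refine ⟨K.zeroCovector_mem_dom, ?_⟩
  rw [mem_preimage, cotangentChart_zeroCovector (mem_chart_source E x)]
  exact K.moser.mem

theorem endpoint_zeroCovector {y : M} (hy : zeroCovector y ∈ K.region) :
    K.endpoint (zeroCovector y) = zeroCovector y := by
  have hys : y ∈ (chartAt E x).source := mem_cotangentChart_source.1 hy.1.1
  have h1 : cotangentChart (E := E) x (zeroCovector y) = (extChartAt 𝓘(ℝ, E) x y, 0) :=
    cotangentChart_zeroCovector hys
  have hR : (extChartAt 𝓘(ℝ, E) x y, (0 : E →L[ℝ] ℝ)) ∈ K.moser.R := h1 ▸ hy.2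
  have hRs : (extChartAt 𝓘(ℝ, E) x y, (0 : E →L[ℝ] ℝ)) ∈ K.model.Rs :=
    K.model.R₀_subset (h1 ▸ hy.1.2)
  rw [endpoint, curve, h1, K.moser.apply_eq_self hR ?_ ⟨zero_le_one, le_rfl⟩, ← h1]
  · exact (cotangentChart x).left_inv hy.1.1
  · rw [K.model.averagedLiouville_zero_section K.isLocalSpray hRs]
    ext <;> simp

/-- `C` is an open set of initial points of Moser curves that are described by the chart and
remain in `B`. -/
structure IsTube (B C : Set (CotangentBundle E M)) : Prop where
  isOpen : IsOpen C
  subset : C ⊆ (cotangentChart (E := E) x).source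
  mem_target : ∀ p ∈ C, ∀ t ∈ Icc (0 : ℝ) 1,
    K.moser.κ t (cotangentChart x p) ∈ (cotangentChart (E := E) x).target
  mem_region : ∀ p ∈ C, ∀ t ∈ Icc (0 : ℝ) 1, K.curve p t ∈ K.region
  mem : ∀ p ∈ C, ∀ t ∈ Icc (0 : ℝ) 1, K.curve p t ∈ B

theorem exists_isTube {B : Set (CotangentBundle E M)} (hB : B ∈ 𝓝 (zeroCovector x)) :
    ∃ C, zeroCovector x ∈ C ∧ K.IsTube B C := by
  have hz := cotangentChart_zeroCovector (E := E) (mem_chart_source E x)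
  have hzs : zeroCovector x ∈ (cotangentChart (E := E) x).source := mem_extChartAt_source _
  have hzt : (extChartAt 𝓘(ℝ, E) x x, 0) ∈ (cotangentChart (E := E) x).target := by
    rw [← hz]; exact (cotangentChart x).map_source hzs
  have h1 : (cotangentChart (E := E) x).target ∩ (cotangentChart (E := E) x).symm ⁻¹'
      (B ∩ K.region) ∈ 𝓝 ((extChartAt 𝓘(ℝ, E) x x, 0) : E × (E →L[ℝ] ℝ)) := by
    have h2 := (isOpen_cotangentChart_target (E := E) x).mem_nhds hzt
    refine Filter.inter_mem h2 (((contMDiffOn_cotangentChart_symm x).continuousOn.continuousAt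
      h2).preimage_mem_nhds ?_)
    rw [← hz, (cotangentChart x).left_inv hzs]
    exact Filter.inter_mem hB (K.isOpen_region.mem_nhds K.zeroCovector_mem_region)
  have h3 := K.moser.eventually_forall_mem K.liouvilleForm_eq_averagedLiouville h1
  obtain ⟨V, hV, hVopen, hzV⟩ := eventually_nhds_iff.1 h3
  refine ⟨(cotangentChart (E := E) x).source ∩ cotangentChart (E := E) x ⁻¹' V,
    ⟨hzs, by rwa [mem_preimage, hz]⟩, ?_, inter_subset_left, ?_, ?_, ?_⟩
  · exact (contMDiffOn_cotangentChart x).continuousOn.isOpen_inter_preimage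
      (isOpen_cotangentChart_source x) hVopen
  · exact fun p hp t ht ↦ (hV _ hp.2 t ht).1
  · exact fun p hp t ht ↦ (hV _ hp.2 t ht).2.2
  · exact fun p hp t ht ↦ (hV _ hp.2 t ht).2.1

theorem curve_zero {p : CotangentBundle E M} (hp : p ∈ (cotangentChart (E := E) x).source) :
    K.curve p 0 = p := by
  rw [curve, K.moser.zero, (cotangentChart x).left_inv hp]

theorem IsTube.cotangentChart_endpoint {K : MoserChart π X x} {B C : Set (CotangentBundle E M)}
    (h : K.IsTube B C) {p : CotangentBundle E M} (hp : p ∈ C) :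
    cotangentChart x (K.endpoint p) = K.moser.κ 1 (cotangentChart x p) :=
  (cotangentChart x).right_inv (h.mem_target p hp 1 ⟨zero_le_one, le_rfl⟩)

theorem IsTube.subset_region {K : MoserChart π X x} {B C : Set (CotangentBundle E M)}
    (h : K.IsTube B C) : C ⊆ K.region := fun p hp ↦ by
  have h1 := h.mem_region p hp 0 ⟨le_rfl, zero_le_one⟩
  rwa [K.curve_zero (h.subset hp)] at h1

variable [T2Space M]

theorem moserForm_cotangentChart {p : CotangentBundle E M} (hp : p ∈ K.region) (t : ℝ)
    (v w : TangentSpace (cotangentModel E) p) :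
    moserForm (liouvilleForm E) (averagedLiouville K.model.φ) t (cotangentChart x p)
      (cotangentChartDeriv x p v) (cotangentChartDeriv x p w) =
      (1 - t) * canonicalForm p v w + t * averagedForm X p v w := by
  rw [moserForm_apply, K.averagedForm_eq hp.1, ← canonicalFormModel_cotangentChartDeriv hp.1.1]
  rfl

/-- The equation that characterises the velocity of a Moser curve, in coordinates. -/
theorem velocity_iff {p : CotangentBundle E M} (hp : p ∈ K.region) {t : ℝ}
    (ht : t ∈ Icc (0 : ℝ) 1) (v : TangentSpace (cotangentModel E) p) :
    (∀ w, (1 - t) * canonicalForm p v w + t * averagedForm X p v w =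
      p.2 (cotangentProjDeriv p w) - averagedOneForm X p w) ↔
      cotangentChartDeriv x p v = K.moser.Y t (cotangentChart x p) := by
  rw [← K.moser.eq_iff t ht _ hp.2]
  constructor
  · intro h w
    obtain ⟨ε, hε⟩ := isInvertible_cotangentChartDeriv hp.1.1
    have hw : cotangentChartDeriv x p (ε.symm w) = w := by
      rw [← hε]
      exact ε.apply_symm_apply w
    have h1 := h (ε.symm w)
    rw [← K.moserForm_cotangentChart hp, ← liouvilleForm_cotangentChart hp.1.1,
      K.averagedOneForm_eq hp.1, hw] at h1
    exact h1
  · intro h w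
    rw [← K.moserForm_cotangentChart hp, ← liouvilleForm_cotangentChart hp.1.1,
      K.averagedOneForm_eq hp.1]
    exact h _

theorem _root_.IsMoserCurve.hasDerivWithinAt {γ : ℝ → CotangentBundle E M}
    (hγ : IsMoserCurve X γ) (hγK : ∀ t ∈ Icc (0 : ℝ) 1, γ t ∈ K.region) :
    ∀ t ∈ Icc (0 : ℝ) 1, HasDerivWithinAt (fun s ↦ cotangentChart x (γ s))
      (K.moser.Y t (cotangentChart x (γ t))) (Icc 0 1) t := by
  intro t ht
  obtain ⟨v, hv, hv'⟩ := hγ t ht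
  rw [← (K.velocity_iff (hγK t ht) ht v).1 hv']
  exact hv.hasDerivWithinAt_cotangentChart (hγK t ht).1.1

/-- Moser curves in the region of a chart are determined by one of their end points. -/
theorem eqOn_of_isMoserCurve {γ γ' : ℝ → CotangentBundle E M} (hγ : IsMoserCurve X γ)
    (hγ' : IsMoserCurve X γ') (hγK : ∀ t ∈ Icc (0 : ℝ) 1, γ t ∈ K.region)
    (hγK' : ∀ t ∈ Icc (0 : ℝ) 1, γ' t ∈ K.region) (h : γ 0 = γ' 0 ∨ γ 1 = γ' 1) :
    EqOn γ γ' (Icc 0 1) := by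
  have h1 := eqOn_Icc_of_hasDerivWithinAt (fun t _ ↦ K.moser.lipschitz t)
    (hγ.hasDerivWithinAt K hγK) (hγ'.hasDerivWithinAt K hγK')
    (h.imp (congrArg (cotangentChart x)) (congrArg (cotangentChart x)))
  exact fun t ht ↦ (cotangentChart x).injOn (hγK t ht).1.1 (hγK' t ht).1.1 (h1 ht)

variable {K} {B C : Set (CotangentBundle E M)}

theorem IsTube.isMoserCurve (h : K.IsTube B C) {p : CotangentBundle E M} (hp : p ∈ C) :
    IsMoserCurve X (K.curve p) := by
  intro t ht
  have htar := h.mem_target p hp t ht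
  have hreg := h.mem_region p hp t ht
  obtain ⟨ε, hε⟩ := isInvertible_cotangentChartDeriv hreg.1.1
  have hv : cotangentChartDeriv x (K.curve p t)
      (ε.symm (K.moser.Y t (K.moser.κ t (cotangentChart x p)))) =
      K.moser.Y t (K.moser.κ t (cotangentChart x p)) := by
    rw [← hε]
    exact ε.apply_symm_apply _
  refine ⟨ε.symm (K.moser.Y t (K.moser.κ t (cotangentChart x p))), ?_, ?_⟩
  · exact (K.moser.hasDerivAt (cotangentChart x p)
      t).hasDerivWithinAt.hasMFDerivWithinAt_cotangentChart_symm htar hv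
  · refine (K.velocity_iff hreg ht _).2 (hv.trans ?_)
    rw [curve, (cotangentChart x).right_inv htar]

end MoserChart

end MoserChart

/-! ### The time-one map of a Moser chart -/

section LocalBirealisation

set_option maxSynthPendingDepth 3

variable {E : Type*} [NormedAddCommGroup E] [NormedSpace ℝ E]
  {M : Type*} [TopologicalSpace M] [ChartedSpace E M] [IsManifold 𝓘(ℝ, E) ∞ M]

namespace MoserChart

variable {π : PoissonStructure E M}
  {X : ∀ p : CotangentBundle E M, TangentSpace (cotangentModel E) p} {x : M}
  {K : MoserChart π X x} {B C : Set (CotangentBundle E M)}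

theorem IsTube.endpoint_mem_region (h : K.IsTube B C) {p : CotangentBundle E M} (hp : p ∈ C) :
    K.endpoint p ∈ K.region :=
  h.mem_region p hp 1 ⟨zero_le_one, le_rfl⟩

theorem IsTube.contMDiffOn_endpoint (h : K.IsTube B C) :
    ContMDiffOn (cotangentModel E) (cotangentModel E) ∞ K.endpoint C :=
  (contMDiffOn_cotangentChart_symm x).comp
    ((K.moser.contDiff_apply 1).contMDiff.comp_contMDiffOn
      ((contMDiffOn_cotangentChart x).mono h.subset))
    fun p hp ↦ h.mem_target p hp 1 ⟨zero_le_one, le_rfl⟩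

/-- The inverse of the end point map, defined in the chart. -/
noncomputable def endpointInv (K : MoserChart π X x) (q : CotangentBundle E M) :
    CotangentBundle E M :=
  (cotangentChart x).symm (K.moser.inv (cotangentChart x q))

theorem IsTube.endpointInv_endpoint (h : K.IsTube B C) {p : CotangentBundle E M} (hp : p ∈ C) :
    K.endpointInv (K.endpoint p) = p := by
  rw [endpointInv, h.cotangentChart_endpoint hp, K.moser.inv_apply,
    (cotangentChart x).left_inv (h.subset hp)]

theorem IsTube.image_endpoint_eq (h : K.IsTube B C) : K.endpoint '' C =
    (cotangentChart (E := E) x).source ∩ cotangentChart (E := E) x ⁻¹'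
      (K.moser.inv ⁻¹' ((cotangentChart (E := E) x).target ∩
        (cotangentChart (E := E) x).symm ⁻¹' C)) := by
  ext q
  constructor
  · rintro ⟨p, hp, rfl⟩
    refine ⟨(h.endpoint_mem_region hp).1.1, ?_⟩
    rw [mem_preimage, mem_preimage, h.cotangentChart_endpoint hp, K.moser.inv_apply]
    refine ⟨(cotangentChart x).map_source (h.subset hp), ?_⟩
    rwa [mem_preimage, (cotangentChart x).left_inv (h.subset hp)]
  · rintro ⟨hq, hq', hq''⟩
    refine ⟨_, hq'', ?_⟩
    rw [endpoint, curve, (cotangentChart x).right_inv hq', K.moser.apply_inv,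
      (cotangentChart x).left_inv hq]

theorem IsTube.isOpen_image_endpoint (h : K.IsTube B C) : IsOpen (K.endpoint '' C) := by
  rw [h.image_endpoint_eq]
  refine (contMDiffOn_cotangentChart x).continuousOn.isOpen_inter_preimage
    (isOpen_cotangentChart_source x) ?_
  exact ((contMDiffOn_cotangentChart_symm x).continuousOn.isOpen_inter_preimage
    (isOpen_cotangentChart_target x) h.isOpen).preimage K.moser.contDiff_inv.continuous

theorem IsTube.contMDiffOn_endpointInv (h : K.IsTube B C) :
    ContMDiffOn (cotangentModel E) (cotangentModel E) ∞ K.endpointInv (K.endpoint '' C) := by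
  rw [h.image_endpoint_eq]
  exact (contMDiffOn_cotangentChart_symm x).comp
    (K.moser.contDiff_inv.contMDiff.comp_contMDiffOn
      ((contMDiffOn_cotangentChart x).mono inter_subset_left)) fun q hq ↦ hq.2.1

theorem oneFormDeriv_nondegenerate (K : MoserChart π X x) {q : CotangentBundle E M}
    (hq : q ∈ K.region) :
    ∀ v, (∀ w, oneFormDeriv (averagedLiouville K.model.φ) (cotangentChart x q) v w = 0) → v = 0 :=
  fun _ hv ↦ K.moser.injective_oneFormDeriv hq.2 hv

/-- The coordinate expression of the derivative of `τ ∘ ψ`. -/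
theorem chartDeriv_mfderiv_source (K : MoserChart π X x)
    {ψ : CotangentBundle E M → CotangentBundle E M}
    {p : CotangentBundle E M} (hp : ψ p ∈ K.region)
    (hψ : MDifferentiableAt (cotangentModel E) (cotangentModel E) ψ p)
    (u : TangentSpace (cotangentModel E) p) :
    chartDeriv x (ψ p).1 (mfderiv (cotangentModel E) 𝓘(ℝ, E) (cotangentProj ∘ ψ) p u) =
      (cotangentChartDeriv x (ψ p) (mfderiv (cotangentModel E) (cotangentModel E) ψ p u)).1 := by
  rw [cotangentChartDeriv_fst hp.1.1, mfderiv_comp p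
    (hasMFDerivAt_cotangentProj (ψ p)).mdifferentiableAt hψ]
  rfl

variable [T2Space M]

/-- The end point map pulls the averaged form back to the canonical form. -/
theorem IsTube.canonicalForm_eq (h : K.IsTube B C) {p : CotangentBundle E M} (hp : p ∈ C)
    (u v : TangentSpace (cotangentModel E) p) :
    canonicalForm p u v = averagedForm X (K.endpoint p)
      (mfderiv (cotangentModel E) (cotangentModel E) K.endpoint p u)
      (mfderiv (cotangentModel E) (cotangentModel E) K.endpoint p v) := by
  have hd (w : TangentSpace (cotangentModel E) p) := cotangentChartDeriv_mfderiv (g := K.moser.κ 1)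
    (h.subset hp) (h.endpoint_mem_region hp).1.1
    ((h.contMDiffOn_endpoint.contMDiffAt (h.isOpen.mem_nhds hp)).mdifferentiableAt (by simp))
    ((K.moser.contDiff_apply 1).differentiable (by simp) _)
    (by filter_upwards [h.isOpen.mem_nhds hp] with q hq using h.cotangentChart_endpoint hq) w
  rw [K.averagedForm_eq (h.endpoint_mem_region hp).1, hd, hd, h.cotangentChart_endpoint hp,
    K.moser.pullback, ← canonicalFormModel_cotangentChartDeriv (h.subset hp)]
  · rfl
  · intro t ht
    have h1 := (h.mem_region p hp t ht).2
    rwa [mem_preimage, curve, (cotangentChart x).right_inv (h.mem_target p hp t ht)] at h1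

/-- The coordinate expression of the derivative of `τ ∘ Φ¹ ∘ ψ`. -/
theorem chartDeriv_mfderiv_target (K : MoserChart π X x)
    {ψ : CotangentBundle E M → CotangentBundle E M}
    {p : CotangentBundle E M} (hp : ψ p ∈ K.region)
    (hψ : MDifferentiableAt (cotangentModel E) (cotangentModel E) ψ p)
    (u : TangentSpace (cotangentModel E) p) :
    chartDeriv x (flow X 1 (ψ p)).1
      (mfderiv (cotangentModel E) 𝓘(ℝ, E) (cotangentProj ∘ flow X 1 ∘ ψ) p u) =
      (fderiv ℝ (K.model.φ 1) (cotangentChart x (ψ p)) (cotangentChartDeriv x (ψ p)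
        (mfderiv (cotangentModel E) (cotangentModel E) ψ p u))).1 := by
  have h1 : (1 : ℝ) ∈ Icc (0 : ℝ) 1 := ⟨zero_le_one, le_rfl⟩
  have hflow : MDifferentiableAt (cotangentModel E) (cotangentModel E) (flow X 1) (ψ p) :=
    (K.contMDiffAt_flow hp.1 h1).mdifferentiableAt (by simp)
  rw [← K.cotangentChartDeriv_mfderiv_flow hp.1 h1,
    cotangentChartDeriv_fst (K.flow_mem_source hp.1 h1),
    mfderiv_comp p (hasMFDerivAt_cotangentProj (flow X 1 (ψ p))).mdifferentiableAt
      (hflow.comp p hψ), mfderiv_comp p hflow hψ]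
  rfl

end MoserChart

/-- A criterion for the (anti-)Poisson property of `a` at a point: `T` and `D` are invertible or
surjective linear coordinates at `a p` and `p`, in which `ℓ` represents the derivative of `a` and
`Ω` the canonical form, and the hypothesis `h` says that `ℓ` maps the Hamiltonian vectors of
functions of `ℓ` to those prescribed by `π`, up to the factor `c`. -/
theorem canonicalBracket_comp_eq [FiniteDimensional ℝ E] {π : PoissonStructure E M}
    {p : CotangentBundle E M} {a : CotangentBundle E M → M} {F : Type*} [NormedAddCommGroup F]
    [NormedSpace ℝ F] (ha : MDifferentiableAt (cotangentModel E) 𝓘(ℝ, E) a p)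
    {T : TangentSpace 𝓘(ℝ, E) (a p) →L[ℝ] E} (hT : T.IsInvertible)
    {D : TangentSpace (cotangentModel E) p → F} (hD : Function.Surjective D) {ℓ : F → E}
    (hℓ : ∀ u, T (mfderiv (cotangentModel E) 𝓘(ℝ, E) a p u) = ℓ (D u))
    {Ω : F → F → ℝ} (hΩ : ∀ u v, canonicalForm p u v = Ω (D u) (D v)) {c : ℝ}
    (h : ∀ (w : F) (η : E →L[ℝ] ℝ), (∀ v, Ω v w = η (ℓ v)) →
      ℓ w = c • T (π.sharp (a p) (η.comp T)))
    {f g : M → ℝ} (hf : MDifferentiableAt 𝓘(ℝ, E) 𝓘(ℝ, ℝ) f (a p))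
    (hg : MDifferentiableAt 𝓘(ℝ, E) 𝓘(ℝ, ℝ) g (a p)) :
    canonicalBracket (f ∘ a) (g ∘ a) p = c * π.bracket f g (a p) := by
  obtain ⟨ε, rfl⟩ := hT
  set H := hamiltonianVector (g ∘ a) p with hH
  set η : E →L[ℝ] ℝ := (mvfderiv 𝓘(ℝ, E) g (a p)).comp (ε.symm : E →L[ℝ] _) with hη
  have h1 : ℓ (D H) = c • ε (π.sharp (a p) (mvfderiv 𝓘(ℝ, E) g (a p))) := by
    have h2 : η.comp (ε : TangentSpace 𝓘(ℝ, E) (a p) →L[ℝ] E) = mvfderiv 𝓘(ℝ, E) g (a p) := by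
      refine ContinuousLinearMap.ext fun v ↦ ?_
      exact congrArg (mvfderiv 𝓘(ℝ, E) g (a p)) (ε.symm_apply_apply v)
    have h3 := h (D H) η fun v ↦ by
      obtain ⟨u, rfl⟩ := hD v
      rw [← hΩ, canonicalForm_hamiltonianVector, mvfderiv_comp_apply p hg ha, ← hℓ]
      exact congrArg (mvfderiv 𝓘(ℝ, E) g (a p)) (ε.symm_apply_apply _).symm
    rw [h2] at h3
    exact h3
  have h4 : mfderiv (cotangentModel E) 𝓘(ℝ, E) a p H =
      c • π.sharp (a p) (mvfderiv 𝓘(ℝ, E) g (a p)) := by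
    refine ε.injective ?_
    rw [map_smul, ← h1, ← hℓ]
    rfl
  rw [canonicalBracket, mvfderiv_comp_apply p hf ha, ← hH, h4, map_smul]
  rfl

end LocalBirealisation

/-! ### Gluing the time-one maps -/

section Gluing

set_option maxSynthPendingDepth 3

/-- Neighbourhoods `A i` of points of a metrizable space can be shrunk to neighbourhoods `B i` such
that any two of them that meet lie in a common `A k`. If `A i` contains the ball of radius `r i`,
the balls of radius `r i / 4` have this property. -/
theorem exists_mem_nhds_forall_inter_nonempty {N ι : Type*} [TopologicalSpace N]
    [TopologicalSpace.MetrizableSpace N] (z : ι → N) (A : ι → Set N) (hA : ∀ i, A i ∈ 𝓝 (z i)) :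
    ∃ B : ι → Set N, (∀ i, B i ∈ 𝓝 (z i)) ∧
      ∀ i j, (B i ∩ B j).Nonempty → ∃ k, B i ⊆ A k ∧ B j ⊆ A k := by
  let _ := TopologicalSpace.metrizableSpaceMetric N
  choose r hr hrA using fun i ↦ Metric.mem_nhds_iff.1 (hA i)
  have key (i j : ι) (hij : r j ≤ r i)
      (h : (Metric.ball (z i) (r i / 4) ∩ Metric.ball (z j) (r j / 4)).Nonempty) :
      Metric.ball (z i) (r i / 4) ⊆ A i ∧ Metric.ball (z j) (r j / 4) ⊆ A i := by
    obtain ⟨q, hqi, hqj⟩ := h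
    rw [Metric.mem_ball] at hqi hqj
    refine ⟨(Metric.ball_subset_ball (by linarith [hr i])).trans (hrA i), fun w hw ↦ hrA i ?_⟩
    rw [Metric.mem_ball] at hw ⊢
    have h1 := dist_triangle w (z j) (z i)
    have h2 := dist_triangle_left (z j) (z i) q
    linarith [hr i]
  refine ⟨fun i ↦ Metric.ball (z i) (r i / 4), fun i ↦ Metric.ball_mem_nhds _ (by linarith [hr i]),
    fun i j h ↦ ?_⟩
  rcases le_total (r j) (r i) with hij | hij
  · exact ⟨i, key i j hij h⟩
  · rw [inter_comm] at h
    exact ⟨j, (key j i hij h).symm⟩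

open Classical in
/-- An injective local diffeomorphism is a diffeomorphism onto its image. -/
theorem exists_partialDiffeomorph {F H N : Type*} [NormedAddCommGroup F] [NormedSpace ℝ F]
    [TopologicalSpace H] {J : ModelWithCorners ℝ F H} [TopologicalSpace N] [ChartedSpace H N]
    {ψ : N → N} {W : Set N} (hinj : InjOn ψ W)
    (hloc : ∀ p ∈ W, ∃ C ⊆ W, p ∈ C ∧ IsOpen C ∧ ContMDiffOn J J ∞ ψ C ∧ IsOpen (ψ '' C) ∧
      ∃ θ : N → N, ContMDiffOn J J ∞ θ (ψ '' C) ∧ ∀ q ∈ C, θ (ψ q) = q) :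
    ∃ Ψ : PartialDiffeomorph J J N N ∞, Ψ.source = W ∧ Ψ.target = ψ '' W ∧ ⇑Ψ = ψ := by
  have hopen : IsOpen W := isOpen_iff_mem_nhds.2 fun p hp ↦
    have ⟨_, hCW, hpC, hC, _⟩ := hloc p hp
    Filter.mem_of_superset (hC.mem_nhds hpC) hCW
  set g : N → N := fun q ↦ if h : ∃ p ∈ W, ψ p = q then h.choose else q with hg
  have hgψ {p : N} (hp : p ∈ W) : g (ψ p) = p := by
    have h : ∃ p' ∈ W, ψ p' = ψ p := ⟨p, hp, rfl⟩
    rw [hg]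
    simp only [dif_pos h]
    exact hinj h.choose_spec.1 hp h.choose_spec.2
  refine ⟨{ toFun := ψ, invFun := g, source := W, target := ψ '' W,
            map_source' := fun p hp ↦ mem_image_of_mem ψ hp, map_target' := ?_,
            left_inv' := fun p hp ↦ hgψ hp, right_inv' := ?_, open_source := hopen,
            open_target := ?_, contMDiffOn_toFun := ?_, contMDiffOn_invFun := ?_ }, rfl, rfl, rfl⟩
  · rintro _ ⟨p, hp, rfl⟩
    rwa [hgψ hp]
  · rintro _ ⟨p, hp, rfl⟩
    rw [hgψ hp]
  · refine isOpen_iff_mem_nhds.2 ?_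
    rintro _ ⟨p, hp, rfl⟩
    obtain ⟨C, hCW, hpC, -, -, hC, -⟩ := hloc p hp
    exact Filter.mem_of_superset (hC.mem_nhds (mem_image_of_mem ψ hpC)) (image_mono hCW)
  · intro p hp
    obtain ⟨C, -, hpC, hC, hs, -⟩ := hloc p hp
    exact (hs.contMDiffAt (hC.mem_nhds hpC)).contMDiffWithinAt
  · rintro _ ⟨p, hp, rfl⟩
    obtain ⟨C, hCW, hpC, -, -, hC, θ, hθ, hθψ⟩ := hloc p hp
    have h1 := hθ.contMDiffAt (hC.mem_nhds (mem_image_of_mem ψ hpC))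
    refine (h1.congr_of_eventuallyEq ?_).contMDiffWithinAt
    filter_upwards [hC.mem_nhds (mem_image_of_mem ψ hpC)] with q hq
    obtain ⟨p', hp', rfl⟩ := hq
    rw [hgψ (hCW hp'), hθψ p' hp']

variable {E : Type*} [NormedAddCommGroup E] [NormedSpace ℝ E] [FiniteDimensional ℝ E]
  {M : Type*} [TopologicalSpace M] [ChartedSpace E M] [IsManifold 𝓘(ℝ, E) ∞ M]
  [T2Space M] [SigmaCompactSpace M]

/-- The cotangent bundle is Hausdorff, second countable and locally compact. -/
theorem cotangentBundle_metrizableSpace :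
    TopologicalSpace.MetrizableSpace (CotangentBundle E M) := by
  have h1 : T2Space (CotangentBundle E M) := cotangentBundle_t2Space
  have h2 : SecondCountableTopology M := ChartedSpace.secondCountable_of_sigmaCompact E M
  have h3 : ProperSpace E := FiniteDimensional.proper ℝ E
  have h4 : ProperSpace (E →L[ℝ] ℝ) := FiniteDimensional.proper ℝ _
  have h5 : SecondCountableTopology (ModelProd E (E →L[ℝ] ℝ)) :=
    inferInstanceAs (SecondCountableTopology (E × (E →L[ℝ] ℝ)))
  obtain ⟨s, hs, hsU⟩ := TopologicalSpace.countable_cover_nhds fun x : M ↦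
    (chartAt E x).open_source.mem_nhds (mem_chart_source E x)
  have h6 : SecondCountableTopology (CotangentBundle E M) := by
    refine ChartedSpace.secondCountable_of_countable_cover (ModelProd E (E →L[ℝ] ℝ))
      (s := zeroCovector '' s) (eq_univ_of_forall fun p ↦ ?_) (hs.image _)
    obtain ⟨x, hx, hpx⟩ := mem_iUnion₂.1 (hsU.symm ▸ mem_univ p.1)
    refine mem_iUnion₂.2 ⟨zeroCovector x, mem_image_of_mem _ hx, ?_⟩
    rw [← extChartAt_source (cotangentModel E)]
    exact mem_cotangentChart_source.2 hpx
  have h7 : LocallyCompactSpace (CotangentBundle E M) :=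
    Manifold.locallyCompact_of_finiteDimensional (cotangentModel E)
  exact TopologicalSpace.metrizableSpace_of_t3_secondCountable _

open Classical in
/-- The end point maps of the Moser charts glue to a diffeomorphism between neighbourhoods of the
zero section. -/
theorem IsPoissonSpray.exists_partialDiffeomorph_endpoint {π : PoissonStructure E M}
    {X : ∀ p : CotangentBundle E M, TangentSpace (cotangentModel E) p}
    (hX : IsPoissonSpray π X) :
    ∃ Ψ : PartialDiffeomorph (cotangentModel E) (cotangentModel E)
        (CotangentBundle E M) (CotangentBundle E M) ∞,
      (∀ x, zeroCovector x ∈ Ψ.source) ∧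
      ∀ p ∈ Ψ.source, ∃ (x : M) (K : MoserChart π X x) (B C : Set (CotangentBundle E M)),
        K.IsTube B C ∧ p ∈ C ∧ EqOn Ψ K.endpoint C := by
  have hmet := cotangentBundle_metrizableSpace (E := E) (M := M)
  have K (x : M) : MoserChart π X x := (hX.nonempty_moserChart x).some
  obtain ⟨B, hB, hBB⟩ := exists_mem_nhds_forall_inter_nonempty (zeroCovector : M → _)
    (fun x ↦ (K x).region) fun x ↦ (K x).isOpen_region.mem_nhds (K x).zeroCovector_mem_region
  choose C hzC hC using fun x ↦ (K x).exists_isTube (hB x)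
  have h01 : (0 : ℝ) ∈ Icc (0 : ℝ) 1 := ⟨le_rfl, zero_le_one⟩
  have h11 : (1 : ℝ) ∈ Icc (0 : ℝ) 1 := ⟨zero_le_one, le_rfl⟩
  -- two Moser curves with a common end point lie in the region of one of the two charts
  have key {x y : M} {p q : CotangentBundle E M} (hp : p ∈ C x) (hq : q ∈ C y)
      (h : (K x).curve p 0 = (K y).curve q 0 ∨ (K x).curve p 1 = (K y).curve q 1) :
      EqOn ((K x).curve p) ((K y).curve q) (Icc 0 1) := by
    have hne : (B x ∩ B y).Nonempty := by
      rcases h with h | h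
      · exact ⟨_, (hC x).mem p hp 0 h01, h ▸ (hC y).mem q hq 0 h01⟩
      · exact ⟨_, (hC x).mem p hp 1 h11, h ▸ (hC y).mem q hq 1 h11⟩
    obtain ⟨k, hxk, hyk⟩ := hBB x y hne
    exact (K k).eqOn_of_isMoserCurve ((hC x).isMoserCurve hp) ((hC y).isMoserCurve hq)
      (fun t ht ↦ hxk ((hC x).mem p hp t ht)) (fun t ht ↦ hyk ((hC y).mem q hq t ht)) h
  have hcurve0 {x : M} {p : CotangentBundle E M} (hp : p ∈ C x) : (K x).curve p 0 = p :=
    (K x).curve_zero ((hC x).subset hp)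
  set ψ : CotangentBundle E M → CotangentBundle E M :=
    fun p ↦ if h : ∃ x, p ∈ C x then (K h.choose).endpoint p else p with hψ
  have hψeq (x : M) : EqOn ψ (K x).endpoint (C x) := fun p hp ↦ by
    have h : ∃ x, p ∈ C x := ⟨x, hp⟩
    rw [hψ]
    simp only [dif_pos h]
    exact key h.choose_spec hp (Or.inl ((hcurve0 h.choose_spec).trans (hcurve0 hp).symm)) h11
  have hinj : InjOn ψ (⋃ x, C x) := by
    intro p hp q hq hpq
    obtain ⟨x, hp⟩ := mem_iUnion.1 hp
    obtain ⟨y, hq⟩ := mem_iUnion.1 hq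
    rw [hψeq x hp, hψeq y hq] at hpq
    rw [← hcurve0 hp, ← hcurve0 hq]
    exact key hp hq (Or.inr hpq) h01
  obtain ⟨Ψ, hΨs, -, hΨ⟩ := exists_partialDiffeomorph (J := cotangentModel E) hinj fun p hp ↦ by
    obtain ⟨x, hp⟩ := mem_iUnion.1 hp
    refine ⟨C x, subset_iUnion C x, hp, (hC x).isOpen,
      (hC x).contMDiffOn_endpoint.congr (hψeq x), ?_, (K x).endpointInv, ?_, fun q hq ↦ ?_⟩
    · rw [(hψeq x).image_eq]
      exact (hC x).isOpen_image_endpoint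
    · rw [(hψeq x).image_eq]
      exact (hC x).contMDiffOn_endpointInv
    · rw [hψeq x hq, (hC x).endpointInv_endpoint hq]
  refine ⟨Ψ, fun x ↦ hΨs ▸ mem_iUnion.2 ⟨x, hzC x⟩, fun p hp ↦ ?_⟩
  rw [hΨs] at hp
  obtain ⟨x, hp⟩ := mem_iUnion.1 hp
  exact ⟨x, K x, B x, C x, hC x, hp, hΨ ▸ hψeq x⟩

end Gluing

/-! ### The bi-realisation -/

section Birealisation

set_option maxSynthPendingDepth 3

variable {E : Type*} [NormedAddCommGroup E] [NormedSpace ℝ E]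
  {M : Type*} [TopologicalSpace M] [ChartedSpace E M] [IsManifold 𝓘(ℝ, E) ∞ M]
  {π : PoissonStructure E M} {X : ∀ p : CotangentBundle E M, TangentSpace (cotangentModel E) p}

namespace MoserChart

variable {x : M} (K : MoserChart π X x) {ψ : CotangentBundle E M → CotangentBundle E M}
  {p : CotangentBundle E M}

/-- The derivative of `ψ` read in a cotangent chart around `ψ p`. -/
noncomputable def derivInChart (_ : MoserChart π X x)
    (ψ : CotangentBundle E M → CotangentBundle E M) (p : CotangentBundle E M)
    (u : TangentSpace (cotangentModel E) p) : E × (E →L[ℝ] ℝ) :=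
  cotangentChartDeriv x (ψ p) (mfderiv (cotangentModel E) (cotangentModel E) ψ p u)

theorem surjective_derivInChart
    (hp : ψ p ∈ K.region)
    (hsurj : Function.Surjective (mfderiv (cotangentModel E) (cotangentModel E) ψ p)) :
    Function.Surjective (K.derivInChart ψ p) := by
  obtain ⟨ε, hε⟩ := isInvertible_cotangentChartDeriv hp.1.1
  intro w
  obtain ⟨u, hu⟩ := hsurj (ε.symm w)
  refine ⟨u, ?_⟩
  rw [derivInChart, hu, ← hε]
  exact ε.apply_symm_apply w

theorem surjective_mfderiv_source
    (hp : ψ p ∈ K.region)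
    (hψ : MDifferentiableAt (cotangentModel E) (cotangentModel E) ψ p)
    (hsurj : Function.Surjective (mfderiv (cotangentModel E) (cotangentModel E) ψ p)) :
    Function.Surjective (mfderiv (cotangentModel E) 𝓘(ℝ, E) (cotangentProj ∘ ψ) p) := by
  intro v
  obtain ⟨ε, hε⟩ := isInvertible_chartDeriv (mem_cotangentChart_source.1 hp.1.1)
  obtain ⟨u, hu⟩ := K.surjective_derivInChart hp hsurj (ε v, 0)
  refine ⟨u, ε.injective ?_⟩
  have h1 := K.chartDeriv_mfderiv_source hp hψ u
  rw [← hε] at h1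
  exact h1.trans (congrArg Prod.fst hu)

theorem surjective_mfderiv_target [T2Space M]
    (hp : ψ p ∈ K.region)
    (hψ : MDifferentiableAt (cotangentModel E) (cotangentModel E) ψ p)
    (hsurj : Function.Surjective (mfderiv (cotangentModel E) (cotangentModel E) ψ p)) :
    Function.Surjective (mfderiv (cotangentModel E) 𝓘(ℝ, E) (cotangentProj ∘ flow X 1 ∘ ψ) p) := by
  intro v
  obtain ⟨ε, hε⟩ := isInvertible_chartDeriv
    (mem_cotangentChart_source.1 (K.flow_mem_source hp.1 ⟨zero_le_one, le_rfl⟩))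
  obtain ⟨w, hw⟩ := K.model.surjective_fderiv 1 (cotangentChart x (ψ p)) (ε v, 0)
  obtain ⟨u, rfl⟩ := K.surjective_derivInChart hp hsurj w
  refine ⟨u, ε.injective ?_⟩
  have h1 := K.chartDeriv_mfderiv_target hp hψ u
  rw [← hε] at h1
  exact h1.trans (congrArg Prod.fst hw)

theorem canonicalForm_eq_oneFormDeriv [T2Space M]
    (hp : ψ p ∈ K.region)
    (hform : ∀ u v : TangentSpace (cotangentModel E) p,
      canonicalForm p u v = averagedForm X (ψ p)
        (mfderiv (cotangentModel E) (cotangentModel E) ψ p u)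
        (mfderiv (cotangentModel E) (cotangentModel E) ψ p v))
    (u v : TangentSpace (cotangentModel E) p) :
    canonicalForm p u v = oneFormDeriv (averagedLiouville K.model.φ) (cotangentChart x (ψ p))
      (K.derivInChart ψ p u) (K.derivInChart ψ p v) := by
  rw [hform, K.averagedForm_eq hp.1]
  rfl

/-- The fibres of `τ ∘ ψ` and `τ ∘ Φ¹ ∘ ψ` are symplectically orthogonal. -/
theorem canonicalForm_eq_zero [FiniteDimensional ℝ E] [T2Space M]
    (hp : ψ p ∈ K.region)
    (hψ : MDifferentiableAt (cotangentModel E) (cotangentModel E) ψ p)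
    (hform : ∀ u v : TangentSpace (cotangentModel E) p,
      canonicalForm p u v = averagedForm X (ψ p)
        (mfderiv (cotangentModel E) (cotangentModel E) ψ p u)
        (mfderiv (cotangentModel E) (cotangentModel E) ψ p v))
    {u v : TangentSpace (cotangentModel E) p}
    (hu : mfderiv (cotangentModel E) 𝓘(ℝ, E) (cotangentProj ∘ ψ) p u = 0)
    (hv : mfderiv (cotangentModel E) 𝓘(ℝ, E) (cotangentProj ∘ flow X 1 ∘ ψ) p v = 0) :
    canonicalForm p u v = 0 := by
  rw [K.canonicalForm_eq_oneFormDeriv hp hform]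
  refine K.model.orthogonal K.isLocalSpray hp.1.2 ?_ ?_
  · refine (K.chartDeriv_mfderiv_source hp hψ u).symm.trans ?_
    exact (congrArg (chartDeriv x (ψ p).1) hu).trans (map_zero _)
  · refine (K.chartDeriv_mfderiv_target hp hψ v).symm.trans ?_
    exact (congrArg (chartDeriv x (flow X 1 (ψ p)).1) hv).trans (map_zero _)

/-- `τ ∘ ψ` is a Poisson map. -/
theorem canonicalBracket_source [FiniteDimensional ℝ E] [T2Space M]
    (hp : ψ p ∈ K.region)
    (hψ : MDifferentiableAt (cotangentModel E) (cotangentModel E) ψ p)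
    (hsurj : Function.Surjective (mfderiv (cotangentModel E) (cotangentModel E) ψ p))
    (hform : ∀ u v : TangentSpace (cotangentModel E) p,
      canonicalForm p u v = averagedForm X (ψ p)
        (mfderiv (cotangentModel E) (cotangentModel E) ψ p u)
        (mfderiv (cotangentModel E) (cotangentModel E) ψ p v))
    {f g : M → ℝ} (hf : ContMDiff 𝓘(ℝ, E) 𝓘(ℝ, ℝ) ∞ f)
    (hg : ContMDiff 𝓘(ℝ, E) 𝓘(ℝ, ℝ) ∞ g) :
    canonicalBracket (f ∘ (cotangentProj ∘ ψ)) (g ∘ (cotangentProj ∘ ψ)) p =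
      π.bracket f g ((cotangentProj ∘ ψ) p) := by
  have hs := mem_cotangentChart_source.1 hp.1.1
  have h1 := canonicalBracket_comp_eq (π := π) (a := cotangentProj ∘ ψ) (c := 1)
    (T := chartDeriv x (ψ p).1) (D := K.derivInChart ψ p) (ℓ := Prod.fst)
    (Ω := fun v w ↦ oneFormDeriv (averagedLiouville K.model.φ) (cotangentChart x (ψ p)) v w)
    ((hasMFDerivAt_cotangentProj (ψ p)).mdifferentiableAt.comp p hψ) (isInvertible_chartDeriv hs)
    (K.surjective_derivInChart hp hsurj) (K.chartDeriv_mfderiv_source hp hψ)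
    (K.canonicalForm_eq_oneFormDeriv hp hform)
    (fun w η hw ↦ by
      rw [K.model.fst_eq_of_forall_oneFormDeriv K.isLocalSpray hp.1.2
        (K.oneFormDeriv_nondegenerate hp) hw, cotangentChart_fst hs, one_smul,
        π.localTensor_extChartAt hs]
      rfl) (hf.mdifferentiableAt (by simp)) (hg.mdifferentiableAt (by simp))
  rwa [one_mul] at h1

/-- `τ ∘ Φ¹ ∘ ψ` is an anti-Poisson map. -/
theorem canonicalBracket_target [FiniteDimensional ℝ E] [T2Space M]
    (hp : ψ p ∈ K.region)
    (hψ : MDifferentiableAt (cotangentModel E) (cotangentModel E) ψ p)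
    (hsurj : Function.Surjective (mfderiv (cotangentModel E) (cotangentModel E) ψ p))
    (hform : ∀ u v : TangentSpace (cotangentModel E) p,
      canonicalForm p u v = averagedForm X (ψ p)
        (mfderiv (cotangentModel E) (cotangentModel E) ψ p u)
        (mfderiv (cotangentModel E) (cotangentModel E) ψ p v))
    {f g : M → ℝ} (hf : ContMDiff 𝓘(ℝ, E) 𝓘(ℝ, ℝ) ∞ f)
    (hg : ContMDiff 𝓘(ℝ, E) 𝓘(ℝ, ℝ) ∞ g) :
    canonicalBracket (f ∘ (cotangentProj ∘ flow X 1 ∘ ψ)) (g ∘ (cotangentProj ∘ flow X 1 ∘ ψ)) p =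
      -π.bracket f g ((cotangentProj ∘ flow X 1 ∘ ψ) p) := by
  have h11 : (1 : ℝ) ∈ Icc (0 : ℝ) 1 := ⟨zero_le_one, le_rfl⟩
  have hs := mem_cotangentChart_source.1 (K.flow_mem_source hp.1 h11)
  have h1 := canonicalBracket_comp_eq (π := π) (a := cotangentProj ∘ flow X 1 ∘ ψ) (c := -1)
    (T := chartDeriv x (flow X 1 (ψ p)).1) (D := K.derivInChart ψ p)
    (ℓ := fun w ↦ (fderiv ℝ (K.model.φ 1) (cotangentChart x (ψ p)) w).1)
    (Ω := fun v w ↦ oneFormDeriv (averagedLiouville K.model.φ) (cotangentChart x (ψ p)) v w)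
    ((hasMFDerivAt_cotangentProj (flow X 1 (ψ p))).mdifferentiableAt.comp p
      (((K.contMDiffAt_flow hp.1 h11).mdifferentiableAt (by simp)).comp p hψ))
    (isInvertible_chartDeriv hs)
    (K.surjective_derivInChart hp hsurj) (K.chartDeriv_mfderiv_target hp hψ)
    (K.canonicalForm_eq_oneFormDeriv hp hform)
    (fun w η hw ↦ by
      rw [K.model.fst_fderiv_eq_of_forall_oneFormDeriv K.isLocalSpray hp.1.2
        (K.oneFormDeriv_nondegenerate hp) hw, ← K.cotangentChart_flow hp.1 h11,
        cotangentChart_fst hs, neg_one_smul, π.localTensor_extChartAt hs]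
      rfl) (hf.mdifferentiableAt (by simp)) (hg.mdifferentiableAt (by simp))
  rwa [neg_one_mul] at h1

end MoserChart

/-- A diffeomorphism `ψ` between neighbourhoods of the zero section that fixes the zero
section and satisfies `ψ^* Ω = ω` yields a bi-realisation. -/
theorem isBirealisation_of_canonicalForm_eq [FiniteDimensional ℝ E] [T2Space M]
    (ψ : PartialDiffeomorph (cotangentModel E) (cotangentModel E)
      (CotangentBundle E M) (CotangentBundle E M) ∞)
    (hz : ∀ x : M, zeroCovector x ∈ ψ.source)
    (hψz : ∀ x : M, ψ (zeroCovector x) = zeroCovector x)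
    (hloc : ∀ p ∈ ψ.source, ∃ (x : M) (K : MoserChart π X x), ψ p ∈ K.region)
    (hform : ∀ p ∈ ψ.source, ∀ u v : TangentSpace (cotangentModel E) p,
      canonicalForm p u v = averagedForm X (ψ p)
        (mfderiv (cotangentModel E) (cotangentModel E) ψ p u)
        (mfderiv (cotangentModel E) (cotangentModel E) ψ p v)) :
    IsBirealisation π ψ.source (cotangentProj ∘ ψ) (cotangentProj ∘ flow X 1 ∘ ψ) := by
  have h11 : (1 : ℝ) ∈ Icc (0 : ℝ) 1 := ⟨zero_le_one, le_rfl⟩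
  have hsm (p) (hp : p ∈ ψ.source) : ContMDiffAt (cotangentModel E) (cotangentModel E) ∞ ψ p :=
    ψ.contMDiffOn_toFun.contMDiffAt (ψ.open_source.mem_nhds hp)
  have hd (p) (hp : p ∈ ψ.source) :
      MDifferentiableAt (cotangentModel E) (cotangentModel E) ψ p :=
    (hsm p hp).mdifferentiableAt (by simp)
  have hsurj (p) (hp : p ∈ ψ.source) :
      Function.Surjective (mfderiv (cotangentModel E) (cotangentModel E) ψ p) := by
    have h1 : IsLocalDiffeomorphAt (cotangentModel E) (cotangentModel E) ∞ ψ p :=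
      ⟨ψ, hp, fun _ _ ↦ rfl⟩
    have h2 := h1.mfderivToContinuousLinearEquiv_coe (by simp)
    rw [← h2]
    exact (h1.mfderivToContinuousLinearEquiv (by simp)).surjective
  have htz (x : M) : (cotangentProj ∘ flow X 1 ∘ ψ) (zeroCovector x) = x := by
    obtain ⟨y, K, hK⟩ := hloc _ (hz x)
    rw [hψz] at hK
    change (flow X 1 (ψ (zeroCovector x))).1 = x
    rw [hψz, K.flow_zeroCovector hK.1 h11]
    rfl
  have hsz (x : M) : (cotangentProj ∘ ψ) (zeroCovector x) = x := by
    change (ψ (zeroCovector x)).1 = x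
    rw [hψz]
    rfl
  exact
    { isOpen := ψ.open_source
      zero_mem := hz
      contMDiffOn_source := contMDiff_cotangentProj.comp_contMDiffOn ψ.contMDiffOn_toFun
      contMDiffOn_target := fun p hp ↦ by
        obtain ⟨x, K, hK⟩ := hloc p hp
        exact ((contMDiff_cotangentProj _).comp p
          ((K.contMDiffAt_flow hK.1 h11).comp p (hsm p hp))).contMDiffWithinAt
      surjOn_source := fun x _ ↦ ⟨zeroCovector x, hz x, hsz x⟩
      surjOn_target := fun x _ ↦ ⟨zeroCovector x, hz x, htz x⟩
      submersion_source := fun p hp ↦ by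
        obtain ⟨x, K, hK⟩ := hloc p hp
        exact K.surjective_mfderiv_source hK (hd p hp) (hsurj p hp)
      submersion_target := fun p hp ↦ by
        obtain ⟨x, K, hK⟩ := hloc p hp
        exact K.surjective_mfderiv_target hK (hd p hp) (hsurj p hp)
      source_zero := hsz
      target_zero := htz
      poisson := fun f g hf hg p hp ↦ by
        obtain ⟨x, K, hK⟩ := hloc p hp
        exact K.canonicalBracket_source hK (hd p hp) (hsurj p hp) (hform p hp) hf hg
      antiPoisson := fun f g hf hg p hp ↦ by
        obtain ⟨x, K, hK⟩ := hloc p hp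
        exact K.canonicalBracket_target hK (hd p hp) (hsurj p hp) (hform p hp) hf hg
      orthogonal := fun p hp u v hu hv ↦ by
        obtain ⟨x, K, hK⟩ := hloc p hp
        exact K.canonicalForm_eq_zero hK (hd p hp) (hform p hp) hu hv }

end Birealisation

theorem mainTheorem2 {E : Type*} [NormedAddCommGroup E] [NormedSpace ℝ E] [FiniteDimensional ℝ E]
    {M : Type*} [TopologicalSpace M] [ChartedSpace E M] [IsManifold 𝓘(ℝ, E) ∞ M]
    [T2Space M] [SigmaCompactSpace M]
    (π : PoissonStructure E M)
    (X : ∀ p : CotangentBundle E M, TangentSpace (cotangentModel E) p)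
    (hX : IsPoissonSpray π X) :
    ∃ ψ : PartialDiffeomorph (cotangentModel E) (cotangentModel E)
        (CotangentBundle E M) (CotangentBundle E M) ∞,
      -- `ψ : W → V` is defined near the zero section and is the identity on it
      (∀ x : M, zeroCovector x ∈ ψ.source ∧ ψ (zeroCovector x) = zeroCovector x) ∧
      -- on `V = ψ(W)` the flow of `X` exists up to time `1` and is smooth in time and point
      ψ.target ⊆ flowDomain X 1 ∧
      ContMDiffOn (𝓘(ℝ, ℝ).prod (cotangentModel E)) (cotangentModel E) ∞
        (fun q : ℝ × CotangentBundle E M ↦ flow X q.1 q.2) (Icc 0 1 ×ˢ ψ.target) ∧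
      -- `ω = ψ^* Ω` on `W`
      (∀ p ∈ ψ.source, ∀ u v : TangentSpace (cotangentModel E) p,
        canonicalForm p u v = averagedForm X (ψ p)
          (mfderiv (cotangentModel E) (cotangentModel E) ψ p u)
          (mfderiv (cotangentModel E) (cotangentModel E) ψ p v)) ∧
      -- `(W, τ ∘ ψ, τ ∘ Φ¹ ∘ ψ)` is a bi-realisation
      IsBirealisation π ψ.source (cotangentProj ∘ ψ) (cotangentProj ∘ flow X 1 ∘ ψ) := by
  obtain ⟨ψ, hz, hloc⟩ := hX.exists_partialDiffeomorph_endpoint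
  have hψz (x : M) : ψ (zeroCovector x) = zeroCovector x := by
    obtain ⟨y, K, B, C, hC, hp, hψ⟩ := hloc _ (hz x)
    rw [hψ hp, K.endpoint_zeroCovector (hC.subset_region hp)]
  have hdom (q : CotangentBundle E M) (hq : q ∈ ψ.target) :
      ∃ (x : M) (K : MoserChart π X x), q ∈ K.region := by
    obtain ⟨x, K, B, C, hC, hp, hψ⟩ := hloc _ (ψ.map_target hq)
    refine ⟨x, K, ?_⟩
    have h2 := hC.endpoint_mem_region hp
    rwa [← hψ hp, ψ.right_inv hq] at h2
  have hform : ∀ p ∈ ψ.source, ∀ u v : TangentSpace (cotangentModel E) p,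
        canonicalForm p u v = averagedForm X (ψ p)
          (mfderiv (cotangentModel E) (cotangentModel E) ψ p u)
          (mfderiv (cotangentModel E) (cotangentModel E) ψ p v) := by
    intro p hp u v
    obtain ⟨x, K, B, C, hC, hp, hψ⟩ := hloc p hp
    have h2 : ψ =ᶠ[𝓝 p] K.endpoint := Filter.eventuallyEq_of_mem (hC.isOpen.mem_nhds hp) hψ
    rw [h2.mfderiv_eq, hψ hp]
    exact hC.canonicalForm_eq hp u v
  refine ⟨ψ, fun x ↦ ⟨hz x, hψz x⟩, fun q hq ↦ ?_, ?_, hform, ?_⟩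
  · obtain ⟨x, K, hK⟩ := hdom q hq
    exact K.dom_subset_flowDomain hK.1
  · rintro ⟨s, q⟩ ⟨hs, hq⟩
    obtain ⟨x, K, hK⟩ := hdom q hq
    refine (K.contMDiffOn_flow (s, q) ⟨hs, hK.1⟩).mono_of_mem_nhdsWithin ?_
    rw [nhdsWithin_prod_eq]
    exact Filter.prod_mem_prod self_mem_nhdsWithin
      (mem_nhdsWithin_of_mem_nhds (K.isOpen_dom.mem_nhds hK.1))
  · refine isBirealisation_of_canonicalForm_eq ψ hz hψz (fun p hp ↦ ?_) hform
    exact hdom _ (ψ.map_source hp)
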